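/- **Setting.** There are $n$ agents, $\mathcal N=\{1,\dots,n\}$; agent $i$ has a cost $c_i>0$ of exerting effort. A monotone function $f:2^{\mathcal N}\to[0,1]$ with $f(\emptyset)=0$ gives the success probability (the reward) $f(S)$ of the project when exactly the agents in $S$ exert effort. It is *additive*: $f(S)=\sum_{i\in S}f(\{i\})$ for all $S$. A *team contract* $(S,\alpha)$ consists of a team $S\subseteq\mathcal N$ and shares $\alpha_i\in[0,1]$ for $i\in S$, with $\alpha_i=0$ for $i\notin S$; only *feasible* contracts are considered, i.e. $\alpha_i f(S)-c_i\ge\alpha_i f(S\setminus\{i\})$ for all $i\in S$. A set $E\subseteq S$ is an *equilibrium* of $(S,\alpha)$ if $\alpha_i f(E)-c_i\ge\alpha_i f(E\setminus\{i\})$ for $i\in E$ and $\alpha_i f(E\cup\{i\})-c_i<\alpha_i f(E)$ for $i\in S\setminus E$. The contract $(S,\alpha)$ is *fair* if for all $i,j\in S$, with $\hat\alpha$ obtained from $\alpha$ by swapping $\alpha_i$ and $\alpha_j$, there is an equilibrium $E$ of $(S,\hat\alpha)$ with $$\alpha_i f(S)-c_i\ge\alpha_j f(E)-c_i\mathbf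 1[i\in E],\qquad \alpha_j f(S)-c_j\ge\alpha_i f(E)-c_j\mathbf 1[j\in E].$$ The *revenue* is $\mathrm{Rev}(S,\alpha)=\bigl(1-\sum_{i\in S}\alpha_i\bigr)f(S)$, and $\mathrm{OPT}$ is the maximum of the revenue over all feasible fair contracts. **Theorem (FPTAS for additive rewards).** For every instance with additive rewards an optimal feasible fair contract exists, and there is a single algorithm which, given $n$, the costs $c_i$, the individual rewards $f(\{i\})$ and $\gamma\in(0,1]$, returns a feasible fair contract of revenue at least $(1-\gamma)^2\cdot\mathrm{OPT}$, in polynomial time in the following two senses. 1. On arbitrary real data, the algorithm, run on a random access machine that performs the operations $+,-,\times,/,<$ on real numbers (without rounding) and $+,-,<$ on integers (used for counting and addressing) at unit cost, takes time polynomial in $n$ and $1/\gamma$. 2. If all $c_i$, all $f(\{i\})$ and $\gamma$ are rational, then the running time of the same algorithm, run in exact rational arithmetic where every number handled is charged its binary length (logarithmic cost criterion), is polynomial in the binary length of the input $(n,(c_i)_i,(f(\{i\}))_i,\gamma)$ and $1/\gamma$. -/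

import Mathlib

noncomputable section

namespace FairTeam

/-! ## Team contracts -/

/-- A team-contract problem with `n` agents: positive effort costs, and a monotone normalized
success probability `reward S` for every set `S` of agents that exert effort. -/
structure TeamInstance (n : ℕ) where
  cost : Fin n → ℝ
  reward : Finset (Fin n) → ℝ
  cost_pos : ∀ i, 0 < cost i
  reward_mem : ∀ S, reward S ∈ Set.Icc (0 : ℝ) 1
  reward_mono : Monotone reward
  reward_empty : reward ∅ = 0

/-- A team together with the linear contract (share) of every agent. -/
@[ext]
structure TeamContract (n : ℕ) where
  team : Finset (Fin n)
  share : Fin n → ℝ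

namespace TeamInstance

variable {n : ℕ} (I : TeamInstance n)

/-- The reward function is additive. -/
def IsAdditive : Prop :=
  ∀ S : Finset (Fin n), I.reward S = ∑ i ∈ S, I.reward {i}

/-- `E` is a pure Nash equilibrium of the team `S` under the shares `α`
(indifferent agents exert effort). -/
def IsEquilibrium (S : Finset (Fin n)) (α : Fin n → ℝ) (E : Finset (Fin n)) : Prop :=
  E ⊆ S ∧
  (∀ i ∈ E, α i * I.reward (E \ {i}) ≤ α i * I.reward E - I.cost i) ∧
  (∀ i ∈ S \ E, α i * I.reward (E ∪ {i}) - I.cost i < α i * I.reward E)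

/-- All shares lie in `[0, 1]`, agents outside the team get nothing, and every member of the team
is willing to exert effort when all the others do. -/
def IsFeasible (A : TeamContract n) : Prop :=
  (∀ i ∈ A.team, A.share i ∈ Set.Icc (0 : ℝ) 1) ∧
  (∀ i ∉ A.team, A.share i = 0) ∧
  (∀ i ∈ A.team,
    A.share i * I.reward (A.team \ {i}) ≤ A.share i * I.reward A.team - I.cost i)

/-- Fairness: for any two members, after swapping their shares there is an equilibrium in which
neither of them is better off than under the original contract. -/
def IsFair (A : TeamContract n) : Prop :=
  ∀ i ∈ A.team, ∀ j ∈ A.team, ∃ E : Finset (Fin n),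
    I.IsEquilibrium A.team (fun k => A.share (Equiv.swap i j k)) E ∧
    A.share j * I.reward E - (if i ∈ E then I.cost i else 0)
      ≤ A.share i * I.reward A.team - I.cost i ∧
    A.share i * I.reward E - (if j ∈ E then I.cost j else 0)
      ≤ A.share j * I.reward A.team - I.cost j

/-- The expected revenue of the principal. -/
def revenue (A : TeamContract n) : ℝ :=
  (1 - ∑ i ∈ A.team, A.share i) * I.reward A.team

/-- A revenue-maximal contract among the feasible fair ones. Its revenue is `OPT`. -/
def IsOptimalFair (A : TeamContract n) : Prop :=
  I.IsFeasible A ∧ I.IsFair A ∧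
    ∀ B : TeamContract n, I.IsFeasible B → I.IsFair B → I.revenue B ≤ I.revenue A

/-- `A` is a (feasible) fair contract, an optimal fair contract exists, and the revenue of `A` is
at least `ρ · OPT`. -/
def IsApproxOptimalFair (ρ : ℝ) (A : TeamContract n) : Prop :=
  I.IsFeasible A ∧ I.IsFair A ∧
    ∃ B : TeamContract n, I.IsOptimalFair B ∧ ρ * I.revenue B ≤ I.revenue A

end TeamInstance

/-! ## The machine model

Random access machines with arithmetic over an ordered field `K`, as a structured programming
language. A store consists of integer arrays and of arrays of elements of `K`; a program mentions
finitely many of them, by number. Integers are used for counting and addressing and can only be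
added and subtracted. Elements of `K` can be combined by field operations and compared, but
there is no rounding and no conversion of an element of `K` to an integer. -/

structure Store (K : Type) where
  int : ℕ → ℕ → ℕ
  val : ℕ → ℕ → K

/-- Integer expressions: numerals, cell `e` of integer array `a`, sum, truncated difference. -/
inductive IntExpr : Type
  | const (k : ℕ)
  | cell (a : ℕ) (e : IntExpr)
  | add (e₁ e₂ : IntExpr)
  | sub (e₁ e₂ : IntExpr)

/-- Field expressions: numerals, cell `e` of value array `a`, and the four field operations. -/
inductive ValExpr : Type
  | const (k : ℕ)
  | cell (a : ℕ) (e : IntExpr)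
  | add (v₁ v₂ : ValExpr)
  | sub (v₁ v₂ : ValExpr)
  | mul (v₁ v₂ : ValExpr)
  | div (v₁ v₂ : ValExpr)

inductive Test : Type
  | intLt (e₁ e₂ : IntExpr)
  | valLt (v₁ v₂ : ValExpr)
  | not (b : Test)

/-- Programs. `setInt a e e'` writes the value of `e'` to cell `e` of integer array `a`, and
`setVal a e v` writes the value of `v` to cell `e` of value array `a`. -/
inductive Prog : Type
  | skip
  | setInt (a : ℕ) (e e' : IntExpr)
  | setVal (a : ℕ) (e : IntExpr) (v : ValExpr)
  | seq (P Q : Prog)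
  | cond (b : Test) (P Q : Prog)
  | loop (b : Test) (P : Prog)

/-- The charge for handling one number. -/
structure CostModel (K : Type) where
  int : ℕ → ℕ
  val : K → ℕ

/-- The uniform cost criterion: every number costs one unit. -/
def unitCost (K : Type) : CostModel K where
  int _ := 1
  val _ := 1

/-- The binary length of a rational number in lowest terms, including its sign. -/
def ratBits (q : ℚ) : ℕ := 1 + Nat.size q.num.natAbs + Nat.size q.den

/-- The logarithmic cost criterion: every number costs its binary length. -/
def bitCost : CostModel ℚ where
  int k := 1 + Nat.size k
  val q := ratBits q

section Semantics

variable {K : Type}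

def IntExpr.eval (σ : Store K) : IntExpr → ℕ
  | const k => k
  | cell a e => σ.int a (e.eval σ)
  | add e₁ e₂ => e₁.eval σ + e₂.eval σ
  | sub e₁ e₂ => e₁.eval σ - e₂.eval σ

/-- The total charge for all numbers that occur in the evaluation. -/
def IntExpr.cost (m : CostModel K) (σ : Store K) : IntExpr → ℕ
  | const k => m.int k
  | cell a e => e.cost m σ + m.int ((cell a e).eval σ)
  | add e₁ e₂ => e₁.cost m σ + e₂.cost m σ + m.int ((add e₁ e₂).eval σ)
  | sub e₁ e₂ => e₁.cost m σ + e₂.cost m σ + m.int ((sub e₁ e₂).eval σ)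

variable [Field K]

/-- Division by zero returns zero. -/
def ValExpr.eval (σ : Store K) : ValExpr → K
  | const k => (k : K)
  | cell a e => σ.val a (e.eval σ)
  | add v₁ v₂ => v₁.eval σ + v₂.eval σ
  | sub v₁ v₂ => v₁.eval σ - v₂.eval σ
  | mul v₁ v₂ => v₁.eval σ * v₂.eval σ
  | div v₁ v₂ => v₁.eval σ / v₂.eval σ

def ValExpr.cost (m : CostModel K) (σ : Store K) : ValExpr → ℕ
  | const k => m.val (k : K)
  | cell a e => e.cost m σ + m.val ((cell a e).eval σ)
  | add v₁ v₂ => v₁.cost m σ + v₂.cost m σ + m.val ((add v₁ v₂).eval σ)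
  | sub v₁ v₂ => v₁.cost m σ + v₂.cost m σ + m.val ((sub v₁ v₂).eval σ)
  | mul v₁ v₂ => v₁.cost m σ + v₂.cost m σ + m.val ((mul v₁ v₂).eval σ)
  | div v₁ v₂ => v₁.cost m σ + v₂.cost m σ + m.val ((div v₁ v₂).eval σ)

def Test.cost (m : CostModel K) (σ : Store K) : Test → ℕ
  | intLt e₁ e₂ => 1 + e₁.cost m σ + e₂.cost m σ
  | valLt v₁ v₂ => 1 + v₁.cost m σ + v₂.cost m σ
  | not b => 1 + b.cost m σ

variable [LinearOrder K]

def Test.Holds (σ : Store K) : Test → Prop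
  | intLt e₁ e₂ => e₁.eval σ < e₂.eval σ
  | valLt v₁ v₂ => v₁.eval σ < v₂.eval σ
  | not b => ¬ b.Holds σ

def Store.setInt (σ : Store K) (a i k : ℕ) : Store K where
  int := Function.update σ.int a (Function.update (σ.int a) i k)
  val := σ.val

def Store.setVal (σ : Store K) (a i : ℕ) (x : K) : Store K where
  int := σ.int
  val := Function.update σ.val a (Function.update (σ.val a) i x)

/-- `Exec m P σ t τ`: the program `P`, started in the store `σ`, halts in the store `τ`, and the
running time under the cost model `m` is `t`. -/
inductive Exec (m : CostModel K) : Prog → Store K → ℕ → Store K → Prop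
  | skip (σ : Store K) : Exec m Prog.skip σ 1 σ
  | setInt (a : ℕ) (e e' : IntExpr) (σ : Store K) :
      Exec m (Prog.setInt a e e') σ (1 + e.cost m σ + e'.cost m σ)
        (σ.setInt a (e.eval σ) (e'.eval σ))
  | setVal (a : ℕ) (e : IntExpr) (v : ValExpr) (σ : Store K) :
      Exec m (Prog.setVal a e v) σ (1 + e.cost m σ + v.cost m σ)
        (σ.setVal a (e.eval σ) (v.eval σ))
  | seq {P Q : Prog} {σ σ₁ σ₂ : Store K} {t₁ t₂ : ℕ} :
      Exec m P σ t₁ σ₁ → Exec m Q σ₁ t₂ σ₂ → Exec m (Prog.seq P Q) σ (t₁ + t₂) σ₂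
  | condTrue {b : Test} {P Q : Prog} {σ τ : Store K} {t : ℕ} :
      b.Holds σ → Exec m P σ t τ → Exec m (Prog.cond b P Q) σ (b.cost m σ + t) τ
  | condFalse {b : Test} {P Q : Prog} {σ τ : Store K} {t : ℕ} :
      ¬ b.Holds σ → Exec m Q σ t τ → Exec m (Prog.cond b P Q) σ (b.cost m σ + t) τ
  | loopTrue {b : Test} {P : Prog} {σ σ₁ σ₂ : Store K} {t₁ t₂ : ℕ} :
      b.Holds σ → Exec m P σ t₁ σ₁ → Exec m (Prog.loop b P) σ₁ t₂ σ₂ →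
      Exec m (Prog.loop b P) σ (b.cost m σ + t₁ + t₂) σ₂
  | loopFalse {b : Test} {P : Prog} {σ : Store K} :
      ¬ b.Holds σ → Exec m (Prog.loop b P) σ (b.cost m σ) σ

/-- The initial store. Cell `0` of integer array `0` holds `n`; the value arrays `0` and `1` hold
the costs and the individual rewards; cell `0` of value array `2` holds `γ`; all the rest is `0`. -/
def inputStore {n : ℕ} (c f : Fin n → K) (γ : K) : Store K where
  int a i := if a = 0 ∧ i = 0 then n else 0
  val a i :=
    if a = 0 then (if h : i < n then c ⟨i, h⟩ else 0)
    else if a = 1 then (if h : i < n then f ⟨i, h⟩ else 0)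
    else if a = 2 ∧ i = 0 then γ
    else 0

end Semantics

/-- The contract written by a program: agent `i` is in the team iff cell `i` of integer array `1`
is `1`, and the share of agent `i` is in cell `i` of value array `3`. -/
def outputContract {K : Type} (toReal : K → ℝ) (n : ℕ) (σ : Store K) : TeamContract n where
  team := Finset.univ.filter fun i : Fin n => σ.int 1 i = 1
  share i := toReal (σ.val 3 i)

/-- The binary length of an additive instance with rational data. -/
def instanceSize {n : ℕ} (c f : Fin n → ℚ) : ℕ :=
  n + ∑ i, (ratBits (c i) + ratBits (f i))

end FairTeam

end

/-! Economics. Under additive rewards an agent works exactly when its share is at least its price `c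
i / f i`, whatever the others do. Suppose `α j > α i`. After the swap everybody except possibly `j`
still works, so `i` can be free of envy only if `α i` is at least `c j / f j - c j / f(S)`. Hence a
fair contract pays each member of `S` at least the maximum of its price and `threshold`
(`cheapest_share_le`). Paying exactly this is fair (`isFair_cheapest`): a share above the threshold
equals a price, so its owner stops working as soon as it gets a smaller share. Thus OPT is the
maximum of `teamRevenue` over the finitely many teams with `c k ≤ f k` for all members.

Approximation. Let `S` be a team of nonnegative revenue. Guess its member `e` of largest reward,
measure rewards in units of `δ = f e / N` with `N = n * ⌈1 / γ⌉`, guess the number `a + 1` of units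
of `S`, and put `x = (a + 1) * δ`. Rounding loses at most `n * δ ≤ γ * f e`, so `(1 - γ) * f(S) ≤ x
≤ f(S)`. Also guess the member `j` that maximizes `c j / f j - c j / x`; call the maximum `T`. As `x
≤ f(S)`, `T` is at most the threshold of `S`. With `T` and `x` fixed it remains to minimize `∑ max
(c k / f k) T` over admissible teams of at least `a + 1` units, a knapsack problem solved by dynamic
programming (`IsCell`).

The delicate point is that the team `R` found may have `f(R) > x`, and then its true threshold may
exceed `T`. In that case the true revenue of `R` is the value at `f(R)` of an affine function whose
value at `x` bounds the computed revenue. If the slope is nonnegative, `R` itself is good enough; if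
it is negative, the member that attains the threshold is good enough alone
(`le_teamRevenue_or_singleton`). So the best of all candidates and all singletons has revenue at
least `(1 - γ) * OPT`, which is more than required (`mul_teamRevenue_le_of_candidates`).

Running time. One program is verified once, over an ordered field with an abstract notion of size
(`SizeModel`) that covers both cost criteria. Every number stored has a closed form in the input,
such as a sum over a subset of the agents, so sizes do not compound along loops; `Budget` collects
these bounds and `budget_of_le` proves them. With bounds on all cells and all loop lengths, the time
is bounded by recursion on the program (`Prog.timeBound`), and the rules for `Runs` give
termination, time, sizes and correctness together (`fptas_spec`, `exec_fptas`). -/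

namespace FairTeam

/-! ## Static analysis of programs -/

/-- The number of nodes, numerals counted in unary. -/
def IntExpr.weight : IntExpr → ℕ
  | const k => k + 1
  | cell _ e => e.weight + 1
  | add e₁ e₂ => e₁.weight + e₂.weight + 1
  | sub e₁ e₂ => e₁.weight + e₂.weight + 1

/-- The number of nodes, numerals counted in unary. -/
def ValExpr.weight : ValExpr → ℕ
  | const k => k + 1
  | cell _ e => e.weight + 1
  | add v₁ v₂ => v₁.weight + v₂.weight + 1
  | sub v₁ v₂ => v₁.weight + v₂.weight + 1
  | mul v₁ v₂ => v₁.weight + v₂.weight + 1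
  | div v₁ v₂ => v₁.weight + v₂.weight + 1

def Test.weight : Test → ℕ
  | intLt e₁ e₂ => e₁.weight + e₂.weight + 1
  | valLt v₁ v₂ => v₁.weight + v₂.weight + 1
  | not b => b.weight + 1

/-- Does the program write to integer array `b`? -/
def Prog.writesInt : Prog → ℕ → Bool
  | skip, _ => false
  | setInt a _ _, b => a == b
  | setVal _ _ _, _ => false
  | seq P Q, b => P.writesInt b || Q.writesInt b
  | cond _ P Q, b => P.writesInt b || Q.writesInt b
  | loop _ P, b => P.writesInt b

/-- Does the program write to value array `b`? -/
def Prog.writesVal : Prog → ℕ → Bool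
  | skip, _ => false
  | setInt _ _ _, _ => false
  | setVal a _ _, b => a == b
  | seq P Q, b => P.writesVal b || Q.writesVal b
  | cond _ P Q, b => P.writesVal b || Q.writesVal b
  | loop _ P, b => P.writesVal b

/-- A bound for the cost of an expression of weight `w` in a store all of whose cells have
size at most `B`. -/
def charge (B w : ℕ) : ℕ := 6 * w * w * (B + 1)

/-- A bound for the running time if all cells have size at most `B` and every loop makes at most
`L` rounds whenever it is entered. -/
def Prog.timeBound (B L : ℕ) : Prog → ℕ
  | skip => 1
  | setInt _ e e' => 1 + charge B e.weight + charge B e'.weight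
  | setVal _ e v => 1 + charge B e.weight + charge B v.weight
  | seq P Q => P.timeBound B L + Q.timeBound B L
  | cond b P Q => charge B b.weight + (P.timeBound B L + Q.timeBound B L)
  | loop b P => L * (charge B b.weight + P.timeBound B L) + charge B b.weight

/-- A loop multiplies the bound for its body by `L`, which raises the degree by one. Since the
program is fixed, the degree is a constant. -/
theorem Prog.exists_timeBound_le (P : Prog) :
    ∃ C d : ℕ, ∀ B L, P.timeBound B L ≤ C * ((B + 1) * (L + 1)) ^ d := by
  have hX : ∀ B L : ℕ, 1 ≤ (B + 1) * (L + 1) := fun B L => Nat.succ_le_of_lt (by positivity)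
  have hc : ∀ B L w : ℕ, charge B w ≤ 6 * w * w * ((B + 1) * (L + 1)) ^ 1 := by
    intro B L w
    rw [charge, pow_one]
    exact Nat.mul_le_mul_left _ (Nat.le_mul_of_pos_right _ (by omega))
  have lift : ∀ B L a d e C, d ≤ e → a ≤ C * ((B + 1) * (L + 1)) ^ d →
      a ≤ C * ((B + 1) * (L + 1)) ^ e := fun B L a d e C h h' =>
    h'.trans (Nat.mul_le_mul_left _ (Nat.pow_le_pow_right (hX B L) h))
  induction P with
  | skip => exact ⟨1, 0, fun B L => by simp [timeBound]⟩
  | setInt a e e' =>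
    refine ⟨1 + 6 * e.weight * e.weight + 6 * e'.weight * e'.weight, 1, fun B L => ?_⟩
    have h₁ := hc B L e.weight
    have h₂ := hc B L e'.weight
    have h₃ : 1 ≤ ((B + 1) * (L + 1)) ^ 1 := by simpa using hX B L
    generalize ((B + 1) * (L + 1)) ^ 1 = X at *
    simp only [timeBound, add_mul, one_mul]
    omega
  | setVal a e v =>
    refine ⟨1 + 6 * e.weight * e.weight + 6 * v.weight * v.weight, 1, fun B L => ?_⟩
    have h₁ := hc B L e.weight
    have h₂ := hc B L v.weight
    have h₃ : 1 ≤ ((B + 1) * (L + 1)) ^ 1 := by simpa using hX B L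
    generalize ((B + 1) * (L + 1)) ^ 1 = X at *
    simp only [timeBound, add_mul, one_mul]
    omega
  | seq P Q hP hQ =>
    obtain ⟨C₁, d₁, h₁⟩ := hP
    obtain ⟨C₂, d₂, h₂⟩ := hQ
    refine ⟨C₁ + C₂, d₁ + d₂, fun B L => ?_⟩
    have h₁ := lift B L _ _ (d₁ + d₂) _ (by omega) (h₁ B L)
    have h₂ := lift B L _ _ (d₁ + d₂) _ (by omega) (h₂ B L)
    generalize ((B + 1) * (L + 1)) ^ (d₁ + d₂) = X at *
    simp only [timeBound, add_mul]
    omega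
  | cond b P Q hP hQ =>
    obtain ⟨C₁, d₁, h₁⟩ := hP
    obtain ⟨C₂, d₂, h₂⟩ := hQ
    refine ⟨6 * b.weight * b.weight + (C₁ + C₂), d₁ + d₂ + 1, fun B L => ?_⟩
    have h₁ := lift B L _ _ (d₁ + d₂ + 1) _ (by omega) (h₁ B L)
    have h₂ := lift B L _ _ (d₁ + d₂ + 1) _ (by omega) (h₂ B L)
    have h₃ := lift B L _ _ (d₁ + d₂ + 1) _ (by omega) (hc B L b.weight)
    generalize ((B + 1) * (L + 1)) ^ (d₁ + d₂ + 1) = X at *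
    simp only [timeBound, add_mul]
    omega
  | loop b P hP =>
    obtain ⟨C₁, d₁, h₁⟩ := hP
    refine ⟨(6 * b.weight * b.weight + C₁) + 6 * b.weight * b.weight, d₁ + 1 + 1,
      fun B L => ?_⟩
    have h₁ := lift B L _ _ (d₁ + 1) _ (by omega) (h₁ B L)
    have h₂ := lift B L _ _ (d₁ + 1) _ (by omega) (hc B L b.weight)
    have h₃ := lift B L _ _ (d₁ + 1 + 1) _ (by omega) (hc B L b.weight)
    have h₄ : L ≤ (B + 1) * (L + 1) := by nlinarith
    have h₅ : L * (charge B b.weight + P.timeBound B L) ≤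
        (6 * b.weight * b.weight + C₁) * ((B + 1) * (L + 1)) ^ (d₁ + 1 + 1) := by
      rw [pow_succ _ (d₁ + 1), ← mul_assoc, mul_comm L]
      refine Nat.mul_le_mul ?_ h₄
      rw [add_mul]
      omega
    simp only [timeBound]
    rw [add_mul]
    omega

/-! ## Sizes -/

/-- A notion of size for the elements of `K` that is compatible with the arithmetic operations
and that bounds the charges of the cost model. -/
structure SizeModel (K : Type) [Field K] [LinearOrder K] (m : CostModel K) where
  Fits : ℕ → K → Prop
  mono : ∀ {a b x}, a ≤ b → Fits a x → Fits b x
  natCast : ∀ k : ℕ, Fits k (k : K)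
  add : ∀ {a b x y}, Fits a x → Fits b y → Fits (a + b + 1) (x + y)
  sub : ∀ {a b x y}, Fits a x → Fits b y → Fits (a + b + 1) (x - y)
  mul : ∀ {a b x y}, Fits a x → Fits b y → Fits (a + b + 1) (x * y)
  div : ∀ {a b x y}, Fits a x → Fits b y → Fits (a + b + 1) (x / y)
  val_le : ∀ {b x}, Fits b x → m.val x ≤ 2 * b + 3
  int_le : ∀ {b k}, k < 2 ^ b → m.int k ≤ b + 1

/-- Under the uniform cost criterion every number has size `0`. -/
def SizeModel.unit (K : Type) [Field K] [LinearOrder K] : SizeModel K (unitCost K) where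
  Fits _ _ := True
  mono _ _ := trivial
  natCast _ := trivial
  add _ _ := trivial
  sub _ _ := trivial
  mul _ _ := trivial
  div _ _ := trivial
  val_le _ := by simp [unitCost]
  int_le _ := by simp [unitCost]

/-- Numerator and denominator are at most `2 ^ b`. -/
def RatFits (b : ℕ) (q : ℚ) : Prop := q.num.natAbs ≤ 2 ^ b ∧ q.den ≤ 2 ^ b

/-- The fraction need not be in lowest terms: the reduced numerator and denominator divide the given
ones, so reduction can only shrink them. -/
theorem RatFits.of_div {b : ℕ} {q : ℚ} (a d : ℤ) (hd : d ≠ 0) (hq : q = a / d)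
    (ha : a.natAbs ≤ 2 ^ b) (hd' : d.natAbs ≤ 2 ^ b) : RatFits b q := by
  rw [← Rat.divInt_eq_div] at hq
  subst hq
  constructor
  · rcases eq_or_ne a 0 with rfl | h0
    · simp
    · exact (Nat.le_of_dvd (Int.natAbs_pos.2 h0)
        (Int.natAbs_dvd_natAbs.2 (Rat.num_dvd a hd))).trans ha
  · have h := Int.natAbs_dvd_natAbs.2 (Rat.den_dvd a d)
    rw [Int.natAbs_natCast] at h
    exact (Nat.le_of_dvd (Int.natAbs_pos.2 hd) h).trans hd'

theorem RatFits.mono {a b : ℕ} {x : ℚ} (h : a ≤ b) (hx : RatFits a x) : RatFits b x :=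
  ⟨hx.1.trans (Nat.pow_le_pow_right two_pos h), hx.2.trans (Nat.pow_le_pow_right two_pos h)⟩

theorem RatFits.neg {b : ℕ} {x : ℚ} (hx : RatFits b x) : RatFits b (-x) := by
  simpa [RatFits] using hx

theorem RatFits.add {a b : ℕ} {x y : ℚ} (hx : RatFits a x) (hy : RatFits b y) :
    RatFits (a + b + 1) (x + y) := by
  have hpow : 2 ^ (a + b + 1) = 2 ^ a * 2 ^ b + 2 ^ a * 2 ^ b := by ring
  refine RatFits.of_div (x.num * y.den + y.num * x.den) (x.den * y.den)
    (by exact_mod_cast (Nat.mul_pos x.pos y.pos).ne') ?_ ?_ ?_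
  · have hx0 : (x.den : ℚ) ≠ 0 := by exact_mod_cast x.pos.ne'
    have hy0 : (y.den : ℚ) ≠ 0 := by exact_mod_cast y.pos.ne'
    push_cast
    rw [eq_div_iff (mul_ne_zero hx0 hy0)]
    have h₁ := Rat.mul_den_eq_num x
    have h₂ := Rat.mul_den_eq_num y
    linear_combination (y.den : ℚ) * h₁ + (x.den : ℚ) * h₂
  · refine (Int.natAbs_add_le _ _).trans ?_
    rw [Int.natAbs_mul, Int.natAbs_mul, Int.natAbs_natCast, Int.natAbs_natCast, hpow]
    refine add_le_add (Nat.mul_le_mul hx.1 hy.2) ?_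
    rw [mul_comm]
    exact Nat.mul_le_mul hx.2 hy.1
  · rw [Int.natAbs_mul, Int.natAbs_natCast, Int.natAbs_natCast, hpow]
    exact (Nat.mul_le_mul hx.2 hy.2).trans (Nat.le_add_right _ _)

theorem RatFits.mul {a b : ℕ} {x y : ℚ} (hx : RatFits a x) (hy : RatFits b y) :
    RatFits (a + b) (x * y) := by
  refine RatFits.of_div (x.num * y.num) (x.den * y.den)
    (by exact_mod_cast (Nat.mul_pos x.pos y.pos).ne') ?_ ?_ ?_
  · have hx0 : (x.den : ℚ) ≠ 0 := by exact_mod_cast x.pos.ne'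
    have hy0 : (y.den : ℚ) ≠ 0 := by exact_mod_cast y.pos.ne'
    push_cast
    rw [eq_div_iff (mul_ne_zero hx0 hy0), ← Rat.mul_den_eq_num x, ← Rat.mul_den_eq_num y]
    ring
  · rw [Int.natAbs_mul, pow_add]
    exact Nat.mul_le_mul hx.1 hy.1
  · rw [Int.natAbs_mul, Int.natAbs_natCast, Int.natAbs_natCast, pow_add]
    exact Nat.mul_le_mul hx.2 hy.2

theorem RatFits.inv {b : ℕ} {x : ℚ} (hx : RatFits b x) : RatFits b x⁻¹ := by
  rcases eq_or_ne x 0 with rfl | h0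
  · simpa using hx
  · refine RatFits.of_div x.den x.num (Rat.num_ne_zero.2 h0) ?_ (by simpa using hx.2) hx.1
    conv_lhs => rw [← Rat.num_div_den x]
    rw [inv_div]
    norm_cast

/-- Sizes under the logarithmic cost criterion. -/
def SizeModel.bit : SizeModel ℚ bitCost where
  Fits := RatFits
  mono := RatFits.mono
  natCast k := ⟨by simpa using (Nat.lt_two_pow_self (n := k)).le, by simpa using Nat.one_le_two_pow⟩
  add := RatFits.add
  sub hx hy := by
    rw [sub_eq_add_neg]
    exact hx.add hy.neg
  mul hx hy := (hx.mul hy).mono (Nat.le_succ _)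
  div hx hy := by
    rw [div_eq_mul_inv]
    exact (hx.mul hy.inv).mono (Nat.le_succ _)
  val_le {b x} h := by
    have hlt : 2 ^ b < 2 ^ (b + 1) := Nat.pow_lt_pow_right one_lt_two (Nat.lt_succ_self b)
    have h₁ := Nat.size_le.2 (h.1.trans_lt hlt)
    have h₂ := Nat.size_le.2 (h.2.trans_lt hlt)
    simp only [bitCost, ratBits]
    omega
  int_le {b k} h := by
    have := Nat.size_le.2 h
    simp only [bitCost]
    omega

theorem ratFits_of_ratBits_le {b : ℕ} {q : ℚ} (h : ratBits q ≤ b) : RatFits b q := by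
  unfold ratBits at h
  exact ⟨(Nat.size_le.1 (by omega : Nat.size q.num.natAbs ≤ b)).le,
    (Nat.size_le.1 (by omega : Nat.size q.den ≤ b)).le⟩

/-! ### Sizes of sums and maxima -/

section SizeModel

variable {K : Type} [Field K] [LinearOrder K] {m : CostModel K} (𝓢 : SizeModel K m)

theorem SizeModel.zero {b : ℕ} : 𝓢.Fits b 0 := by
  simpa using 𝓢.mono (Nat.zero_le b) (𝓢.natCast 0)

theorem SizeModel.max {b : ℕ} {x y : K} (hx : 𝓢.Fits b x) (hy : 𝓢.Fits b y) :
    𝓢.Fits b (max x y) := by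
  rcases max_choice x y with h | h <;> rw [h] <;> assumption

theorem SizeModel.sum {ι : Type*} (S : Finset ι) {b n : ℕ} (hn : S.card ≤ n) {x : ι → K}
    (h : ∀ i ∈ S, 𝓢.Fits b (x i)) : 𝓢.Fits (n * (b + 1)) (∑ i ∈ S, x i) := by
  classical
  refine 𝓢.mono (Nat.mul_le_mul_right _ hn) ?_
  clear hn
  induction S using Finset.induction_on with
  | empty => simpa using 𝓢.zero
  | insert a S ha ih =>
    rw [Finset.sum_insert ha, Finset.card_insert_of_notMem ha]
    refine 𝓢.mono ?_ (𝓢.add (h a (by simp)) (ih fun i hi => h i (by simp [hi])))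
    rw [add_mul]
    omega

/-- A maximum is one of its arguments, so unlike a sum it needs no additional room. -/
theorem SizeModel.foldMax {ι : Type*} (S : Finset ι) {b : ℕ} {x : ι → K}
    (h : ∀ i ∈ S, 𝓢.Fits b (x i)) : 𝓢.Fits b (S.fold Max.max 0 x) := by
  classical
  induction S using Finset.induction_on with
  | empty => simpa using 𝓢.zero
  | insert a S ha ih =>
    rw [Finset.fold_insert ha]
    exact 𝓢.max (h a (by simp)) (ih fun i hi => h i (by simp [hi]))

/-- All cells of the store have size at most `B`. -/
def SizeModel.Bounded (B : ℕ) (σ : Store K) : Prop :=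
  (∀ a i, σ.int a i < 2 ^ B) ∧ ∀ a i, 𝓢.Fits B (σ.val a i)

end SizeModel

theorem IntExpr.one_le_weight (e : IntExpr) : 1 ≤ e.weight := by cases e <;> simp [weight]

theorem ValExpr.one_le_weight (v : ValExpr) : 1 ≤ v.weight := by cases v <;> simp [weight]

/-- Integers are only added and subtracted, so each node adds at most one bit. Counting numerals in
unary makes the bound cover them too. -/
theorem IntExpr.eval_lt {K : Type} {σ : Store K} {B : ℕ} (hσ : ∀ a i, σ.int a i < 2 ^ B) (e : IntExpr) :
    e.eval σ < 2 ^ (B + e.weight) := by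
  have key : ∀ a b : ℕ, 2 ^ (B + a) + 2 ^ (B + b) ≤ 2 ^ (B + (a + b + 1)) := by
    intro a b
    have h₁ : 2 ^ (B + a) ≤ 2 ^ (B + a + b) := Nat.pow_le_pow_right two_pos (by omega)
    have h₂ : 2 ^ (B + b) ≤ 2 ^ (B + a + b) := Nat.pow_le_pow_right two_pos (by omega)
    rw [show B + (a + b + 1) = (B + a + b) + 1 by ring, pow_succ]
    omega
  induction e with
  | const k =>
    exact (Nat.lt_two_pow_self (n := k)).trans_le
      (Nat.pow_le_pow_right two_pos (by simp only [weight]; omega))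
  | cell a e _ => exact (hσ a _).trans_le (Nat.pow_le_pow_right two_pos (by omega))
  | add e₁ e₂ h₁ h₂ =>
    have := key e₁.weight e₂.weight
    simp only [eval, weight]
    omega
  | sub e₁ e₂ h₁ h₂ =>
    have := key e₁.weight e₂.weight
    simp only [eval, weight]
    omega

/-- The quadratic dependence on the weight leaves room for the charge of the root, which is linear
in the weight, on top of the charges of the two subexpressions. -/
theorem charge_add_le (B u v : ℕ) : charge B u + charge B v + 6 * (u + v + 1) * (B + 1) ≤
    charge B (u + v + 1) := by
  simp only [charge]
  have : 6 * (u + v + 1) * (u + v + 1) * (B + 1) = 6 * u * u * (B + 1) + 6 * v * v * (B + 1) +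
    6 * (u + v + 1) * (B + 1) + 6 * (2 * u * v + u + v) * (B + 1) := by ring
  omega

theorem charge_succ_le (B u : ℕ) : charge B u + 6 * (u + 1) * (B + 1) ≤ charge B (u + 1) := by
  have := charge_add_le B u 0
  simpa [charge] using this

/-! ### Charges of evaluations in bounded stores -/

section SizeModel

variable {K : Type} [Field K] [LinearOrder K] {m : CostModel K} {𝓢 : SizeModel K m} {B : ℕ}
  {σ : Store K}

theorem SizeModel.Bounded.int_le (hσ : 𝓢.Bounded B σ) (e : IntExpr) :
    m.int (e.eval σ) ≤ 6 * e.weight * (B + 1) := by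
  have h₁ := 𝓢.int_le (e.eval_lt hσ.1)
  have h₂ := e.one_le_weight
  nlinarith

theorem SizeModel.Bounded.intCost_le (hσ : 𝓢.Bounded B σ) (e : IntExpr) :
    e.cost m σ ≤ charge B e.weight := by
  induction e with
  | const k =>
    have := hσ.int_le (.const k)
    have h₂ := charge_succ_le B k
    simp only [IntExpr.cost, IntExpr.eval, IntExpr.weight] at *
    omega
  | cell a e ih =>
    have := hσ.int_le (.cell a e)
    have h₂ := charge_succ_le B e.weight
    simp only [IntExpr.cost, IntExpr.weight] at *
    omega
  | add e₁ e₂ h₁ h₂ =>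
    have := hσ.int_le (.add e₁ e₂)
    have h₂ := charge_add_le B e₁.weight e₂.weight
    simp only [IntExpr.cost, IntExpr.weight] at *
    omega
  | sub e₁ e₂ h₁ h₂ =>
    have := hσ.int_le (.sub e₁ e₂)
    have h₂ := charge_add_le B e₁.weight e₂.weight
    simp only [IntExpr.cost, IntExpr.weight] at *
    omega

theorem SizeModel.Bounded.fits (hσ : 𝓢.Bounded B σ) (v : ValExpr) :
    𝓢.Fits (v.weight * (B + 1)) (v.eval σ) := by
  induction v with
  | const k =>
    refine 𝓢.mono ?_ (𝓢.natCast k)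
    simp only [ValExpr.weight]
    nlinarith
  | cell a e =>
    refine 𝓢.mono ?_ (hσ.2 a _)
    simp only [ValExpr.weight]
    nlinarith
  | add v₁ v₂ h₁ h₂ =>
    refine 𝓢.mono ?_ (𝓢.add h₁ h₂)
    simp only [ValExpr.weight]
    nlinarith
  | sub v₁ v₂ h₁ h₂ =>
    refine 𝓢.mono ?_ (𝓢.sub h₁ h₂)
    simp only [ValExpr.weight]
    nlinarith
  | mul v₁ v₂ h₁ h₂ =>
    refine 𝓢.mono ?_ (𝓢.mul h₁ h₂)
    simp only [ValExpr.weight]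
    nlinarith
  | div v₁ v₂ h₁ h₂ =>
    refine 𝓢.mono ?_ (𝓢.div h₁ h₂)
    simp only [ValExpr.weight]
    nlinarith

theorem SizeModel.Bounded.val_le (hσ : 𝓢.Bounded B σ) (v : ValExpr) :
    m.val (v.eval σ) ≤ 6 * v.weight * (B + 1) := by
  have h₁ := 𝓢.val_le (hσ.fits v)
  have h₂ := v.one_le_weight
  nlinarith

theorem SizeModel.Bounded.valCost_le (hσ : 𝓢.Bounded B σ) (v : ValExpr) :
    v.cost m σ ≤ charge B v.weight := by
  induction v with
  | const k =>
    have := hσ.val_le (.const k)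
    have h₂ := charge_succ_le B k
    simp only [ValExpr.cost, ValExpr.eval, ValExpr.weight] at *
    omega
  | cell a e =>
    have := hσ.val_le (.cell a e)
    have h₂ := charge_succ_le B e.weight
    have h₃ := hσ.intCost_le e
    simp only [ValExpr.cost, ValExpr.weight] at *
    omega
  | add v₁ v₂ h₁ h₂ =>
    have := hσ.val_le (.add v₁ v₂)
    have h₂ := charge_add_le B v₁.weight v₂.weight
    simp only [ValExpr.cost, ValExpr.weight] at *
    omega
  | sub v₁ v₂ h₁ h₂ =>
    have := hσ.val_le (.sub v₁ v₂)
    have h₂ := charge_add_le B v₁.weight v₂.weight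
    simp only [ValExpr.cost, ValExpr.weight] at *
    omega
  | mul v₁ v₂ h₁ h₂ =>
    have := hσ.val_le (.mul v₁ v₂)
    have h₂ := charge_add_le B v₁.weight v₂.weight
    simp only [ValExpr.cost, ValExpr.weight] at *
    omega
  | div v₁ v₂ h₁ h₂ =>
    have := hσ.val_le (.div v₁ v₂)
    have h₂ := charge_add_le B v₁.weight v₂.weight
    simp only [ValExpr.cost, ValExpr.weight] at *
    omega

theorem SizeModel.Bounded.testCost_le (hσ : 𝓢.Bounded B σ) (b : Test) :
    b.cost m σ ≤ charge B b.weight := by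
  induction b with
  | intLt e₁ e₂ =>
    have h₁ := hσ.intCost_le e₁
    have h₂ := hσ.intCost_le e₂
    have h₃ := charge_add_le B e₁.weight e₂.weight
    have h₄ : 1 ≤ 6 * (e₁.weight + e₂.weight + 1) * (B + 1) := Nat.succ_le_of_lt (by positivity)
    simp only [Test.cost, Test.weight]
    omega
  | valLt v₁ v₂ =>
    have h₁ := hσ.valCost_le v₁
    have h₂ := hσ.valCost_le v₂
    have h₃ := charge_add_le B v₁.weight v₂.weight
    have h₄ : 1 ≤ 6 * (v₁.weight + v₂.weight + 1) * (B + 1) := Nat.succ_le_of_lt (by positivity)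
    simp only [Test.cost, Test.weight]
    omega
  | not b ih =>
    have h₃ := charge_succ_le B b.weight
    have h₄ : 1 ≤ 6 * (b.weight + 1) * (B + 1) := Nat.succ_le_of_lt (by positivity)
    simp only [Test.cost, Test.weight]
    omega

end SizeModel

/-! ## Program logic -/

/-- The arrays that `P` does not write to are the same in `σ` and `τ`. -/
structure Frame {K : Type} (P : Prog) (σ τ : Store K) : Prop where
  int : ∀ a, P.writesInt a = false → τ.int a = σ.int a
  val : ∀ a, P.writesVal a = false → τ.val a = σ.val a

theorem Frame.refl {K : Type} (P : Prog) (σ : Store K) : Frame P σ σ :=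
  ⟨fun _ _ => rfl, fun _ _ => rfl⟩

theorem Frame.trans {K : Type} {P : Prog} {σ₁ σ₂ σ₃ : Store K} (h : Frame P σ₁ σ₂)
    (h' : Frame P σ₂ σ₃) : Frame P σ₁ σ₃ :=
  ⟨fun a ha => (h'.int a ha).trans (h.int a ha), fun a ha => (h'.val a ha).trans (h.val a ha)⟩

section Runs

variable {K : Type} [Field K] [LinearOrder K] {m : CostModel K}

/-- Whether a program writes to an array is a syntactic property that `decide` checks.
Specifications therefore mention only what a program changes, and all other facts are carried over
by the frame. -/
theorem Exec.frame {P : Prog} {σ τ : Store K} {t : ℕ} (h : Exec m P σ t τ) : Frame P σ τ := by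
  induction h with
  | skip σ => exact Frame.refl _ _
  | setInt a e e' σ =>
    refine ⟨fun b hb => ?_, fun b _ => rfl⟩
    exact Function.update_of_ne (by rintro rfl; simp [Prog.writesInt] at hb) _ _
  | setVal a e v σ =>
    refine ⟨fun b _ => rfl, fun b hb => ?_⟩
    exact Function.update_of_ne (by rintro rfl; simp [Prog.writesVal] at hb) _ _
  | seq _ _ h₁ h₂ =>
    refine ⟨fun b hb => ?_, fun b hb => ?_⟩
    · simp only [Prog.writesInt, Bool.or_eq_false_iff] at hb
      rw [h₂.int b hb.2, h₁.int b hb.1]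
    · simp only [Prog.writesVal, Bool.or_eq_false_iff] at hb
      rw [h₂.val b hb.2, h₁.val b hb.1]
  | condTrue _ _ h =>
    refine ⟨fun b hb => ?_, fun b hb => ?_⟩
    · simp only [Prog.writesInt, Bool.or_eq_false_iff] at hb
      exact h.int b hb.1
    · simp only [Prog.writesVal, Bool.or_eq_false_iff] at hb
      exact h.val b hb.1
  | condFalse _ _ h =>
    refine ⟨fun b hb => ?_, fun b hb => ?_⟩
    · simp only [Prog.writesInt, Bool.or_eq_false_iff] at hb
      exact h.int b hb.2
    · simp only [Prog.writesVal, Bool.or_eq_false_iff] at hb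
      exact h.val b hb.2
  | loopTrue _ _ _ h₁ h₂ =>
    refine ⟨fun b hb => ?_, fun b hb => ?_⟩
    · rw [h₂.int b hb, h₁.int b hb]
    · rw [h₂.val b hb, h₁.val b hb]
  | loopFalse _ => exact Frame.refl _ _

variable (𝓢 : SizeModel K m) (B L : ℕ)

/-- Started in `σ`, whose cells have size at most `B`, the program halts within its time bound,
in a store that satisfies `Q` and whose cells have size at most `B`. -/
def Runs (P : Prog) (σ : Store K) (Q : Store K → Prop) : Prop :=
  𝓢.Bounded B σ → ∃ t τ, Exec m P σ t τ ∧ t ≤ P.timeBound B L ∧ 𝓢.Bounded B τ ∧ Q τ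

variable {𝓢 B L} {P P' : Prog} {σ : Store K} {Q R : Store K → Prop}

theorem Runs.mono (h : Runs 𝓢 B L P σ Q) (hQ : ∀ τ, Frame P σ τ → Q τ → R τ) :
    Runs 𝓢 B L P σ R := by
  intro hσ
  obtain ⟨t, τ, h₁, h₂, h₃, h₄⟩ := h hσ
  exact ⟨t, τ, h₁, h₂, h₃, hQ τ h₁.frame h₄⟩

theorem Runs.skip (h : Q σ) : Runs 𝓢 B L .skip σ Q :=
  fun hσ => ⟨1, σ, .skip σ, le_rfl, hσ, h⟩

theorem Runs.setInt {a : ℕ} {e e' : IntExpr} (hB : e'.eval σ < 2 ^ B)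
    (h : Q (σ.setInt a (e.eval σ) (e'.eval σ))) : Runs 𝓢 B L (.setInt a e e') σ Q := by
  intro hσ
  refine ⟨_, _, .setInt a e e' σ, ?_, ⟨fun b i => ?_, hσ.2⟩, h⟩
  · exact add_le_add (add_le_add le_rfl (hσ.intCost_le e)) (hσ.intCost_le e')
  · simp only [Store.setInt, Function.update_apply]
    split_ifs with h₁
    · rw [Function.update_apply]
      split_ifs
      · exact hB
      · exact hσ.1 _ _
    · exact hσ.1 _ _

theorem Runs.setVal {a : ℕ} {e : IntExpr} {v : ValExpr} (hB : 𝓢.Fits B (v.eval σ))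
    (h : Q (σ.setVal a (e.eval σ) (v.eval σ))) : Runs 𝓢 B L (.setVal a e v) σ Q := by
  intro hσ
  refine ⟨_, _, .setVal a e v σ, ?_, ⟨hσ.1, fun b i => ?_⟩, h⟩
  · exact add_le_add (add_le_add le_rfl (hσ.intCost_le e)) (hσ.valCost_le v)
  · simp only [Store.setVal, Function.update_apply]
    split_ifs with h₁
    · rw [Function.update_apply]
      split_ifs
      · exact hB
      · exact hσ.2 _ _
    · exact hσ.2 _ _

theorem Runs.seq (h : Runs 𝓢 B L P σ fun τ => Runs 𝓢 B L P' τ Q) :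
    Runs 𝓢 B L (.seq P P') σ Q := by
  intro hσ
  obtain ⟨t₁, τ, h₁, h₂, h₃, h₄⟩ := h hσ
  obtain ⟨t₂, υ, h₅, h₆, h₇⟩ := h₄ h₃
  exact ⟨t₁ + t₂, υ, .seq h₁ h₅, add_le_add h₂ h₆, h₇⟩

theorem Runs.cond {b : Test} (h₁ : b.Holds σ → Runs 𝓢 B L P σ Q)
    (h₂ : ¬ b.Holds σ → Runs 𝓢 B L P' σ Q) : Runs 𝓢 B L (.cond b P P') σ Q := by
  intro hσ
  by_cases hb : b.Holds σ
  · obtain ⟨t, τ, h, ht, h'⟩ := h₁ hb hσ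
    exact ⟨_, τ, .condTrue hb h,
      add_le_add (hσ.testCost_le b) (ht.trans (Nat.le_add_right _ _)), h'⟩
  · obtain ⟨t, τ, h, ht, h'⟩ := h₂ hb hσ
    exact ⟨_, τ, .condFalse hb h,
      add_le_add (hσ.testCost_le b) (ht.trans (Nat.le_add_left _ _)), h'⟩

/-- The rule for a loop that makes exactly `N` rounds. -/
theorem Runs.loop {b : Test} (N : ℕ) (hN : N ≤ L) (Inv : ℕ → Store K → Prop) (h0 : Inv 0 σ)
    (hstep : ∀ k < N, ∀ τ, Frame P σ τ → Inv k τ → b.Holds τ ∧ Runs 𝓢 B L P τ (Inv (k + 1)))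
    (hend : ∀ τ, Frame P σ τ → Inv N τ → ¬ b.Holds τ) :
    Runs 𝓢 B L (.loop b P) σ (Inv N) := by
  intro hσ
  -- Induction on the number `d` of remaining rounds, because the rest of the loop starts in a new
  -- store.
  have key : ∀ d k, k + d = N → ∀ τ, Frame P σ τ → 𝓢.Bounded B τ → Inv k τ →
      ∃ t υ, Exec m (.loop b P) τ t υ ∧
        t ≤ d * (charge B b.weight + P.timeBound B L) + charge B b.weight ∧
        𝓢.Bounded B υ ∧ Inv N υ := by
    intro d
    induction d with
    | zero =>
      intro k hk τ hf hτ hi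
      obtain rfl : k = N := by simpa using hk
      exact ⟨_, τ, .loopFalse (hend τ hf hi), by simpa using hτ.testCost_le b, hτ, hi⟩
    | succ d ih =>
      intro k hk τ hf hτ hi
      obtain ⟨hb, hr⟩ := hstep k (by omega) τ hf hi
      obtain ⟨t, υ, h₁, h₂, h₃, h₄⟩ := hr hτ
      obtain ⟨t', υ', h₅, h₆, h₇⟩ := ih (k + 1) (by omega) υ (hf.trans h₁.frame) h₃ h₄
      refine ⟨_, υ', .loopTrue hb h₁ h₅, ?_, h₇⟩
      have := hτ.testCost_le b
      rw [add_mul, one_mul]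
      omega
  obtain ⟨t, τ, h₁, h₂, h₃⟩ := key N 0 (by simp) σ (Frame.refl _ _) hσ h0
  exact ⟨t, τ, h₁, h₂.trans (add_le_add (Nat.mul_le_mul_right _ hN) le_rfl), h₃⟩

/-- Cell `0` of integer array `a`, used as a variable. -/
abbrev ivar (a : ℕ) : IntExpr := .cell a (.const 0)

/-- Cell `0` of value array `a`, used as a variable. -/
abbrev vvar (a : ℕ) : ValExpr := .cell a (.const 0)

/-- `for i in [0, bound) do P`, the counter being cell `0` of integer array `i`. -/
def Prog.forLoop (i : ℕ) (bound : IntExpr) (P : Prog) : Prog :=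
  .seq (.setInt i (.const 0) (.const 0))
    (.loop (.intLt (ivar i) bound) (.seq P (.setInt i (.const 0) (.add (ivar i) (.const 1)))))

/-- The invariant is asserted after the counter has been updated. The bound is re-evaluated in every
round; its constancy is to be derived from the frame relative to the store before the loop, which is
available to every premise about later stores. -/
theorem Runs.forLoop {i : ℕ} {bound : IntExpr} (N : ℕ) (hN : N ≤ L) (hB : N < 2 ^ B)
    (hi : P.writesInt i = false)
    (hbound : ∀ τ, Frame (.forLoop i bound P) σ τ → bound.eval τ = N)
    (Inv : ℕ → Store K → Prop) (h0 : Inv 0 (σ.setInt i 0 0))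
    (hstep : ∀ k < N, ∀ τ, Frame (.forLoop i bound P) σ τ → τ.int i 0 = k → Inv k τ →
      Runs 𝓢 B L P τ fun υ => Inv (k + 1) (υ.setInt i 0 (k + 1)))
    (hQ : ∀ τ, Frame (.forLoop i bound P) σ τ → Inv N τ → Q τ) :
    Runs 𝓢 B L (.forLoop i bound P) σ Q := by
  set body : Prog := .seq P (.setInt i (.const 0) (.add (ivar i) (.const 1))) with hbody
  have hfr : ∀ τ, Frame body (σ.setInt i 0 0) τ → Frame (.forLoop i bound P) σ τ := by
    intro τ h
    refine ⟨fun a ha => ?_, fun a ha => ?_⟩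
    · simp only [Prog.forLoop, Prog.writesInt, Bool.or_eq_false_iff] at ha
      have hne : a ≠ i := by rintro rfl; simp at ha
      rw [h.int a (by simp only [hbody, Prog.writesInt, Bool.or_eq_false_iff]; exact ha.2)]
      exact Function.update_of_ne hne _ _
    · exact h.val a (by simpa [Prog.forLoop, Prog.writesVal, hbody] using ha)
  refine Runs.seq (Runs.setInt ?_ ?_)
  · simp [IntExpr.eval]
  refine Runs.mono (Q := fun τ => τ.int i 0 = N ∧ Inv N τ) ?_ fun τ h₁ h₂ =>
    hQ τ (hfr τ ⟨h₁.int, h₁.val⟩) h₂.2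
  refine Runs.loop N hN (fun k τ => τ.int i 0 = k ∧ Inv k τ) ⟨by simp [Store.setInt, IntExpr.eval], h0⟩ ?_ ?_
  · rintro k hk τ hf ⟨hk', hinv⟩
    refine ⟨?_, ?_⟩
    · simp only [Test.Holds, hbound τ (hfr τ hf), IntExpr.eval, hk', hk]
    · refine Runs.seq ((hstep k hk τ (hfr τ hf) hk' hinv).mono fun υ hυ h => ?_)
      have : υ.int i 0 = k := by rw [hυ.int i hi, hk']
      refine Runs.setInt ?_ ?_ <;> simp only [IntExpr.eval, this]
      · omega
      · exact ⟨by simp [Store.setInt], h⟩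
  · rintro τ hf ⟨hk', hinv⟩
    simp only [Test.Holds, hbound τ (hfr τ hf), IntExpr.eval, hk', lt_irrefl, not_false_iff]

end Runs

-- Reading a store after a write

attribute [simp] IntExpr.eval ValExpr.eval Test.Holds

section Reads

variable {K : Type} (σ : Store K) (a b i j : ℕ)

@[simp]
theorem Store.setInt_val (k : ℕ) : (σ.setInt a i k).val = σ.val := rfl

@[simp]
theorem Store.setVal_int (x : K) : (σ.setVal a i x).int = σ.int := rfl

@[simp]
theorem Store.setInt_int_of_ne (k : ℕ) (h : b ≠ a) : (σ.setInt a i k).int b = σ.int b :=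
  Function.update_of_ne h _ _

@[simp]
theorem Store.setVal_val_of_ne (x : K) (h : b ≠ a) : (σ.setVal a i x).val b = σ.val b :=
  Function.update_of_ne h _ _

@[simp]
theorem Store.setInt_int_self (k : ℕ) :
    (σ.setInt a i k).int a j = if j = i then k else σ.int a j := by
  simp [Store.setInt, Function.update_apply]

@[simp]
theorem Store.setVal_val_self (x : K) :
    (σ.setVal a i x).val a j = if j = i then x else σ.val a j := by
  simp [Store.setVal, Function.update_apply]

end Reads

/-! ## Teams under additive rewards -/

section Teams

variable {K : Type} [Field K] [LinearOrder K]

/-- The share above which a member of the team is free of envy towards the other members. -/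
def threshold (c f : ℕ → K) (S : Finset ℕ) : K :=
  S.fold max 0 fun i => c i / f i - c i / ∑ k ∈ S, f k

/-- The revenue of the cheapest fair contract for the team `S`. -/
def teamRevenue (c f : ℕ → K) (S : Finset ℕ) : K :=
  (1 - ∑ i ∈ S, max (c i / f i) (threshold c f S)) * ∑ i ∈ S, f i

variable {c f : ℕ → K} {S : Finset ℕ}

theorem threshold_nonneg : 0 ≤ threshold c f S := Finset.le_fold_max _ |>.2 (Or.inl le_rfl)

theorem le_threshold {k : ℕ} (hk : k ∈ S) :
    c k / f k - c k / ∑ i ∈ S, f i ≤ threshold c f S :=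
  (Finset.le_fold_max _).2 (Or.inr ⟨k, hk, le_rfl⟩)

theorem threshold_le {t : K} (h0 : 0 ≤ t)
    (h : ∀ k ∈ S, c k / f k - c k / ∑ i ∈ S, f i ≤ t) : threshold c f S ≤ t :=
  (Finset.fold_max_le _).2 ⟨h0, h⟩

theorem threshold_eq_zero_or :
    threshold c f S = 0 ∨ ∃ k ∈ S, threshold c f S = c k / f k - c k / ∑ i ∈ S, f i := by
  have h := (Finset.le_fold_max (s := S) (b := (0 : K))
    (f := fun i => c i / f i - c i / ∑ k ∈ S, f k) (threshold c f S)).1 le_rfl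
  rcases h with h | ⟨k, hk, h⟩
  · exact Or.inl (le_antisymm h threshold_nonneg)
  · exact Or.inr ⟨k, hk, le_antisymm h (le_threshold hk)⟩

/-- `f k` measured in units of `δ`, rounded down and capped at `N`. -/
def units (f : ℕ → K) (δ : K) (N k : ℕ) : ℕ :=
  Nat.findGreatest (fun t => (t : K) * δ ≤ f k) N

theorem units_le (δ : K) (N k : ℕ) : units f δ N k ≤ N := Nat.findGreatest_le _

theorem units_self {δ : K} {N k : ℕ} (h : f k = N * δ) : units f δ N k = N :=
  le_antisymm (units_le δ N k) (Nat.le_findGreatest le_rfl h.ge)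

/-! ### Revenue under rounded rewards and guessed thresholds -/

variable [IsStrictOrderedRing K]

theorem teamRevenue_singleton {k : ℕ} (hc : 0 < c k) (hf : c k ≤ f k) :
    teamRevenue c f {k} = (1 - c k / f k) * f k := by
  have : threshold c f {k} = 0 := by simp [threshold]
  rw [teamRevenue, this]
  simp [max_eq_left (div_nonneg hc.le (hc.le.trans hf))]

/-- If the members of `S` tolerate the threshold `T` at total reward `x`, and the actual total reward
is at least `x`, then the revenue of `S` or that of one of its members is as large as computed
with `T` and `x`. -/
theorem le_teamRevenue_or_singleton {x T : K} (hc : ∀ k ∈ S, 0 < c k) (hv : ∀ k ∈ S, c k ≤ f k)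
    (hfx : ∀ k ∈ S, f k ≤ x) (hT : ∀ k ∈ S, c k / f k - c k / x ≤ T) (hT0 : 0 ≤ T) (hx : 0 < x)
    (hxS : x ≤ ∑ k ∈ S, f k) (h1 : ∑ k ∈ S, max (c k / f k) T ≤ 1) :
    (1 - ∑ k ∈ S, max (c k / f k) T) * x ≤ teamRevenue c f S ∨
      ∃ k ∈ S, (1 - ∑ k ∈ S, max (c k / f k) T) * x ≤ teamRevenue c f {k} := by
  set F := ∑ k ∈ S, f k with hF
  set q := ∑ k ∈ S, max (c k / f k) T with hq
  set T' := threshold c f S with hT'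
  have hF0 : 0 < F := hx.trans_le hxS
  -- If the true threshold is at most `T`, passing to it lowers the payments while the reward rises
  -- from `x` to `F`.
  rcases le_or_gt T' T with hle | hlt
  · left
    have h₁ : ∑ k ∈ S, max (c k / f k) T' ≤ q :=
      Finset.sum_le_sum fun k _ => max_le_max le_rfl hle
    rw [teamRevenue, ← hT', ← hF]
    have h₂ : (1 - q) * x ≤ (1 - q) * F := mul_le_mul_of_nonneg_left hxS (by linarith)
    nlinarith
  · obtain h0 | ⟨k, hk, hkT⟩ := threshold_eq_zero_or (c := c) (f := f) (S := S)
    · rw [← hT'] at h0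
      linarith
    rw [← hT', ← hF] at hkT
    have hck := hc k hk
    have hfk : 0 < f k := hck.trans_le (hv k hk)
    -- `P` is the payment to the members whose price exceeds the true threshold, and `m` counts the
    -- others, each of whom receives `T'`.
    set P := ∑ i ∈ S with T' < c i / f i, c i / f i with hP
    set m : K := ((S.filter fun i => ¬ T' < c i / f i).card : K) with hm
    have hm0 : 0 ≤ m := Nat.cast_nonneg _
    have hsum : ∑ i ∈ S, max (c i / f i) T' = P + m * T' := by
      rw [← Finset.sum_filter_add_sum_filter_not S (fun i => T' < c i / f i)]
      congr 1
      · exact Finset.sum_congr rfl fun i hi => max_eq_left (Finset.mem_filter.1 hi).2.le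
      · rw [hm, ← nsmul_eq_mul]
        exact Finset.sum_eq_card_nsmul fun i hi =>
          max_eq_right (not_lt.1 (Finset.mem_filter.1 hi).2)
    have hqge : P + m * (c k / f k - c k / x) ≤ q := by
      rw [hq, ← Finset.sum_filter_add_sum_filter_not S (fun i => T' < c i / f i)]
      refine add_le_add (Finset.sum_le_sum fun i _ => le_max_left _ _) ?_
      rw [hm, ← nsmul_eq_mul]
      exact Finset.card_nsmul_le_sum _ _ _ fun i _ => (hT k hk).trans (le_max_right _ _)
    -- The member `k` that attains the threshold has a price above it, so its price is one of the
    -- terms of `P`.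
    have hkT' : T' < c k / f k := by
      rw [hkT]
      have : 0 < c k / F := div_pos hck hF0
      linarith
    have hpk : c k / f k ≤ P := by
      refine Finset.single_le_sum (f := fun i => c i / f i) (fun i hi => ?_)
        (Finset.mem_filter.2 ⟨hk, hkT'⟩)
      have := hc i (Finset.mem_filter.1 hi).1
      exact div_nonneg this.le (this.le.trans (hv i (Finset.mem_filter.1 hi).1))
    set p := c k / f k with hp
    have hcp : c k = p * f k := by rw [hp]; field_simp
    have hxc : c k / x * x = c k := div_mul_cancel₀ _ hx.ne'
    have hFc : c k / F * F = c k := div_mul_cancel₀ _ hF0.ne'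
    -- Both revenues are compared with the affine function `y ↦ (1 - P - m * p) * y + m * c k`: its
    -- value at `x` bounds the computed revenue, its value at `F` is the true one.
    have hub : (1 - q) * x ≤ (1 - P - m * p) * x + m * c k := by
      have : (1 - q) * x ≤ (1 - (P + m * (p - c k / x))) * x :=
        mul_le_mul_of_nonneg_right (by linarith) hx.le
      calc _ ≤ _ := this
        _ = (1 - P - m * p) * x + m * (c k / x * x) := by ring
        _ = _ := by rw [hxc]
    have hrev : teamRevenue c f S = (1 - P - m * p) * F + m * c k := by
      rw [teamRevenue, ← hT', ← hF, hsum, hkT]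
      calc _ = (1 - P - m * p) * F + m * (c k / F * F) := by ring
        _ = _ := by rw [hFc]
    -- With nonnegative slope move from `x` up to `F`. With negative slope move down to `f k ≤ x`,
    -- where the value is `(1 - P) * f k`, at most the revenue `(1 - p) * f k` of `k` alone.
    rcases le_or_gt 0 (1 - P - m * p) with hs | hs
    · left
      rw [hrev]
      nlinarith [mul_le_mul_of_nonneg_left hxS hs]
    · right
      refine ⟨k, hk, hub.trans ?_⟩
      rw [teamRevenue_singleton hck (hv k hk), ← hp, hcp]
      have h₂ : (1 - P - m * p) * (x - f k) ≤ 0 :=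
        mul_nonpos_of_nonpos_of_nonneg hs.le (by linarith [hfx k hk])
      nlinarith [mul_le_mul_of_nonneg_right hpk hfk.le]

/-- Lowering the total reward from `∑ k ∈ S, f k` to `x` costs at most the same fraction of the
revenue. -/
theorem mul_teamRevenue_le {γ x T : K}
    (hx : 0 < x) (hxS : x ≤ ∑ k ∈ S, f k) (hxγ : (1 - γ) * ∑ k ∈ S, f k ≤ x)
    (hT : T ≤ threshold c f S) (hR : 0 ≤ teamRevenue c f S) :
    (1 - γ) * teamRevenue c f S ≤ (1 - ∑ k ∈ S, max (c k / f k) T) * x ∧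
      ∑ k ∈ S, max (c k / f k) T ≤ 1 := by
  have hF0 : 0 < ∑ k ∈ S, f k := hx.trans_le hxS
  have h₁ : ∑ k ∈ S, max (c k / f k) T ≤ ∑ k ∈ S, max (c k / f k) (threshold c f S) :=
    Finset.sum_le_sum fun k _ => max_le_max le_rfl hT
  have h₂ : 0 ≤ 1 - ∑ k ∈ S, max (c k / f k) (threshold c f S) :=
    nonneg_of_mul_nonneg_left hR hF0
  refine ⟨?_, by linarith⟩
  rw [teamRevenue]
  calc _ = (1 - ∑ k ∈ S, max (c k / f k) (threshold c f S)) * ((1 - γ) * ∑ k ∈ S, f k) := by ring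
    _ ≤ (1 - ∑ k ∈ S, max (c k / f k) (threshold c f S)) * x := mul_le_mul_of_nonneg_left hxγ h₂
    _ ≤ _ := mul_le_mul_of_nonneg_right (by linarith) hx.le

theorem units_mul_le {δ : K} {N k : ℕ} (hf : 0 ≤ f k) : (units f δ N k : K) * δ ≤ f k := by
  refine Nat.findGreatest_spec (P := fun t : ℕ => (t : K) * δ ≤ f k) (Nat.zero_le N) ?_
  simpa using hf

/-- The cap at `N` does no harm: if it is attained, then `f k ≤ N * δ` is already enough. -/
theorem le_units_mul {δ : K} {N k : ℕ} (hδ : 0 < δ) (hfN : f k ≤ N * δ) :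
    f k ≤ (units f δ N k + 1) * δ := by
  rcases (units_le (f := f) δ N k).eq_or_lt with h | h
  · rw [h]
    nlinarith
  · have := Nat.findGreatest_is_greatest (Nat.lt_succ_self (units f δ N k)) h
    push_cast at this
    exact (not_le.1 this).le

/-- The members that may be combined at total reward `x` and threshold `T`, `b` being the largest
admissible individual reward. -/
def admissible (c f : ℕ → K) (n : ℕ) (b x T : K) : Finset ℕ :=
  (Finset.range n).filter fun k => c k ≤ f k ∧ f k ≤ b ∧ c k / f k - c k / x ≤ T

/-- `R` has minimal weight at threshold `T` among the admissible teams of at least `a` units. -/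
structure IsLightest (c f : ℕ → K) (n : ℕ) (b x T : K) (u : ℕ → ℕ) (a : ℕ) (R : Finset ℕ) :
    Prop where
  subset : R ⊆ admissible c f n b x T
  spec : ∀ S ⊆ admissible c f n b x T, a ≤ ∑ k ∈ S, u k → ∑ k ∈ S, max (c k / f k) T < 2 →
    a ≤ ∑ k ∈ R, u k ∧ ∑ k ∈ R, max (c k / f k) T ≤ ∑ k ∈ S, max (c k / f k) T

/-- Among the candidates inspected by the algorithm there is an almost optimal one. -/
theorem mul_teamRevenue_le_of_candidates {n N : ℕ} {γ r : K} (hN : 0 < N) (hNγ : (n : K) ≤ N * γ)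
    (hγ0 : 0 < γ) (hγ1 : γ ≤ 1) (hc : ∀ k < n, 0 < c k) (hr : 0 ≤ r)
    (hsingle : ∀ k < n, c k ≤ f k → teamRevenue c f {k} ≤ r)
    (hcand : ∀ e < n, c e ≤ f e → ∀ a < n * N, ∀ j < n,
      ∃ R, IsLightest c f n (f e) ((a + 1 : ℕ) * (f e / N))
        (c j / f j - c j / ((a + 1 : ℕ) * (f e / N))) (units f (f e / N) N) (a + 1) R ∧
        teamRevenue c f R ≤ r)
    (hS : ∀ k ∈ S, k < n ∧ c k ≤ f k) : (1 - γ) * teamRevenue c f S ≤ r := by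
  rcases le_or_gt 0 (teamRevenue c f S) with hR | hR
  swap
  · nlinarith
  rcases S.eq_empty_or_nonempty with rfl | hne
  · simpa [teamRevenue] using hr
  have hcS : ∀ k ∈ S, 0 < c k := fun k hk => hc k (hS k hk).1
  have hfS : ∀ k ∈ S, 0 < f k := fun k hk => (hcS k hk).trans_le (hS k hk).2
  -- The three correct guesses for `S` are `e` here, the level `a` with `a + 1` units in total, and
  -- `j` below.
  obtain ⟨e, he, hemax⟩ := S.exists_max_image f hne
  have hN0 : (0 : K) < N := by exact_mod_cast hN
  set δ := f e / N with hδ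
  have hδ0 : 0 < δ := div_pos (hfS e he) hN0
  have heδ : f e = N * δ := by rw [hδ]; field_simp
  set u := units f δ N with hu
  have hue : u e = N := units_self heδ
  obtain ⟨a, ha⟩ : ∃ a, ∑ k ∈ S, u k = a + 1 := by
    refine Nat.exists_eq_succ_of_ne_zero (Nat.ne_of_gt ?_)
    exact (hue.symm ▸ hN).trans_le (Finset.single_le_sum (f := u) (fun _ _ => Nat.zero_le _) he)
  have hScard : S.card ≤ n := by
    simpa using Finset.card_le_card (fun k hk => Finset.mem_range.2 (hS k hk).1 : S ⊆ Finset.range n)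
  have haN : a < n * N := by
    have : ∑ k ∈ S, u k ≤ S.card • N := Finset.sum_le_card_nsmul _ _ _ fun k _ => units_le δ N k
    have h₂ : S.card * N ≤ n * N := Nat.mul_le_mul_right _ hScard
    rw [smul_eq_mul] at this
    omega
  set x : K := (a + 1 : ℕ) * δ with hx
  have hxsum : x = ∑ k ∈ S, (u k : K) * δ := by
    rw [← Finset.sum_mul, hx, ← ha, Nat.cast_sum]
  have hx0 : 0 < x := mul_pos (by positivity) hδ0
  have hxF : x ≤ ∑ k ∈ S, f k := by
    rw [hxsum]
    exact Finset.sum_le_sum fun k hk => units_mul_le (hfS k hk).le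
  -- The agent `e` alone contributes exactly `N` units, so `x` dominates every individual reward in
  -- `S`. This is what makes the guessed threshold nonnegative and allows the fallback to
  -- singletons.
  have hex : f e ≤ x := by
    rw [hxsum, heδ, ← hue]
    exact Finset.single_le_sum (f := fun k => (u k : K) * δ) (fun k _ => by positivity) he
  -- Each member loses at most one unit, and `n` units amount to at most `γ * f e` because `n ≤ N *
  -- γ`.
  have hxγ : (1 - γ) * ∑ k ∈ S, f k ≤ x := by
    have h₁ : ∑ k ∈ S, f k ≤ x + S.card * δ := by
      rw [hxsum, ← nsmul_eq_mul, ← Finset.sum_const, ← Finset.sum_add_distrib]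
      refine Finset.sum_le_sum fun k hk => ?_
      have := le_units_mul (k := k) hδ0 (heδ ▸ hemax k hk)
      rw [add_mul, one_mul] at this
      exact this
    have h₂ : (S.card : K) * δ ≤ γ * f e := by
      rw [heδ, ← mul_assoc]
      refine mul_le_mul_of_nonneg_right ?_ hδ0.le
      have : (S.card : K) ≤ n := by exact_mod_cast hScard
      linarith
    have h₃ : γ * f e ≤ γ * ∑ k ∈ S, f k :=
      mul_le_mul_of_nonneg_left
        (Finset.single_le_sum (f := f) (fun k hk => (hfS k hk).le) he) hγ0.le
    linarith
  obtain ⟨j, hj, hjmax⟩ := S.exists_max_image (fun k => c k / f k - c k / x) hne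
  obtain ⟨R, hRl, hRr⟩ := hcand e (hS e he).1 (hS e he).2 a haN j (hS j hj).1
  rw [← hδ, ← hu, ← hx] at hRl
  set T := c j / f j - c j / x with hT
  have hT0 : 0 ≤ T := sub_nonneg.2
    (div_le_div_of_nonneg_left (hcS j hj).le (hfS j hj) ((hemax j hj).trans hex))
  -- The envy terms increase with the total reward, and `x` does not exceed that of `S`.
  have hTS : T ≤ threshold c f S := by
    refine le_trans ?_ (le_threshold hj)
    have := div_le_div_of_nonneg_left (hcS j hj).le hx0 hxF
    linarith
  obtain ⟨h₁, h₂⟩ := mul_teamRevenue_le hx0 hxF hxγ hTS hR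
  obtain ⟨h₃, h₄⟩ := hRl.spec S (fun k hk => Finset.mem_filter.2
    ⟨Finset.mem_range.2 (hS k hk).1, (hS k hk).2, hemax k hk, hjmax k hk⟩) ha.ge
    (h₂.trans_lt one_lt_two)
  have hRmem : ∀ k ∈ R, k < n ∧ c k ≤ f k ∧ f k ≤ f e ∧ c k / f k - c k / x ≤ T := by
    intro k hk
    have := Finset.mem_filter.1 (hRl.subset hk)
    exact ⟨Finset.mem_range.1 this.1, this.2⟩
  have hcR : ∀ k ∈ R, 0 < c k := fun k hk => hc k (hRmem k hk).1
  have hxR : x ≤ ∑ k ∈ R, f k := by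
    have : x ≤ ((∑ k ∈ R, u k : ℕ) : K) * δ :=
      mul_le_mul_of_nonneg_right (by exact_mod_cast h₃) hδ0.le
    refine this.trans ?_
    rw [Nat.cast_sum, Finset.sum_mul]
    exact Finset.sum_le_sum fun k hk =>
      units_mul_le ((hcR k hk).le.trans (hRmem k hk).2.1)
  have hfin : (1 - γ) * teamRevenue c f S ≤ (1 - ∑ k ∈ R, max (c k / f k) T) * x :=
    h₁.trans (mul_le_mul_of_nonneg_right (by linarith) hx0.le)
  refine hfin.trans ?_
  -- Rounding down gives `f(R) ≥ x` only, possibly with strict inequality; hence the comparison with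
  -- singletons.
  rcases le_teamRevenue_or_singleton hcR (fun k hk => (hRmem k hk).2.1)
    (fun k hk => (hRmem k hk).2.2.1.trans hex) (fun k hk => (hRmem k hk).2.2.2) hT0 hx0 hxR
    (h₄.trans h₂) with h | ⟨k, hk, h⟩
  · exact h.trans hRr
  · exact h.trans (hsingle k (hRmem k hk).1 (hRmem k hk).2.1)

end Teams

/-! ## Fair contracts under additive rewards -/

/-- The extension of a tuple by zero. -/
def extend {K : Type} [Zero K] {n : ℕ} (g : Fin n → K) (i : ℕ) : K :=
  if h : i < n then g ⟨i, h⟩ else 0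

@[simp]
theorem extend_val {K : Type} [Zero K] {n : ℕ} (g : Fin n → K) (i : Fin n) :
    extend g (i : ℕ) = g i := by
  simp [extend]

namespace TeamInstance

variable {n : ℕ} (I : TeamInstance n)

/-- The individual reward of an agent. -/
def single (i : Fin n) : ℝ := I.reward {i}

/-- The agents in `S` as natural numbers. -/
def toNat (S : Finset (Fin n)) : Finset ℕ := S.map Fin.valEmbedding

/-- The cheapest fair contract for the team `S`. -/
noncomputable def cheapest (S : Finset (Fin n)) : TeamContract n where
  team := S
  share i := if i ∈ S then
    max (I.cost i / I.single i) (threshold (extend I.cost) (extend I.single) (toNat S)) else 0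

variable {I}

theorem single_nonneg (i : Fin n) : 0 ≤ I.single i := (I.reward_mem _).1

theorem sum_toNat (S : Finset (Fin n)) (hI : I.IsAdditive) :
    ∑ k ∈ toNat S, extend I.single k = I.reward S := by
  rw [hI S, toNat, Finset.sum_map]
  simp [single]

theorem reward_sdiff (hI : I.IsAdditive) {S : Finset (Fin n)} {i : Fin n} (hi : i ∈ S) :
    I.reward (S \ {i}) = I.reward S - I.single i := by
  rw [hI (S \ {i}), hI S, ← Finset.sum_sdiff (Finset.singleton_subset_iff.2 hi),
    Finset.sum_singleton, single]
  ring

theorem reward_union (hI : I.IsAdditive) {S : Finset (Fin n)} {i : Fin n} (hi : i ∉ S) :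
    I.reward (S ∪ {i}) = I.reward S + I.single i := by
  rw [hI (S ∪ {i}), hI S, Finset.sum_union (Finset.disjoint_singleton_right.2 hi),
    Finset.sum_singleton, single]

theorem le_threshold_toNat (hI : I.IsAdditive) {S : Finset (Fin n)} {i : Fin n} (hi : i ∈ S) :
    I.cost i / I.single i - I.cost i / I.reward S ≤
      threshold (extend I.cost) (extend I.single) (toNat S) := by
  have := le_threshold (c := extend I.cost) (f := extend I.single) (S := toNat S) (k := (i : ℕ))
    (Finset.mem_map_of_mem Fin.valEmbedding hi)
  simpa [sum_toNat S hI] using this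

theorem threshold_toNat_le (hI : I.IsAdditive) {S : Finset (Fin n)} {t : ℝ} (h0 : 0 ≤ t)
    (h : ∀ i ∈ S, I.cost i / I.single i - I.cost i / I.reward S ≤ t) :
    threshold (extend I.cost) (extend I.single) (toNat S) ≤ t := by
  refine threshold_le h0 fun k hk => ?_
  obtain ⟨i, hi, rfl⟩ := Finset.mem_map.1 hk
  simpa [sum_toNat S hI] using h i hi

theorem cost_le_of_isFeasible (hI : I.IsAdditive) {A : TeamContract n} (hA : I.IsFeasible A)
    {i : Fin n} (hi : i ∈ A.team) :
    I.cost i ≤ A.share i * I.single i ∧ I.cost i ≤ I.single i := by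
  have h := hA.2.2 i hi
  rw [reward_sdiff hI hi] at h
  have h₁ : I.cost i ≤ A.share i * I.single i := by linarith
  refine ⟨h₁, h₁.trans ?_⟩
  exact mul_le_of_le_one_left (single_nonneg i) (hA.1 i hi).2

theorem single_pos {i : Fin n} (h : I.cost i ≤ I.single i) : 0 < I.single i :=
  (I.cost_pos i).trans_le h

/-- Every fair contract pays each member at least what the cheapest fair contract does. -/
theorem cheapest_share_le (hI : I.IsAdditive) {A : TeamContract n} (hA : I.IsFeasible A)
    (hF : I.IsFair A) {i : Fin n} (hi : i ∈ A.team) :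
    max (I.cost i / I.single i)
      (threshold (extend I.cost) (extend I.single) (toNat A.team)) ≤ A.share i := by
  have hp : ∀ k ∈ A.team, I.cost k / I.single k ≤ A.share k := fun k hk =>
    (div_le_iff₀ (single_pos (cost_le_of_isFeasible hI hA hk).2)).2
      (cost_le_of_isFeasible hI hA hk).1
  refine max_le (hp i hi) (threshold_toNat_le hI (hA.1 i hi).1 fun j hj => ?_)
  have hcj := I.cost_pos j
  have hfj := single_pos (cost_le_of_isFeasible hI hA hj).2
  have hR : I.single j ≤ I.reward A.team :=
    I.reward_mono (Finset.singleton_subset_iff.2 hj)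
  have hR0 : 0 < I.reward A.team := hfj.trans_le hR
  -- If `j` has no larger share than `i`, the price of `j` already bounds the share of `i`.
  rcases le_or_gt (A.share j) (A.share i) with hle | hlt
  · have := div_pos hcj hR0
    have := hp j hj
    linarith
  have hij : i ≠ j := by rintro rfl; exact lt_irrefl _ hlt
  obtain ⟨E, ⟨hES, -, hE⟩, hEi, -⟩ := hF i hi j hj
  -- In every equilibrium after the swap all members but `j` work: `i` gains, and the others keep a
  -- share that motivates them.
  have hmem : ∀ k ∈ A.team, k ≠ j → k ∈ E := by
    intro k hk hkj
    by_contra hkE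
    have h := hE k (Finset.mem_sdiff.2 ⟨hk, hkE⟩)
    rw [reward_union hI hkE, mul_add] at h
    dsimp only at h
    have hck := (cost_le_of_isFeasible hI hA hk).1
    by_cases hki : k = i
    · subst hki
      rw [Equiv.swap_apply_left] at h
      have := mul_le_mul_of_nonneg_right hlt.le (single_nonneg (I := I) k)
      linarith
    · rw [Equiv.swap_apply_of_ne_of_ne hki hkj] at h
      linarith
  have hsub : A.team \ {j} ⊆ E := fun k hk => by
    rw [Finset.mem_sdiff, Finset.mem_singleton] at hk
    exact hmem k hk.1 hk.2
  have h₁ := I.reward_mono hsub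
  rw [reward_sdiff hI hj] at h₁
  rw [if_pos (hmem i hi hij)] at hEi
  -- Absence of envy of `i`; the cost of `i` cancels since `i` works in both situations.
  have h₂ : A.share j * (I.reward A.team - I.single j) ≤ A.share i * I.reward A.team :=
    (mul_le_mul_of_nonneg_left h₁ (hA.1 j hj).1).trans (by linarith)
  have h₃ := mul_le_mul_of_nonneg_right (hp j hj) (sub_nonneg.2 hR)
  have h₄ : (I.cost j / I.single j - I.cost j / I.reward A.team) * I.reward A.team =
      I.cost j / I.single j * (I.reward A.team - I.single j) := by
    field_simp
  exact le_of_mul_le_mul_right (h₄.trans_le (h₃.trans h₂)) hR0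

theorem teamRevenue_toNat (hI : I.IsAdditive) (S : Finset (Fin n)) :
    teamRevenue (extend I.cost) (extend I.single) (toNat S) = I.revenue (I.cheapest S) := by
  rw [teamRevenue, sum_toNat S hI, revenue, cheapest]
  congr 2
  rw [toNat, Finset.sum_map]
  refine Finset.sum_congr rfl fun i hi => ?_
  simp [hi]

theorem revenue_le_teamRevenue (hI : I.IsAdditive) {A : TeamContract n} (hA : I.IsFeasible A)
    (hF : I.IsFair A) :
    I.revenue A ≤ teamRevenue (extend I.cost) (extend I.single) (toNat A.team) := by
  rw [teamRevenue_toNat hI]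
  refine mul_le_mul_of_nonneg_right (sub_le_sub_left ?_ _) (I.reward_mem _).1
  refine Finset.sum_le_sum fun i hi => ?_
  simpa [cheapest, show i ∈ A.team from hi] using cheapest_share_le hI hA hF hi

variable {S : Finset (Fin n)}

theorem cost_le_share_mul {i : Fin n} (hS : ∀ i ∈ S, I.cost i ≤ I.single i) (hi : i ∈ S) :
    I.cost i ≤ (I.cheapest S).share i * I.single i := by
  rw [← div_le_iff₀ (single_pos (hS i hi))]
  simp [cheapest, hi]

theorem isFeasible_cheapest (hI : I.IsAdditive) (hS : ∀ i ∈ S, I.cost i ≤ I.single i) :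
    I.IsFeasible (I.cheapest S) := by
  have hp : ∀ i ∈ S, I.cost i / I.single i ≤ 1 := fun i hi =>
    (div_le_one (single_pos (hS i hi))).2 (hS i hi)
  refine ⟨fun i hi => ?_, fun i hi => if_neg hi, fun i hi => ?_⟩
  · replace hi : i ∈ S := hi
    simp only [cheapest, hi, if_true]
    refine ⟨threshold_nonneg.trans (le_max_right _ _), max_le (hp i hi) ?_⟩
    refine threshold_toNat_le hI zero_le_one fun j hj => ?_
    have := div_nonneg (I.cost_pos j).le (I.reward_mem S).1
    linarith [hp j hj]
  · rw [reward_sdiff hI hi]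
    have := cost_le_share_mul hS hi
    linarith

/-- After the swap take as equilibrium the agents whose new share covers their price. If `α j > α
i`, then `α j` is the price of `j`, because the threshold does not exceed `α i`. So `j` stops
working, the reward drops by at least `f j`, and the definition of the threshold says that `i` does
not gain. -/
theorem isFair_cheapest (hI : I.IsAdditive) (hS : ∀ i ∈ S, I.cost i ≤ I.single i) :
    I.IsFair (I.cheapest S) := by
  set α := (I.cheapest S).share with hα
  have hαp : ∀ k ∈ S, I.cost k ≤ α k * I.single k := fun k hk => cost_le_share_mul hS hk
  have hα0 : ∀ k ∈ S, 0 ≤ α k := fun k hk => ((isFeasible_cheapest hI hS).1 k hk).1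
  -- `E` is described by membership only, so that the claim can be applied with the roles of `i` and
  -- `j` exchanged.
  have key : ∀ i ∈ S, ∀ j ∈ S, ∀ E : Finset (Fin n),
      (∀ k, k ∈ E ↔ k ∈ S ∧ I.cost k ≤ α (Equiv.swap i j k) * I.single k) →
      α j * I.reward E - (if i ∈ E then I.cost i else 0) ≤ α i * I.reward S - I.cost i := by
    intro i hi j hj E hE
    have hES : E ⊆ S := fun k hk => ((hE k).1 hk).1
    have hER := I.reward_mono hES
    have hE0 := (I.reward_mem E).1
    have hdrop : ∀ k ∈ S, k ∉ E → I.reward E ≤ I.reward S - I.single k := by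
      intro k hk hkE
      rw [← reward_sdiff hI hk]
      refine I.reward_mono fun l hl => Finset.mem_sdiff.2 ⟨hES hl, ?_⟩
      rw [Finset.mem_singleton]
      rintro rfl
      exact hkE hl
    rcases le_or_gt (α j) (α i) with hle | hlt
    · split_ifs with hiE
      · have h₁ := mul_le_mul hle hER hE0 (hα0 i hi)
        linarith
      · have h₁ := mul_le_mul hle (hdrop i hi hiE) hE0 (hα0 i hi)
        have h₂ := hαp i hi
        linarith
    · have hiE : i ∈ E := by
        rw [hE, Equiv.swap_apply_left]
        exact ⟨hi, (hαp i hi).trans (mul_le_mul_of_nonneg_right hlt.le (single_nonneg i))⟩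
      have hfj := single_pos (hS j hj)
      have hT : threshold (extend I.cost) (extend I.single) (toNat S) ≤ α i := by
        simp [hα, cheapest, hi]
      have hαj : α j = I.cost j / I.single j := by
        have h₁ : α j = max (I.cost j / I.single j)
            (threshold (extend I.cost) (extend I.single) (toNat S)) := by
          simp [hα, cheapest, hj]
        rw [h₁]
        refine max_eq_left ?_
        by_contra hlt'
        rw [max_eq_right (not_le.1 hlt').le] at h₁
        linarith
      have hjE : j ∉ E := by
        rw [hE, Equiv.swap_apply_right, not_and, not_le]
        intro _
        rwa [← lt_div_iff₀ hfj, ← hαj]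
      have hF0 : 0 < I.reward S :=
        hfj.trans_le (I.reward_mono (Finset.singleton_subset_iff.2 hj))
      have h₁ : α j * I.reward E ≤ α j * (I.reward S - I.single j) :=
        mul_le_mul_of_nonneg_left (hdrop j hj hjE) (hα0 j hj)
      have h₂ : α j * (I.reward S - I.single j) =
          (I.cost j / I.single j - I.cost j / I.reward S) * I.reward S := by
        rw [hαj]
        field_simp
      have h₃ := mul_le_mul_of_nonneg_right ((le_threshold_toNat hI hj).trans hT) hF0.le
      rw [if_pos hiE]
      linarith
  intro i hi j hj
  replace hi : i ∈ S := hi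
  replace hj : j ∈ S := hj
  set E := S.filter fun k => I.cost k ≤ α (Equiv.swap i j k) * I.single k with hE
  refine ⟨E, ⟨Finset.filter_subset _ _, fun k hk => ?_, fun k hk => ?_⟩,
    key i hi j hj E fun k => Finset.mem_filter, key j hj i hi E fun k => ?_⟩
  · rw [reward_sdiff hI hk]
    have := (Finset.mem_filter.1 hk).2
    change α (Equiv.swap i j k) * _ ≤ α (Equiv.swap i j k) * _ - _
    linarith
  · obtain ⟨h₁, h₂⟩ := Finset.mem_sdiff.1 hk
    rw [reward_union hI h₂]
    have h₃ : ¬ I.cost k ≤ α (Equiv.swap i j k) * I.single k := fun h =>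
      h₂ (Finset.mem_filter.2 ⟨h₁, h⟩)
    change α (Equiv.swap i j k) * _ - _ < α (Equiv.swap i j k) * _
    linarith
  · rw [Equiv.swap_comm]
    exact Finset.mem_filter

/-- A team whose revenue is almost as large as that of every other team yields an almost optimal
fair contract. -/
theorem isApproxOptimalFair_cheapest (hI : I.IsAdditive) (hS : ∀ i ∈ S, I.cost i ≤ I.single i)
    {ρ : ℝ} (h : ∀ R : Finset ℕ,
      (∀ k ∈ R, k < n ∧ extend I.cost k ≤ extend I.single k) →
        ρ * teamRevenue (extend I.cost) (extend I.single) R ≤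
          teamRevenue (extend I.cost) (extend I.single) (toNat S)) :
    I.IsApproxOptimalFair ρ (I.cheapest S) := by
  classical
  refine ⟨isFeasible_cheapest hI hS, isFair_cheapest hI hS, ?_⟩
  -- Existence of an optimum: the fair contracts of each team are dominated by its cheapest one, and
  -- there are finitely many teams.
  obtain ⟨R, hR, hmax⟩ := ((Finset.univ : Finset (Finset (Fin n))).filter
    fun R => ∀ i ∈ R, I.cost i ≤ I.single i).exists_max_image
    (fun R => I.revenue (I.cheapest R)) ⟨∅, by simp⟩
  have hRv := (Finset.mem_filter.1 hR).2
  refine ⟨I.cheapest R, ⟨isFeasible_cheapest hI hRv, isFair_cheapest hI hRv,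
    fun A hA hF => ?_⟩, ?_⟩
  · refine (revenue_le_teamRevenue hI hA hF).trans ?_
    rw [teamRevenue_toNat hI]
    exact hmax _ (Finset.mem_filter.2 ⟨Finset.mem_univ _,
      fun i hi => (cost_le_of_isFeasible hI hA hi).2⟩)
  · rw [← teamRevenue_toNat hI, ← teamRevenue_toNat hI]
    refine h _ fun k hk => ?_
    obtain ⟨i, hi, rfl⟩ := Finset.mem_map.1 hk
    simpa using hRv i hi

end TeamInstance

/-! ### Transfer from the field of the machine to the real numbers -/

theorem map_threshold {K : Type} [Field K] [LinearOrder K] (ι : K →+* ℝ) (hι : Monotone ι)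
    (c f : ℕ → K) (S : Finset ℕ) :
    ι (threshold c f S) = threshold (fun i => ι (c i)) (fun i => ι (f i)) S := by
  rw [threshold, threshold, ← map_zero ι,
    ← Finset.fold_hom (op := max) (op' := max) (m := ι) fun x y => hι.map_max]
  simp

theorem map_teamRevenue {K : Type} [Field K] [LinearOrder K] (ι : K →+* ℝ) (hι : Monotone ι)
    (c f : ℕ → K) (S : Finset ℕ) :
    ι (teamRevenue c f S) = teamRevenue (fun i => ι (c i)) (fun i => ι (f i)) S := by
  simp [teamRevenue, map_threshold ι hι, hι.map_max]

/-! ## The registers -/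

namespace Reg

/-! Integer arrays. -/

/-- The number of agents. -/
abbrev n : ℕ := 0
/-- The indicator of the team that is returned. -/
abbrev team : ℕ := 1
/-- The powers of two. -/
abbrev pow : ℕ := 2
/-- The next power of two. -/
abbrev double : ℕ := 3
/-- The least integer that is at least `1 / γ`. -/
abbrev G : ℕ := 4
/-- The number of units of the largest individual reward. -/
abbrev N : ℕ := 5
/-- The number of levels for the total reward. -/
abbrev levels : ℕ := 6
/-- The counter of auxiliary loops. -/
abbrev i : ℕ := 7
/-- The agent with the largest individual reward. -/
abbrev e : ℕ := 8
/-- The level of the total reward. -/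
abbrev a : ℕ := 9
/-- The agent that determines the threshold. -/
abbrev j : ℕ := 10
/-- The agent considered by the dynamic program. -/
abbrev k : ℕ := 11
/-- The counter for the cells of the dynamic program. -/
abbrev u : ℕ := 12
/-- The individual rewards in units. -/
abbrev units : ℕ := 13
/-- The teams of the dynamic program as bit masks. -/
abbrev masks : ℕ := 14
/-- The bit mask of the candidate team. -/
abbrev cand : ℕ := 15
/-- The part of the mask that remains to be decoded. -/
abbrev rest : ℕ := 16
/-- The indicator of the candidate team. -/
abbrev mark : ℕ := 17
/-- The bit mask of the best team so far. -/
abbrev best : ℕ := 18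

/-! Value arrays. -/

abbrev cost : ℕ := 0
abbrev reward : ℕ := 1
abbrev gamma : ℕ := 2
/-- The shares that are returned. -/
abbrev share : ℕ := 3
/-- The ratios of cost and individual reward. -/
abbrev price : ℕ := 4
/-- An accumulator. -/
abbrev acc : ℕ := 5
/-- The value of `G`. -/
abbrev valG : ℕ := 6
/-- The value of `N`. -/
abbrev valN : ℕ := 7
/-- The unit for rewards. -/
abbrev delta : ℕ := 8
/-- The assumed total reward. -/
abbrev x : ℕ := 9
/-- The assumed threshold. -/
abbrev T : ℕ := 10
/-- The minimal weights of the dynamic program. -/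
abbrev W : ℕ := 11
/-- The weight of the current agent. -/
abbrev w : ℕ := 12
/-- The total reward of the candidate. -/
abbrev total : ℕ := 13
/-- The threshold of the candidate. -/
abbrev thr : ℕ := 14
/-- The sum of the shares of the candidate. -/
abbrev sum : ℕ := 15
/-- The revenue of the best team so far. -/
abbrev bestRev : ℕ := 16
/-- The revenue of the candidate. -/
abbrev rev : ℕ := 17

end Reg

/-! ## Evaluation of a candidate -/

/-- The bit mask of a finite set. -/
def mask (S : Finset ℕ) : ℕ := ∑ i ∈ S, 2 ^ i

theorem mask_lt {S : Finset ℕ} {n : ℕ} (h : ∀ i ∈ S, i < n) : mask S < 2 ^ n :=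
  Nat.geomSum_lt le_rfl h

theorem filter_lt_succ (S : Finset ℕ) (k : ℕ) : S.filter (· < k + 1) =
    if k ∈ S then insert k (S.filter (· < k)) else S.filter (· < k) := by
  ext i
  split_ifs with h <;> simp only [Finset.mem_filter, Finset.mem_insert]
  · constructor
    · rintro ⟨h₁, h₂⟩
      by_cases hik : i = k
      · exact Or.inl hik
      · exact Or.inr ⟨h₁, by omega⟩
    · rintro (rfl | ⟨h₁, h₂⟩)
      · exact ⟨h, by omega⟩
      · exact ⟨h₁, by omega⟩
  · constructor
    · rintro ⟨h₁, h₂⟩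
      exact ⟨h₁, lt_of_le_of_ne (by omega) (by rintro rfl; exact h h₁)⟩
    · rintro ⟨h₁, h₂⟩
      exact ⟨h₁, by omega⟩

theorem filter_lt_of_subset {S : Finset ℕ} {n : ℕ} (h : S ⊆ Finset.range n) :
    S.filter (· < n) = S :=
  Finset.filter_true_of_mem fun _ hi => Finset.mem_range.1 (h hi)

/-- The agent that a descending loop considers. -/
abbrev descending : IntExpr := .sub (ivar Reg.n) (.add (ivar Reg.i) (.const 1))

/-- Computes the indicator and the total reward of the candidate from its mask. -/
def decode : Prog :=
  .seq (.setVal Reg.total (.const 0) (.const 0)) <|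
  .seq (.setInt Reg.rest (.const 0) (ivar Reg.cand)) <|
  .forLoop Reg.i (ivar Reg.n) <|
    .cond (.intLt (ivar Reg.rest) (.cell Reg.pow descending))
      (.setInt Reg.mark descending (.const 0)) <|
      .seq (.setInt Reg.rest (.const 0) (.sub (ivar Reg.rest) (.cell Reg.pow descending))) <|
      .seq (.setVal Reg.total (.const 0)
        (.add (vvar Reg.total) (.cell Reg.reward descending)))
      (.setInt Reg.mark descending (.const 1))

/-- The share that the agent of the loop requires in the candidate team. -/
abbrev required : ValExpr :=
  .sub (.cell Reg.price (ivar Reg.i)) (.div (.cell Reg.cost (ivar Reg.i)) (vvar Reg.total))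

/-- The agent of the loop is marked. -/
abbrev marked : Test := .intLt (.const 0) (.cell Reg.mark (ivar Reg.i))

/-- Computes the threshold of the candidate. -/
def computeThreshold : Prog :=
  .seq (.setVal Reg.thr (.const 0) (.const 0)) <|
  .forLoop Reg.i (ivar Reg.n) <|
    .cond marked
      (.cond (.valLt (vvar Reg.thr) required) (.setVal Reg.thr (.const 0) required) .skip) .skip

/-- Computes the sum of the shares of the candidate. -/
def computeSum : Prog :=
  .seq (.setVal Reg.sum (.const 0) (.const 0)) <|
  .forLoop Reg.i (ivar Reg.n) <|
    .cond marked
      (.cond (.valLt (.cell Reg.price (ivar Reg.i)) (vvar Reg.thr))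
        (.setVal Reg.sum (.const 0) (.add (vvar Reg.sum) (vvar Reg.thr)))
        (.setVal Reg.sum (.const 0) (.add (vvar Reg.sum) (.cell Reg.price (ivar Reg.i)))))
      .skip

/-- Computes the revenue of the candidate and keeps the candidate if it is the best one so far. -/
def evaluate : Prog :=
  .seq decode <| .seq computeThreshold <| .seq computeSum <|
  .seq (.setVal Reg.rev (.const 0)
    (.mul (.sub (.const 1) (vvar Reg.sum)) (vvar Reg.total))) <|
  .cond (.valLt (vvar Reg.bestRev) (vvar Reg.rev))
    (.seq (.setVal Reg.bestRev (.const 0) (vvar Reg.rev))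
      (.setInt Reg.best (.const 0) (ivar Reg.cand)))
    .skip

/-- The teams all of whose members can be motivated. -/
def IsValid {K : Type} [LE K] (n : ℕ) (c f : ℕ → K) (S : Finset ℕ) : Prop := ∀ k ∈ S, k < n ∧ c k ≤ f k

theorem IsValid.subset {K : Type} [LE K] {n : ℕ} {c f : ℕ → K} {S : Finset ℕ}
    (h : IsValid n c f S) : S ⊆ Finset.range n :=
  fun k hk => Finset.mem_range.2 (h k hk).1

section Env

variable {K : Type} [Field K] {n N : ℕ} {c f : ℕ → K} {σ : Store K}

/-- The data that the main part of the algorithm works with. -/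
structure Env (n N : ℕ) (c f : ℕ → K) (σ : Store K) : Prop where
  n_eq : σ.int Reg.n 0 = n
  N_eq : σ.int Reg.N 0 = N
  levels_eq : σ.int Reg.levels 0 = n * N
  pow_eq : ∀ i < n, σ.int Reg.pow i = 2 ^ i
  cost_eq : σ.val Reg.cost = c
  reward_eq : σ.val Reg.reward = f
  price_eq : ∀ i < n, σ.val Reg.price i = c i / f i
  valN_eq : σ.val Reg.valN 0 = N

theorem Env.congr {τ : Store K} (h : Env n N c f σ)
    (hi : ∀ a ∈ [Reg.n, Reg.N, Reg.levels, Reg.pow], τ.int a = σ.int a)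
    (hv : ∀ a ∈ [Reg.cost, Reg.reward, Reg.price, Reg.valN], τ.val a = σ.val a) :
    Env n N c f τ where
  n_eq := by rw [hi _ (by simp), h.n_eq]
  N_eq := by rw [hi _ (by simp), h.N_eq]
  levels_eq := by rw [hi _ (by simp), h.levels_eq]
  pow_eq := by rw [hi _ (by simp)]; exact h.pow_eq
  cost_eq := by rw [hv _ (by simp), h.cost_eq]
  reward_eq := by rw [hv _ (by simp), h.reward_eq]
  price_eq := by rw [hv _ (by simp)]; exact h.price_eq
  valN_eq := by rw [hv _ (by simp), h.valN_eq]

theorem Env.frame {P : Prog} {τ : Store K} (h : Env n N c f σ) (hf : Frame P σ τ)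
    (hi : ∀ a ∈ [Reg.n, Reg.N, Reg.levels, Reg.pow], P.writesInt a = false)
    (hv : ∀ a ∈ [Reg.cost, Reg.reward, Reg.price, Reg.valN], P.writesVal a = false) :
    Env n N c f τ :=
  h.congr (fun a ha => hf.int a (hi a ha)) fun a ha => hf.val a (hv a ha)

end Env

/-! ### Correctness of the evaluation of a candidate -/

section Specifications

variable {K : Type} [Field K] [LinearOrder K] {m : CostModel K} {𝓢 : SizeModel K m}
  {B L n N G : ℕ} {c f : ℕ → K} {γ : K} {σ : Store K}

/-- All numbers that the algorithm stores have size at most `B`, and none of its loops makes more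
than `L` rounds. -/
structure Budget (𝓢 : SizeModel K m) (B L n N G : ℕ) (c f : ℕ → K) (γ : K) : Prop where
  n_lt : n < B
  L_lt : L < 2 ^ B
  G_le : G ≤ L
  N_le : N ≤ L
  n_le : n ≤ L
  levels_lt : n * N < L
  nat : ∀ k : ℕ, k ≤ N + G + 2 → 𝓢.Fits B (k : K)
  price : ∀ i < n, 𝓢.Fits B (c i / f i)
  clock : ∀ k ≤ G, 𝓢.Fits B (k * γ)
  level : ∀ e < n, ∀ t ≤ n * N, 𝓢.Fits B (t * (f e / N))
  threshold : ∀ e < n, ∀ t ≤ n * N, ∀ j < n, 𝓢.Fits B (c j / f j - c j / (t * (f e / N)))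
  weight : ∀ e < n, ∀ t ≤ n * N, ∀ j < n, ∀ R ⊆ Finset.range n, ∀ z : K, z = 0 ∨ z = 2 →
    𝓢.Fits B (z + ∑ k ∈ R, max (c k / f k) (c j / f j - c j / (t * (f e / N))))
  reward : ∀ S ⊆ Finset.range n, 𝓢.Fits B (∑ k ∈ S, f k)
  envy : ∀ S ⊆ Finset.range n, ∀ k < n, 𝓢.Fits B (c k / f k - c k / ∑ i ∈ S, f i)
  shares : ∀ S ⊆ Finset.range n, ∀ R ⊆ Finset.range n,
    𝓢.Fits B (∑ k ∈ R, max (c k / f k) (FairTeam.threshold c f S))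
  revenue : ∀ S ⊆ Finset.range n, 𝓢.Fits B (teamRevenue c f S)

variable {S : Finset ℕ}

theorem Budget.lt_two_pow (hB : Budget 𝓢 B L n N G c f γ) {k : ℕ} (h : k ≤ L) : k < 2 ^ B :=
  h.trans_lt hB.L_lt

theorem Budget.fits_zero (hB : Budget 𝓢 B L n N G c f γ) : 𝓢.Fits B 0 := by
  simpa using hB.nat 0 (by omega)

theorem decode_spec (hB : Budget 𝓢 B L n N G c f γ) (hσ : Env n N c f σ)
    (hS : S ⊆ Finset.range n) (hcand : σ.int Reg.cand 0 = mask S) :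
    Runs 𝓢 B L decode σ fun τ =>
      (∀ i < n, τ.int Reg.mark i = if i ∈ S then 1 else 0) ∧
        τ.val Reg.total 0 = ∑ k ∈ S, f k := by
  have hSn : ∀ i ∈ S, i < n := fun i hi => Finset.mem_range.1 (hS hi)
  have hB1 : 1 < 2 ^ B := Nat.one_lt_two_pow (by have := hB.n_lt; omega)
  refine Runs.seq (Runs.setVal (by simpa using hB.fits_zero) ?_)
  refine Runs.seq (Runs.setInt ?_ ?_)
  · simp only [IntExpr.eval, Store.setVal_int, hcand]
    exact (mask_lt hSn).trans (Nat.pow_lt_pow_right one_lt_two hB.n_lt)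
  -- The bits are read from the top: after `k` rounds the agents from `n - k` on are decoded, and
  -- `rest` is the mask of the others.
  refine Runs.forLoop n hB.n_le (hB.lt_two_pow hB.n_le) (by decide) (fun τ hτ => ?_)
    (fun k τ => τ.int Reg.rest 0 = mask (S.filter (· < n - k)) ∧
      τ.val Reg.total 0 = ∑ i ∈ S.filter (n - k ≤ ·), f i ∧
      ∀ i < n, n - k ≤ i → τ.int Reg.mark i = if i ∈ S then 1 else 0) ?_ ?_ ?_
  · simp only [IntExpr.eval]
    rw [hτ.int _ (by decide)]
    simpa +decide using hσ.n_eq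
  · refine ⟨?_, ?_, fun i hi hi' => by omega⟩
    · simp +decide [hcand, filter_lt_of_subset hS]
    · rw [Finset.filter_false_of_mem fun i hi => by have := hSn i hi; omega]
      simp +decide
  · rintro k hk τ hτ hkτ ⟨h₁, h₂, h₃⟩
    obtain ⟨q, hq⟩ : ∃ q, n - k = q + 1 := ⟨n - k - 1, by omega⟩
    have hq' : n - (k + 1) = q := by omega
    have hn : τ.int Reg.n 0 = n := by
      rw [hτ.int _ (by decide)]
      simpa +decide using hσ.n_eq
    have hpow : τ.int Reg.pow q = 2 ^ q := by
      rw [hτ.int _ (by decide)]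
      simpa +decide using hσ.pow_eq q (by omega)
    have hf : τ.val Reg.reward = f := by
      rw [hτ.val _ (by decide)]
      simpa +decide using hσ.reward_eq
    have hge : S.filter (q ≤ ·) =
        if q ∈ S then insert q (S.filter (n - k ≤ ·)) else S.filter (n - k ≤ ·) := by
      ext i
      split_ifs with h <;> simp only [Finset.mem_filter, Finset.mem_insert, hq]
      · constructor
        · rintro ⟨hi, hi'⟩
          by_cases hiq : i = q
          · exact Or.inl hiq
          · exact Or.inr ⟨hi, by omega⟩
        · rintro (rfl | ⟨hi, hi'⟩)
          · exact ⟨h, le_rfl⟩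
          · exact ⟨hi, by omega⟩
      · constructor
        · rintro ⟨hi, hi'⟩
          exact ⟨hi, lt_of_le_of_ne hi' (by rintro rfl; exact h hi)⟩
        · rintro ⟨hi, hi'⟩
          exact ⟨hi, by omega⟩
    -- All lower bits together stay below `2 ^ q`, so comparing `rest` with `2 ^ q` reads off bit
    -- `q` without any division.
    have hlt : mask (S.filter (· < q)) < 2 ^ q := mask_lt fun i hi => (Finset.mem_filter.1 hi).2
    rw [hq, filter_lt_succ] at h₁
    refine Runs.cond (fun hb => ?_) fun hb => ?_
    · simp only [Test.Holds, IntExpr.eval, hn, hkτ, hq', hpow, h₁] at hb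
      have hqS : q ∉ S := by
        intro hqS
        rw [if_pos hqS, mask, Finset.sum_insert (by simp)] at hb
        omega
      rw [if_neg hqS] at h₁ hge
      refine Runs.setInt (by simp) ?_
      simp +decide only [IntExpr.eval, hn, hkτ, hq', Store.setInt_int_of_ne, Store.setInt_val,
        ne_eq, h₁, h₂, hge, true_and]
      intro i hi hi'
      rw [Store.setInt_int_self]
      by_cases hiq : i = q
      · rw [if_pos hiq, if_neg (hiq ▸ hqS)]
      · rw [if_neg hiq]
        exact h₃ i hi (by omega)
    · simp only [Test.Holds, IntExpr.eval, hn, hkτ, hq', hpow, h₁, not_lt] at hb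
      have hqS : q ∈ S := by
        by_contra hqS
        rw [if_neg hqS] at hb
        omega
      rw [if_pos hqS] at h₁ hge
      rw [mask, Finset.sum_insert (by simp)] at h₁
      have hsum : f q + ∑ i ∈ S.filter (n - k ≤ ·), f i =
          ∑ i ∈ S.filter (q ≤ ·), f i := by
        rw [hge, Finset.sum_insert (by simp [hq])]
      refine Runs.seq (Runs.setInt ?_ ?_)
      · simp only [IntExpr.eval, hn, hkτ, hq', hpow, h₁, Nat.add_sub_cancel_left]
        exact hlt.trans (Nat.pow_lt_pow_right one_lt_two (by have := hB.n_lt; omega))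
      refine Runs.seq (Runs.setVal ?_ ?_)
      · simp +decide only [ValExpr.eval, IntExpr.eval, hn, hkτ, hq', Store.setInt_int_of_ne,
          Store.setInt_val, ne_eq, h₂, hf]
        rw [add_comm, hsum]
        exact hB.reward _ ((Finset.filter_subset _ _).trans hS)
      refine Runs.setInt (by simpa using hB1) ?_
      simp +decide only [ValExpr.eval, IntExpr.eval, hn, hkτ, hq', Store.setInt_int_of_ne,
          Store.setInt_val, Store.setVal_int, ne_eq, h₁, h₂, hf, hpow,
          Store.setInt_int_self, Store.setVal_val_self, if_true]
      refine ⟨?_, ?_, fun i hi hi' => ?_⟩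
      · simp [mask]
      · rw [add_comm, hsum]
      · split_ifs with hiq hiS hiS
        · rfl
        · exact absurd (hiq ▸ hqS) hiS
        · rw [h₃ i hi (by omega), if_pos hiS]
        · rw [h₃ i hi (by omega), if_neg hiS]
  · rintro τ - ⟨-, h₂, h₃⟩
    refine ⟨fun i hi => h₃ i hi (by omega), ?_⟩
    rw [h₂, Finset.filter_true_of_mem fun i _ => by omega]

theorem computeThreshold_spec (hB : Budget 𝓢 B L n N G c f γ) (hσ : Env n N c f σ)
    (hS : S ⊆ Finset.range n) (hmark : ∀ i < n, σ.int Reg.mark i = if i ∈ S then 1 else 0)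
    (htotal : σ.val Reg.total 0 = ∑ k ∈ S, f k) :
    Runs 𝓢 B L computeThreshold σ fun τ => τ.val Reg.thr 0 = threshold c f S := by
  refine Runs.seq (Runs.setVal (by simpa using hB.fits_zero) ?_)
  refine Runs.forLoop n hB.n_le (hB.lt_two_pow hB.n_le) (by decide) (fun τ hτ => ?_)
    (fun k τ => τ.val Reg.thr 0 =
      (S.filter (· < k)).fold max 0 fun i => c i / f i - c i / ∑ k ∈ S, f k) ?_ ?_ ?_
  · simp only [IntExpr.eval]
    rw [hτ.int _ (by decide)]
    simpa +decide using hσ.n_eq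
  · simp +decide
  · intro k hk τ hτ hkτ h₁
    have hmk : τ.int Reg.mark k = if k ∈ S then 1 else 0 := by
      rw [hτ.int _ (by decide)]
      simpa +decide using hmark k hk
    have hp : τ.val Reg.price k = c k / f k := by
      rw [hτ.val _ (by decide)]
      simpa +decide using hσ.price_eq k hk
    have hc : τ.val Reg.cost = c := by
      rw [hτ.val _ (by decide)]
      simpa +decide using hσ.cost_eq
    have ht : τ.val Reg.total 0 = ∑ k ∈ S, f k := by
      rw [hτ.val _ (by decide)]
      simpa +decide using htotal
    have hreq : required.eval τ = c k / f k - c k / ∑ k ∈ S, f k := by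
      simp only [ValExpr.eval, IntExpr.eval, hkτ, hp, hc, ht]
    rw [filter_lt_succ]
    refine Runs.cond (fun hb => ?_) fun hb => Runs.skip ?_
    · simp only [Test.Holds, IntExpr.eval, hkτ, hmk] at hb
      have hkS : k ∈ S := by
        by_contra hkS
        simp [hkS] at hb
      rw [if_pos hkS, Finset.fold_insert (by simp), ← h₁]
      refine Runs.cond (fun hb' => Runs.setVal ?_ ?_) fun hb' => Runs.skip ?_
      · rw [hreq]
        exact hB.envy S hS k hk
      · rw [Test.Holds, hreq] at hb'
        rw [hreq, max_eq_left]
        · simp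
        · exact hb'.le
      · rw [Test.Holds, hreq, not_lt] at hb'
        rw [max_eq_right]
        · simp
        · exact hb'
    · simp only [Test.Holds, IntExpr.eval, hkτ, hmk] at hb
      have hkS : k ∉ S := by
        intro hkS
        simp [hkS] at hb
      rw [if_neg hkS]
      simpa using h₁
  · intro τ _ h
    rw [h, filter_lt_of_subset hS, threshold]

theorem computeSum_spec (hB : Budget 𝓢 B L n N G c f γ) (hσ : Env n N c f σ)
    (hS : S ⊆ Finset.range n) (hmark : ∀ i < n, σ.int Reg.mark i = if i ∈ S then 1 else 0)
    (hthr : σ.val Reg.thr 0 = threshold c f S) :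
    Runs 𝓢 B L computeSum σ fun τ =>
      τ.val Reg.sum 0 = ∑ k ∈ S, max (c k / f k) (threshold c f S) := by
  refine Runs.seq (Runs.setVal (by simpa using hB.fits_zero) ?_)
  refine Runs.forLoop n hB.n_le (hB.lt_two_pow hB.n_le) (by decide) (fun τ hτ => ?_)
    (fun k τ => τ.val Reg.sum 0 =
      ∑ k ∈ S.filter (· < k), max (c k / f k) (threshold c f S)) ?_ ?_ ?_
  · simp only [IntExpr.eval]
    rw [hτ.int _ (by decide)]
    simpa +decide using hσ.n_eq
  · simp +decide
  · intro k hk τ hτ hkτ h₁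
    have hmk : τ.int Reg.mark k = if k ∈ S then 1 else 0 := by
      rw [hτ.int _ (by decide)]
      simpa +decide using hmark k hk
    have hp : τ.val Reg.price k = c k / f k := by
      rw [hτ.val _ (by decide)]
      simpa +decide using hσ.price_eq k hk
    have ht : τ.val Reg.thr 0 = threshold c f S := by
      rw [hτ.val _ (by decide)]
      simpa +decide using hthr
    -- The accumulator holds partial sums, but with the threshold of all of `S`; therefore the
    -- budget for `shares` involves two sets.
    have hfit := hB.shares S hS (S.filter (· < k + 1)) ((Finset.filter_subset _ _).trans hS)
    rw [filter_lt_succ] at hfit ⊢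
    refine Runs.cond (fun hb => ?_) fun hb => Runs.skip ?_
    · simp only [Test.Holds, IntExpr.eval, hkτ, hmk] at hb
      have hkS : k ∈ S := by
        by_contra hkS
        simp [hkS] at hb
      rw [if_pos hkS, Finset.sum_insert (by simp), ← h₁, add_comm] at hfit ⊢
      refine Runs.cond (fun hb' => ?_) fun hb' => ?_
      · simp only [Test.Holds, ValExpr.eval, IntExpr.eval, hkτ, hp, ht] at hb'
        rw [max_eq_right hb'.le] at hfit ⊢
        refine Runs.setVal ?_ ?_ <;> simp only [ValExpr.eval, IntExpr.eval, ht]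
        · exact hfit
        · simp [add_comm]
      · simp only [Test.Holds, ValExpr.eval, IntExpr.eval, hkτ, hp, ht, not_lt] at hb'
        rw [max_eq_left hb'] at hfit ⊢
        refine Runs.setVal ?_ ?_ <;> simp only [ValExpr.eval, IntExpr.eval, hkτ, hp]
        · exact hfit
        · simp [add_comm]
    · simp only [Test.Holds, IntExpr.eval, hkτ, hmk] at hb
      have hkS : k ∉ S := by
        intro hkS
        simp [hkS] at hb
      rw [if_neg hkS]
      simpa using h₁
  · intro τ _ h
    rw [h, filter_lt_of_subset hS]

/-- The best candidate so far is stored. -/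
def HasBest (n : ℕ) (c f : ℕ → K) (σ : Store K) : Prop :=
  ∃ S, IsValid n c f S ∧ σ.int Reg.best 0 = mask S ∧ σ.val Reg.bestRev 0 = teamRevenue c f S

theorem HasBest.congr {τ : Store K} (h : HasBest n c f σ) (hi : τ.int Reg.best = σ.int Reg.best)
    (hv : τ.val Reg.bestRev = σ.val Reg.bestRev) : HasBest n c f τ := by
  rw [HasBest, hi, hv]
  exact h

/-- Besides the best candidate, the indicator and the threshold are recorded, since the final
contract is written from them. -/
theorem evaluate_spec (hB : Budget 𝓢 B L n N G c f γ) (hσ : Env n N c f σ)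
    (hS : IsValid n c f S) (hcand : σ.int Reg.cand 0 = mask S) (hbest : HasBest n c f σ) :
    Runs 𝓢 B L evaluate σ fun τ =>
      (∀ i < n, τ.int Reg.mark i = if i ∈ S then 1 else 0) ∧
      τ.val Reg.thr 0 = threshold c f S ∧ HasBest n c f τ ∧
      σ.val Reg.bestRev 0 ≤ τ.val Reg.bestRev 0 ∧ teamRevenue c f S ≤ τ.val Reg.bestRev 0 := by
  refine Runs.seq ((decode_spec hB hσ hS.subset hcand).mono fun τ₁ hf₁ h₁ => ?_)
  have hσ₁ := hσ.frame hf₁ (by decide) (by decide)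
  refine Runs.seq ((computeThreshold_spec hB hσ₁ hS.subset h₁.1 h₁.2).mono fun τ₂ hf₂ h₂ => ?_)
  have hσ₂ := hσ₁.frame hf₂ (by decide) (by decide)
  have hm₂ : τ₂.int Reg.mark = τ₁.int Reg.mark := hf₂.int _ (by decide)
  have ht₂ : τ₂.val Reg.total = τ₁.val Reg.total := hf₂.val _ (by decide)
  refine Runs.seq ((computeSum_spec hB hσ₂ hS.subset (hm₂ ▸ h₁.1) h₂).mono fun τ₃ hf₃ h₃ => ?_)
  have hm₃ : τ₃.int Reg.mark = τ₁.int Reg.mark := (hf₃.int _ (by decide)).trans hm₂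
  have ht₃ : τ₃.val Reg.total 0 = ∑ k ∈ S, f k := by
    rw [hf₃.val _ (by decide), ht₂, h₁.2]
  have hthr₃ : τ₃.val Reg.thr 0 = threshold c f S := by
    rw [hf₃.val _ (by decide), h₂]
  have hcand₃ : τ₃.int Reg.cand 0 = mask S := by
    rw [hf₃.int _ (by decide), hf₂.int _ (by decide), hf₁.int _ (by decide), hcand]
  have hb₃ : τ₃.val Reg.bestRev = σ.val Reg.bestRev := by
    rw [hf₃.val _ (by decide), hf₂.val _ (by decide), hf₁.val _ (by decide)]
  have hbi₃ : τ₃.int Reg.best = σ.int Reg.best := by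
    rw [hf₃.int _ (by decide), hf₂.int _ (by decide), hf₁.int _ (by decide)]
  have hrev : (ValExpr.mul (.sub (.const 1) (vvar Reg.sum)) (vvar Reg.total)).eval τ₃ =
      teamRevenue c f S := by
    simp only [ValExpr.eval, IntExpr.eval, h₃, ht₃, Nat.cast_one, teamRevenue]
  have hfit := hB.revenue S hS.subset
  refine Runs.seq (Runs.setVal ?_ ?_)
  · rwa [hrev]
  rw [hrev]
  refine Runs.cond (fun hb => ?_) fun hb => ?_
  · simp +decide [hb₃] at hb
    refine Runs.seq (Runs.setVal (by simpa using hfit) (Runs.setInt ?_ ?_))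
    · simp only [IntExpr.eval, Store.setVal_int, hcand₃]
      exact (mask_lt fun i hi => (hS i hi).1).trans (Nat.pow_lt_pow_right one_lt_two hB.n_lt)
    · simp +decide only [ValExpr.eval, IntExpr.eval, Store.setInt_int_of_ne,
        Store.setInt_val, Store.setVal_int, ne_eq,
      Store.setVal_val_self, Store.setVal_val_of_ne, if_true, hm₃, hthr₃, hcand₃]
      exact ⟨h₁.1, trivial, ⟨S, hS, by simp, by simp⟩, hb.le, le_rfl⟩
  · simp +decide [hb₃] at hb
    refine Runs.skip ?_
    simp +decide only [Store.setVal_int, Store.setVal_val_of_ne, ne_eq, hm₃,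
      hthr₃, hb₃]
    exact ⟨h₁.1, trivial, hbest.congr (by simp [hbi₃]) (by simp +decide [hb₃]), le_rfl, hb⟩

end Specifications

/-! ## The dynamic program -/

/-- Expresses all individual rewards in units of a fraction of the reward of agent `e`. -/
def roundRewards : Prog :=
  .seq (.setVal Reg.delta (.const 0) (.div (.cell Reg.reward (ivar Reg.e)) (vvar Reg.valN))) <|
  .forLoop Reg.k (ivar Reg.n) <|
    .seq (.setInt Reg.units (ivar Reg.k) (.const 0)) <|
    .seq (.setVal Reg.acc (.const 0) (.const 0)) <|
    .forLoop Reg.i (ivar Reg.N) <|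
      .seq (.setVal Reg.acc (.const 0) (.add (vvar Reg.acc) (vvar Reg.delta))) <|
      .cond (.valLt (.cell Reg.reward (ivar Reg.k)) (vvar Reg.acc)) .skip
        (.setInt Reg.units (ivar Reg.k) (.add (ivar Reg.i) (.const 1)))

/-- The number of cells of the dynamic program. -/
abbrev cells : IntExpr := .add (ivar Reg.a) (.const 2)

/-- The cell that a descending loop considers. -/
abbrev current : IntExpr := .sub (.add (ivar Reg.a) (.const 1)) (ivar Reg.u)

/-- The cell from which the current one is reached by adding agent `k`. -/
abbrev previous : IntExpr := .sub current (.cell Reg.units (ivar Reg.k))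

/-- The weight of the current cell if agent `k` is added. -/
abbrev augmented : ValExpr := .add (vvar Reg.w) (.cell Reg.W previous)

/-- Adds agent `k` to the team of the current cell if this is an improvement. -/
def relax : Prog :=
  .cond (.valLt augmented (.cell Reg.W current))
    (.seq (.setVal Reg.W current augmented)
      (.setInt Reg.masks current (.add (.cell Reg.masks previous) (.cell Reg.pow (ivar Reg.k)))))
    .skip

/-- Cells of the dynamic program before any agent is considered. -/
def initCells : Prog :=
  .seq (.forLoop Reg.u cells <|
    .seq (.setVal Reg.W (ivar Reg.u) (.const 2)) (.setInt Reg.masks (ivar Reg.u) (.const 0)))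
  (.setVal Reg.W (.const 0) (.const 0))

/-- Lets all cells take agent `k` into account. -/
def relaxAll : Prog :=
  .seq (.cond (.valLt (.cell Reg.price (ivar Reg.k)) (vvar Reg.T))
    (.setVal Reg.w (.const 0) (vvar Reg.T))
    (.setVal Reg.w (.const 0) (.cell Reg.price (ivar Reg.k))))
  (.forLoop Reg.u cells relax)

/-- Lets all cells take agent `k` into account if this agent is admissible. -/
def considerAgent : Prog :=
  .cond (.valLt (.cell Reg.reward (ivar Reg.k)) (.cell Reg.cost (ivar Reg.k))) .skip <|
  .cond (.valLt (.cell Reg.reward (ivar Reg.e)) (.cell Reg.reward (ivar Reg.k))) .skip <|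
  .cond (.valLt (vvar Reg.T) (.sub (.cell Reg.price (ivar Reg.k))
    (.div (.cell Reg.cost (ivar Reg.k)) (vvar Reg.x)))) .skip relaxAll

/-- Computes a lightest team for the current guesses. -/
def lightestTeam : Prog :=
  .seq (.setVal Reg.T (.const 0) (.sub (.cell Reg.price (ivar Reg.j))
    (.div (.cell Reg.cost (ivar Reg.j)) (vvar Reg.x)))) <|
  .seq initCells <|
  .seq (.forLoop Reg.k (ivar Reg.n) considerAgent) <|
  .setInt Reg.cand (.const 0) (.cell Reg.masks (.add (ivar Reg.a) (.const 1)))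

/-! ### The knapsack recursion -/

section Cells

variable {K : Type} [Field K] [LinearOrder K] {A : Finset ℕ} {u : ℕ → ℕ} {w : ℕ → K} {k s : ℕ}
  {W W' : K} {M M' : ℕ}

/-- The contents `W`, `M` of cell `s` of the dynamic program after the agents below `k` have been
considered: `M` is the mask of a team of weight `W` and at least `s` units that is lightest among
these; or `W` is at least `2`. -/
def IsCell (A : Finset ℕ) (u : ℕ → ℕ) (w : ℕ → K) (k s : ℕ) (W : K) (M : ℕ) : Prop :=
  ∃ R ⊆ A.filter (· < k), M = mask R ∧
    (∃ z : K, W = z + ∑ i ∈ R, w i ∧ (z = 2 ∨ z = 0 ∧ s ≤ ∑ i ∈ R, u i)) ∧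
    ∀ S ⊆ A.filter (· < k), s ≤ ∑ i ∈ S, u i → W ≤ ∑ i ∈ S, w i

theorem isCell_zero_zero : IsCell A u w 0 0 0 0 :=
  ⟨∅, by simp, by simp [mask], ⟨0, by simp, Or.inr ⟨rfl, by simp⟩⟩, fun S hS _ => by
    rw [show S = ∅ by simpa using hS]
    simp⟩

/-- The value `2` plays the role of infinity: a team of weight at least `2` would have to be paid
more than the whole reward. -/
theorem isCell_zero_succ : IsCell A u w 0 (s + 1) 2 0 :=
  ⟨∅, by simp, by simp [mask], ⟨2, by simp, Or.inl rfl⟩, fun S hS h => by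
    rw [show S = ∅ by simpa using hS] at h
    simp at h⟩

theorem IsCell.succ_of_notMem (h : IsCell A u w k s W M) (hk : k ∉ A) :
    IsCell A u w (k + 1) s W M := by
  rw [IsCell, filter_lt_succ, if_neg hk]
  exact h

theorem sum_erase_units (S : Finset ℕ) (hk : k ∈ S) (h : s ≤ ∑ i ∈ S, u i) :
    s - u k ≤ ∑ i ∈ S.erase k, u i := by
  rw [← Finset.add_sum_erase S u hk] at h
  omega

variable [IsStrictOrderedRing K]

/-- A team with `k` and at least `s` units leaves, without `k`, a team with at least `s - u k`
units. Truncated subtraction is right here, since a cell asks for "at least" its number of units.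
Teams without `k` are covered by the old entry, which is larger than the new one. -/
theorem IsCell.relax (h : IsCell A u w k s W M) (h' : IsCell A u w k (s - u k) W' M') (hk : k ∈ A)
    (hlt : w k + W' < W) : IsCell A u w (k + 1) s (w k + W') (M' + 2 ^ k) := by
  obtain ⟨R, hR, rfl, ⟨z, rfl, hz⟩, hopt'⟩ := h'
  obtain ⟨-, -, -, -, hopt⟩ := h
  have hkR : k ∉ R := fun hkR => by simpa using hR hkR
  rw [IsCell, filter_lt_succ, if_pos hk]
  refine ⟨insert k R, Finset.insert_subset_insert k hR, ?_, ⟨z, ?_, ?_⟩, fun S hS hs => ?_⟩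
  · rw [mask, mask, Finset.sum_insert hkR, add_comm]
  · rw [Finset.sum_insert hkR]
    ring
  · refine hz.imp id (And.imp id fun hz => ?_)
    rw [Finset.sum_insert hkR]
    omega
  · by_cases hkS : k ∈ S
    · rw [← Finset.add_sum_erase S w hkS]
      refine add_le_add_right (hopt' _ ?_ (sum_erase_units S hkS hs)) _
      rwa [← Finset.subset_insert_iff]
    · exact hlt.le.trans (hopt S ((Finset.subset_insert_iff_of_notMem hkS).1 hS) hs)

theorem IsCell.keep (h : IsCell A u w k s W M) (h' : IsCell A u w k (s - u k) W' M') (hk : k ∈ A)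
    (hle : W ≤ w k + W') : IsCell A u w (k + 1) s W M := by
  obtain ⟨-, -, -, -, hopt'⟩ := h'
  obtain ⟨R, hR, hM, hW, hopt⟩ := h
  rw [IsCell, filter_lt_succ, if_pos hk]
  refine ⟨R, hR.trans (Finset.subset_insert _ _), hM, hW, fun S hS hs => ?_⟩
  by_cases hkS : k ∈ S
  · rw [← Finset.add_sum_erase S w hkS]
    refine hle.trans (add_le_add_right (hopt' _ ?_ (sum_erase_units S hkS hs)) _)
    rwa [← Finset.subset_insert_iff]
  · exact hopt S ((Finset.subset_insert_iff_of_notMem hkS).1 hS) hs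

/-- Weights are nonnegative, so a cell that still contains the summand `2` shows that no team with
enough units weighs less than `2`. -/
theorem IsCell.isLightest {c f : ℕ → K} {n : ℕ} {b x T : K} (hc : ∀ k < n, 0 < c k)
    (h : IsCell (admissible c f n b x T) u (fun k => max (c k / f k) T) n s W M) :
    ∃ R, M = mask R ∧ IsLightest c f n b x T u s R := by
  obtain ⟨R, hR, hM, ⟨z, hW, hz⟩, hopt⟩ := h
  have hA : admissible c f n b x T ⊆ Finset.range n := Finset.filter_subset _ _
  rw [filter_lt_of_subset hA] at hR hopt
  refine ⟨R, hM, hR, fun S hS hs hlt => ?_⟩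
  have hle := hopt S hS hs
  have h0 : 0 ≤ ∑ k ∈ R, max (c k / f k) T := by
    refine Finset.sum_nonneg fun k hk => le_max_of_le_left ?_
    have hk := Finset.mem_filter.1 (hR hk)
    have hck := hc k (Finset.mem_range.1 hk.1)
    exact div_nonneg hck.le (hck.le.trans hk.2.1)
  rcases hz with rfl | ⟨rfl, hz⟩
  · linarith
  · exact ⟨hz, by rwa [hW, zero_add] at hle⟩

end Cells

theorem IsLightest.isValid {K : Type} [Field K] [LinearOrder K] {c f : ℕ → K} {n a : ℕ} {b x T : K}
    {u : ℕ → ℕ} {R : Finset ℕ} (h : IsLightest c f n b x T u a R) : IsValid n c f R := fun _ hk =>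
  have hk := Finset.mem_filter.1 (h.subset hk)
  ⟨Finset.mem_range.1 hk.1, hk.2.1⟩

/-- The guesses for which a lightest team is computed: the agent `e` with the largest individual
reward, the level `a` of the total reward, and the agent `j` that determines the threshold. -/
structure Guess {K : Type} [Field K] [LinearOrder K] (n N : ℕ) (c f : ℕ → K) (e a j : ℕ)
    (σ : Store K) : Prop extends Env n N c f σ where
  e_eq : σ.int Reg.e 0 = e
  a_eq : σ.int Reg.a 0 = a
  j_eq : σ.int Reg.j 0 = j
  x_eq : σ.val Reg.x 0 = (a + 1 : ℕ) * (f e / N)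
  units_eq : ∀ k < n, σ.int Reg.units k = units f (f e / N) N k

section Guess

variable {K : Type} [Field K] [LinearOrder K] {n N e a j : ℕ} {c f : ℕ → K} {σ τ : Store K}

theorem Guess.congr (h : Guess n N c f e a j σ)
    (hi : ∀ b ∈ [Reg.n, Reg.N, Reg.levels, Reg.pow, Reg.e, Reg.a, Reg.j, Reg.units],
      τ.int b = σ.int b)
    (hv : ∀ b ∈ [Reg.cost, Reg.reward, Reg.price, Reg.valN, Reg.x], τ.val b = σ.val b) :
    Guess n N c f e a j τ where
  toEnv := h.toEnv.congr
    (fun b hb => hi b (by simp only [List.mem_cons, List.not_mem_nil] at hb ⊢; tauto))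
    fun b hb => hv b (by simp only [List.mem_cons, List.not_mem_nil] at hb ⊢; tauto)
  e_eq := by rw [hi _ (by simp), h.e_eq]
  a_eq := by rw [hi _ (by simp), h.a_eq]
  j_eq := by rw [hi _ (by simp), h.j_eq]
  x_eq := by rw [hv _ (by simp), h.x_eq]
  units_eq := by rw [hi _ (by simp)]; exact h.units_eq

theorem Guess.frame {P : Prog} (h : Guess n N c f e a j σ) (hf : Frame P σ τ)
    (hi : ∀ b ∈ [Reg.n, Reg.N, Reg.levels, Reg.pow, Reg.e, Reg.a, Reg.j, Reg.units],
      P.writesInt b = false)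
    (hv : ∀ b ∈ [Reg.cost, Reg.reward, Reg.price, Reg.valN, Reg.x], P.writesVal b = false) :
    Guess n N c f e a j τ :=
  h.congr (fun b hb => hf.int b (hi b hb)) fun b hb => hf.val b (hv b hb)

end Guess

/-! ### Correctness of the dynamic program -/

section Specifications

variable {K : Type} [Field K] [LinearOrder K] {m : CostModel K} {𝓢 : SizeModel K m}
  {B L n N G e a j : ℕ} {c f : ℕ → K} {γ : K} {σ : Store K}

theorem roundRewards_spec (hB : Budget 𝓢 B L n N G c f γ) (hσ : Env n N c f σ) (he : e < n)
    (heσ : σ.int Reg.e 0 = e) :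
    Runs 𝓢 B L roundRewards σ fun τ =>
      τ.val Reg.delta 0 = f e / N ∧ ∀ k < n, τ.int Reg.units k = units f (f e / N) N k := by
  have hNn : N ≤ n * N := Nat.le_mul_of_pos_left N (by omega)
  have hδ : (ValExpr.div (.cell Reg.reward (ivar Reg.e)) (vvar Reg.valN)).eval σ = f e / N := by
    simp only [ValExpr.eval, IntExpr.eval, hσ.reward_eq, hσ.valN_eq, heσ]
  refine Runs.seq (Runs.setVal ?_ ?_)
  · rw [hδ]
    -- For `N = 0` the division returns `0`; otherwise `δ` is the first level of the budget.
    rcases Nat.eq_zero_or_pos N with h0 | hpos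
    · simpa [h0] using hB.fits_zero
    · simpa using hB.level e he 1 (by omega)
  rw [hδ]
  refine Runs.forLoop n hB.n_le (hB.lt_two_pow hB.n_le) (by decide) (fun τ hτ => ?_)
    (fun k τ => τ.val Reg.delta 0 = f e / N ∧
      ∀ k' < k, τ.int Reg.units k' = units f (f e / N) N k') ?_ ?_ ?_
  · simp only [IntExpr.eval]
    rw [hτ.int _ (by decide)]
    simpa +decide using hσ.n_eq
  · simp
  · rintro k hk τ hτ hkτ ⟨h₁, h₂⟩
    have hf : τ.val Reg.reward = f := by
      rw [hτ.val _ (by decide)]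
      simpa +decide using hσ.reward_eq
    refine Runs.seq (Runs.setInt (by simp) (Runs.seq (Runs.setVal (by simpa using hB.fits_zero) ?_)))
    simp only [IntExpr.eval, ValExpr.eval, hkτ, Nat.cast_zero]
    -- Field elements cannot be rounded to integers directly, so the multiples of `δ` are compared
    -- with `f k` one by one.
    refine Runs.forLoop N hB.N_le (hB.lt_two_pow hB.N_le) (by decide) (fun υ hυ => ?_)
      (fun t υ => υ.val Reg.acc 0 = t * (f e / N) ∧
        υ.int Reg.units k = Nat.findGreatest (fun t => (t : K) * (f e / N) ≤ f k) t ∧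
        ∀ k' < k, υ.int Reg.units k' = units f (f e / N) N k') ?_ ?_ ?_
    · simp only [IntExpr.eval]
      rw [hυ.int _ (by decide)]
      simp +decide only [Store.setVal_int, Store.setInt_int_of_ne, ne_eq]
      rw [hτ.int _ (by decide)]
      simpa +decide using hσ.N_eq
    · refine ⟨by simp, by simp +decide, fun k' hk' => ?_⟩
      simp +decide only [Store.setVal_int, Store.setInt_int_of_ne, Store.setInt_int_self, ne_eq]
      rw [if_neg (by omega), h₂ k' hk']
    · rintro t ht υ hυ htυ ⟨h₃, h₄, h₅⟩
      have hkυ : υ.int Reg.k 0 = k := by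
        rw [hυ.int _ (by decide)]
        simpa +decide using hkτ
      have hfυ : υ.val Reg.reward = f := by
        rw [hυ.val _ (by decide)]
        simpa +decide using hf
      have hδυ : υ.val Reg.delta 0 = f e / N := by
        rw [hυ.val _ (by decide)]
        simpa +decide using h₁
      have hacc : (ValExpr.add (vvar Reg.acc) (vvar Reg.delta)).eval υ =
          ((t + 1 : ℕ) : K) * (f e / N) := by
        simp only [ValExpr.eval, IntExpr.eval, h₃, hδυ]
        push_cast
        ring
      refine Runs.seq (Runs.setVal ?_ ?_)
      · rw [hacc]
        exact hB.level e he _ (by omega)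
      rw [hacc]
      refine Runs.cond (fun hb => Runs.skip ?_) fun hb => Runs.setInt ?_ ?_
      · simp +decide [hkυ, hfυ] at hb
        refine ⟨by simp, ?_, ?_⟩
        · rw [Nat.findGreatest_of_not (by push_cast; exact not_le.2 hb)]
          simpa +decide using h₄
        · simpa +decide using h₅
      · simp +decide only [IntExpr.eval, Store.setVal_int, htυ]
        exact hB.lt_two_pow (by have := hB.N_le; omega)
      · simp +decide [hkυ, hfυ] at hb
        refine ⟨by simp +decide, ?_, ?_⟩
        · rw [Nat.findGreatest_eq (by push_cast; exact hb)]
          simp +decide [hkυ, htυ]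
        · intro k' hk'
          simp +decide only [IntExpr.eval, Store.setVal_int, hkυ, Store.setInt_int_of_ne,
            Store.setInt_int_self, ne_eq]
          rw [if_neg (by omega), h₅ k' hk']
    · rintro υ hυ ⟨-, h₄, h₅⟩
      refine ⟨?_, fun k' hk' => ?_⟩
      · simp only [Store.setInt_val]
        rw [hυ.val _ (by decide)]
        simpa +decide using h₁
      · simp +decide only [Store.setInt_int_of_ne, ne_eq]
        rcases (Nat.lt_succ_iff_lt_or_eq.1 hk') with h | rfl
        · exact h₅ k' h
        · exact h₄
  · rintro τ - h
    exact h

/-- The threshold that belongs to a guess. -/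
def guessThreshold (c f : ℕ → K) (N e a j : ℕ) : K :=
  c j / f j - c j / ((a + 1 : ℕ) * (f e / N))

/-- The team computed for a guess. -/
abbrev IsLightestFor (n N : ℕ) (c f : ℕ → K) (e a j : ℕ) (R : Finset ℕ) : Prop :=
  IsLightest c f n (f e) ((a + 1 : ℕ) * (f e / N)) (guessThreshold c f N e a j)
    (units f (f e / N) N) (a + 1) R

/-- The cells of the dynamic program for a guess. -/
abbrev IsGuessCell (n N : ℕ) (c f : ℕ → K) (e a j k s : ℕ) (σ : Store K) : Prop :=
  IsCell (admissible c f n (f e) ((a + 1 : ℕ) * (f e / N)) (guessThreshold c f N e a j))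
    (units f (f e / N) N) (fun k => max (c k / f k) (guessThreshold c f N e a j)) k s
    (σ.val Reg.W s) (σ.int Reg.masks s)

theorem cells_eval (hB : Budget 𝓢 B L n N G c f γ) (ha : a < n * N) : a + 2 ≤ L := by
  have := hB.levels_lt
  omega

theorem initCells_spec (hB : Budget 𝓢 B L n N G c f γ) (hσ : Guess n N c f e a j σ)
    (ha : a < n * N) :
    Runs 𝓢 B L initCells σ fun τ => ∀ s ≤ a + 1, IsGuessCell n N c f e a j 0 s τ := by
  have haL : a + 2 ≤ L := cells_eval hB ha
  refine Runs.seq (Runs.forLoop (a + 2) haL (hB.lt_two_pow haL) (by decide) (fun τ hτ => ?_)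
    (fun k τ => ∀ s < k, τ.val Reg.W s = 2 ∧ τ.int Reg.masks s = 0) ?_ ?_ ?_)
  · simp only [IntExpr.eval]
    rw [hτ.int _ (by decide), hσ.a_eq]
  · simp
  · intro k hk τ hτ hkτ h
    refine Runs.seq (Runs.setVal ?_ (Runs.setInt (by simp) ?_))
    · simpa using hB.nat 2 (by omega)
    · intro s hs
      simp +decide only [IntExpr.eval, ValExpr.eval, Store.setVal_int, Store.setInt_int_of_ne,
        Store.setInt_val, ne_eq, hkτ, Store.setInt_int_self, Store.setVal_val_self]
      split_ifs with hsk
      · simp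
      · exact h s (by omega)
  · intro τ _ h
    refine Runs.setVal (by simpa using hB.fits_zero) fun s hs => ?_
    rcases s with _ | s
    · simpa [IsGuessCell, (h 0 (by omega)).2] using isCell_zero_zero
    · simpa [IsGuessCell, h (s + 1) (by omega)] using isCell_zero_succ

/-- A cell always holds `0` or `2` plus the weight of a single set of agents, and a mask below `2 ^
n`. So its size does not grow with the number of updates. -/
theorem Budget.fits_cell (hB : Budget 𝓢 B L n N G c f γ) (he : e < n) (ha : a < n * N) (hj : j < n)
    {u : ℕ → ℕ} {k s M : ℕ} {W : K}
    (h : IsCell (admissible c f n (f e) ((a + 1 : ℕ) * (f e / N)) (guessThreshold c f N e a j)) u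
      (fun k => max (c k / f k) (guessThreshold c f N e a j)) k s W M) :
    𝓢.Fits B W ∧ M < 2 ^ B := by
  obtain ⟨R, hR, hM, ⟨z, hW, hz⟩, -⟩ := h
  have hRn : R ⊆ Finset.range n :=
    hR.trans ((Finset.filter_subset _ _).trans (Finset.filter_subset _ _))
  refine ⟨?_, ?_⟩
  · rw [hW]
    exact hB.weight e he (a + 1) ha j hj R hRn z (hz.symm.imp And.left id)
  · rw [hM]
    exact (mask_lt fun i hi => Finset.mem_range.1 (hRn hi)).trans
      (Nat.pow_lt_pow_right one_lt_two hB.n_lt)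

variable [IsStrictOrderedRing K]

theorem relaxAll_spec (hB : Budget 𝓢 B L n N G c f γ) (hσ : Guess n N c f e a j σ) (he : e < n)
    (ha : a < n * N) (hj : j < n) (hT : σ.val Reg.T 0 = guessThreshold c f N e a j) {k : ℕ}
    (hkn : k < n) (hkσ : σ.int Reg.k 0 = k)
    (hk : k ∈ admissible c f n (f e) ((a + 1 : ℕ) * (f e / N)) (guessThreshold c f N e a j))
    (hcells : ∀ s ≤ a + 1, IsGuessCell n N c f e a j k s σ) :
    Runs 𝓢 B L relaxAll σ fun τ => ∀ s ≤ a + 1, IsGuessCell n N c f e a j (k + 1) s τ := by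
  have haL : a + 2 ≤ L := cells_eval hB ha
  refine Runs.seq (Runs.mono (Q := fun τ =>
    τ.val Reg.w 0 = max (c k / f k) (guessThreshold c f N e a j) ∧
      τ.val Reg.W = σ.val Reg.W) ?_ fun τ hτ h => ?_)
  · have hfit : 𝓢.Fits B (max (c k / f k) (guessThreshold c f N e a j)) := by
      have h := hB.weight e he (a + 1) ha j hj {k} (by simpa using hkn) 0 (Or.inl rfl)
      rwa [zero_add, Finset.sum_singleton] at h
    refine Runs.cond (fun hb => ?_) fun hb => ?_
    · simp only [Test.Holds, ValExpr.eval, IntExpr.eval, hkσ, hT, hσ.price_eq k hkn] at hb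
      rw [max_eq_right hb.le] at hfit ⊢
      refine Runs.setVal ?_ ?_
      · simpa [hT] using hfit
      · simp +decide [hT]
    · simp only [Test.Holds, ValExpr.eval, IntExpr.eval, hkσ, hT, hσ.price_eq k hkn, not_lt] at hb
      rw [max_eq_left hb] at hfit ⊢
      refine Runs.setVal ?_ ?_
      · simpa [hkσ, hσ.price_eq k hkn] using hfit
      · simp +decide [hkσ, hσ.price_eq k hkn]
  obtain ⟨hw, hW⟩ := h
  have hσ' : Guess n N c f e a j τ := hσ.frame hτ (by decide) (by decide)
  have hkτ : τ.int Reg.k 0 = k := by rw [hτ.int _ (by decide), hkσ]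
  have hcells : ∀ s ≤ a + 1, IsGuessCell n N c f e a j k s τ := by
    intro s hs
    rw [IsGuessCell, hW, hτ.int _ (by decide)]
    exact hcells s hs
  clear hτ hW hkσ hT hσ
  -- The cells are updated in place from `a + 1` downwards; after `t` rounds exactly the cells `s`
  -- with `a + 1 < s + t` have taken `k` into account.
  refine Runs.forLoop (a + 2) haL (hB.lt_two_pow haL) (by decide) (fun υ hυ => ?_)
    (fun t υ => ∀ s ≤ a + 1, IsGuessCell n N c f e a j (if a + 1 < s + t then k + 1 else k) s υ)
    ?_ ?_ ?_
  · simp only [IntExpr.eval]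
    rw [hυ.int _ (by decide), hσ'.a_eq]
  · intro s hs
    rw [if_neg (by omega)]
    exact hcells s hs
  · intro t ht υ hυ htυ h
    have hυ' : Guess n N c f e a j υ := hσ'.frame hυ (by decide) (by decide)
    have hkυ : υ.int Reg.k 0 = k := by rw [hυ.int _ (by decide), hkτ]
    have hwυ : υ.val Reg.w 0 = max (c k / f k) (guessThreshold c f N e a j) := by
      rw [hυ.val _ (by decide), hw]
    set s := a + 1 - t with hs
    have hcur : current.eval υ = s := by
      simp only [IntExpr.eval, hυ'.a_eq, htυ, hs]
    have hprev : previous.eval υ = s - units f (f e / N) N k := by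
      rw [previous, IntExpr.eval, hcur]
      simp only [IntExpr.eval, hkυ, hυ'.units_eq k hkn]
    have hc₁ := h s (by omega)
    have hc₂ := h (s - units f (f e / N) N k) (by omega)
    -- Neither the current cell nor the one `units` below it has been updated yet. If `k` has zero
    -- units, they are the same cell.
    rw [if_neg (by omega)] at hc₁ hc₂
    have haug : augmented.eval υ = max (c k / f k) (guessThreshold c f N e a j) +
        υ.val Reg.W (s - units f (f e / N) N k) := by
      rw [augmented, ValExpr.eval, ValExpr.eval, ValExpr.eval, hprev]
      simp only [IntExpr.eval, hwυ]
    refine Runs.cond (fun hb => ?_) fun hb => ?_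
    · rw [Test.Holds, haug, ValExpr.eval, hcur] at hb
      have hnew := hc₁.relax hc₂ hk hb
      obtain ⟨hf₁, hf₂⟩ := hB.fits_cell he ha hj hnew
      refine Runs.seq (Runs.setVal ?_ ?_)
      · rw [haug]
        exact hf₁
      rw [hcur, haug]
      -- Overwriting the weight does not affect the masks, so the mask of the predecessor is still
      -- the old one.
      have hmask : ∀ x : K, (IntExpr.add (.cell Reg.masks previous)
          (.cell Reg.pow (ivar Reg.k))).eval (υ.setVal Reg.W s x) =
          υ.int Reg.masks (s - units f (f e / N) N k) + 2 ^ k := by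
        intro x
        have : previous.eval (υ.setVal Reg.W s x) = s - units f (f e / N) N k := hprev
        rw [IntExpr.eval, IntExpr.eval, IntExpr.eval, this]
        simp only [IntExpr.eval, Store.setVal_int, hkυ, hυ'.pow_eq k hkn]
      refine Runs.setInt ?_ ?_
      · rw [hmask]
        exact hf₂
      · rw [hmask]
        have : ∀ x : K, current.eval (υ.setVal Reg.W s x) = s := fun x => hcur
        rw [this]
        intro s' hs'
        simp +decide only [IsGuessCell, Store.setVal_int, Store.setInt_int_of_ne,
          Store.setInt_val, ne_eq, Store.setInt_int_self, Store.setVal_val_self]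
        by_cases hss : s' = s
        · rw [if_pos hss, if_pos hss, if_pos (by omega), hss]
          exact hnew
        · rw [if_neg hss, if_neg hss]
          have hiff : a + 1 < s' + t ↔ a + 1 < s' + (t + 1) := by omega
          simpa only [hiff] using h s' hs'
    · rw [Test.Holds, haug, ValExpr.eval, hcur, not_lt] at hb
      have hnew := hc₁.keep hc₂ hk hb
      refine Runs.skip fun s' hs' => ?_
      simp +decide only [IsGuessCell, Store.setInt_int_of_ne, Store.setInt_val, ne_eq]
      by_cases hss : s' = s
      · rw [if_pos (by omega), hss]
        exact hnew
      · have hiff : a + 1 < s' + t ↔ a + 1 < s' + (t + 1) := by omega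
        simpa only [hiff] using h s' hs'
  · intro υ _ h s hs
    have := h s hs
    rwa [if_pos (by omega)] at this

theorem considerAgent_spec (hB : Budget 𝓢 B L n N G c f γ) (hσ : Guess n N c f e a j σ) (he : e < n)
    (ha : a < n * N) (hj : j < n) (hT : σ.val Reg.T 0 = guessThreshold c f N e a j) {k : ℕ}
    (hkn : k < n) (hkσ : σ.int Reg.k 0 = k)
    (hcells : ∀ s ≤ a + 1, IsGuessCell n N c f e a j k s σ) :
    Runs 𝓢 B L considerAgent σ fun τ => ∀ s ≤ a + 1, IsGuessCell n N c f e a j (k + 1) s τ := by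
  have hskip : k ∉ admissible c f n (f e) ((a + 1 : ℕ) * (f e / N)) (guessThreshold c f N e a j) →
      Runs 𝓢 B L .skip σ fun τ => ∀ s ≤ a + 1, IsGuessCell n N c f e a j (k + 1) s τ :=
    fun h => Runs.skip fun s hs => (hcells s hs).succ_of_notMem h
  refine Runs.cond (fun h₁ => hskip ?_) fun h₁ => Runs.cond (fun h₂ => hskip ?_) fun h₂ =>
    Runs.cond (fun h₃ => hskip ?_) fun h₃ => ?_
  · simp only [Test.Holds, ValExpr.eval, IntExpr.eval, hkσ, hσ.reward_eq, hσ.cost_eq] at h₁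
    simp only [admissible, Finset.mem_filter, not_and, not_le]
    exact fun _ h => absurd h (not_le.2 h₁)
  · simp only [Test.Holds, ValExpr.eval, IntExpr.eval, hkσ, hσ.reward_eq, hσ.e_eq] at h₂
    simp only [admissible, Finset.mem_filter, not_and, not_le]
    exact fun _ _ h => absurd h (not_le.2 h₂)
  · simp only [Test.Holds, ValExpr.eval, IntExpr.eval, hkσ, hσ.price_eq k hkn, hσ.cost_eq, hσ.x_eq,
      hT] at h₃
    simp only [admissible, Finset.mem_filter, not_and, not_le]
    exact fun _ _ _ => h₃
  · simp only [Test.Holds, ValExpr.eval, IntExpr.eval, hkσ, hσ.price_eq k hkn, hσ.cost_eq, hσ.x_eq,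
      hσ.reward_eq, hσ.e_eq, hT, not_lt] at h₁ h₂ h₃
    exact relaxAll_spec hB hσ he ha hj hT hkn hkσ
      (Finset.mem_filter.2 ⟨Finset.mem_range.2 hkn, h₁, h₂, h₃⟩) hcells

theorem lightestTeam_spec (hB : Budget 𝓢 B L n N G c f γ) (hc : ∀ k < n, 0 < c k)
    (hσ : Guess n N c f e a j σ) (he : e < n) (ha : a < n * N) (hj : j < n) :
    Runs 𝓢 B L lightestTeam σ fun τ =>
      ∃ R, IsLightestFor n N c f e a j R ∧ τ.int Reg.cand 0 = mask R := by
  have hT : (ValExpr.sub (.cell Reg.price (ivar Reg.j))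
      (.div (.cell Reg.cost (ivar Reg.j)) (vvar Reg.x))).eval σ = guessThreshold c f N e a j := by
    simp only [ValExpr.eval, IntExpr.eval, hσ.j_eq, hσ.price_eq j hj, hσ.cost_eq, hσ.x_eq,
      guessThreshold]
  refine Runs.seq (Runs.setVal ?_ ?_)
  · rw [hT]
    exact hB.threshold e he (a + 1) ha j hj
  rw [hT]
  set σ₁ := σ.setVal Reg.T ((IntExpr.const 0).eval σ) (guessThreshold c f N e a j) with hσ₁
  have hg₁ : Guess n N c f e a j σ₁ := hσ.congr (fun _ _ => rfl) fun b hb =>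
    Store.setVal_val_of_ne _ _ _ _ _ (by rintro rfl; revert hb; decide)
  have hT₁ : σ₁.val Reg.T 0 = guessThreshold c f N e a j := by simp [hσ₁]
  clear_value σ₁
  refine Runs.seq ((initCells_spec hB hg₁ ha).mono fun σ₂ hf₂ h₂ => ?_)
  have hg₂ : Guess n N c f e a j σ₂ := hg₁.frame hf₂ (by decide) (by decide)
  have hT₂ : σ₂.val Reg.T 0 = guessThreshold c f N e a j := by rw [hf₂.val _ (by decide), hT₁]
  refine Runs.seq (Runs.forLoop n hB.n_le (hB.lt_two_pow hB.n_le) (by decide) (fun τ hτ => ?_)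
    (fun k τ => ∀ s ≤ a + 1, IsGuessCell n N c f e a j k s τ) ?_ ?_ ?_)
  · simp only [IntExpr.eval]
    rw [hτ.int _ (by decide), hg₂.n_eq]
  · simpa +decide [IsGuessCell] using h₂
  · intro k hk τ hτ hkτ h
    have hg : Guess n N c f e a j τ := hg₂.frame hτ (by decide) (by decide)
    refine (considerAgent_spec hB hg he ha hj ?_ hk hkτ h).mono fun υ _ h => ?_
    · rw [hτ.val _ (by decide), hT₂]
    · simpa +decide [IsGuessCell] using h
  · intro τ hτ h
    have hg : Guess n N c f e a j τ := hg₂.frame hτ (by decide) (by decide)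
    -- The guessed level is `a + 1` units, hence the top cell.
    have hcell := h (a + 1) le_rfl
    have hM : (IntExpr.cell Reg.masks (.add (ivar Reg.a) (.const 1))).eval τ =
        τ.int Reg.masks (a + 1) := by
      simp only [IntExpr.eval, hg.a_eq]
    obtain ⟨R, hR, hR'⟩ := hcell.isLightest hc
    refine Runs.setInt ?_ ⟨R, hR', ?_⟩
    · rw [hM]
      exact (hB.fits_cell he ha hj hcell).2
    · rw [hM]
      simpa using hR

end Specifications

/-! ## The algorithm -/

/-- Evaluates all teams with a single member. -/
def trySingletons : Prog :=
  .forLoop Reg.k (ivar Reg.n) <|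
    .cond (.valLt (.cell Reg.reward (ivar Reg.k)) (.cell Reg.cost (ivar Reg.k))) .skip <|
      .seq (.setInt Reg.cand (.const 0) (.cell Reg.pow (ivar Reg.k))) evaluate

/-- Evaluates the lightest teams for the current level of the total reward. -/
def tryLevel : Prog := .forLoop Reg.j (ivar Reg.n) (.seq lightestTeam evaluate)

/-- Evaluates the lightest teams for the current agent with the largest individual reward. -/
def tryLevels : Prog :=
  .seq (.setVal Reg.x (.const 0) (.const 0)) <|
  .forLoop Reg.a (ivar Reg.levels) <|
    .seq (.setVal Reg.x (.const 0) (.add (vvar Reg.x) (vvar Reg.delta))) tryLevel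

/-- Evaluates the lightest teams for all guesses. -/
def tryGuesses : Prog :=
  .forLoop Reg.e (ivar Reg.n) <|
    .cond (.valLt (.cell Reg.reward (ivar Reg.e)) (.cell Reg.cost (ivar Reg.e))) .skip <|
      .seq roundRewards tryLevels

/-- Computes the ratios of cost and reward and the powers of two. -/
def computePrices : Prog :=
  .seq (.setInt Reg.double (.const 0) (.const 1)) <|
  .forLoop Reg.i (ivar Reg.n) <|
    .seq (.setVal Reg.price (ivar Reg.i)
      (.div (.cell Reg.cost (ivar Reg.i)) (.cell Reg.reward (ivar Reg.i)))) <|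
    .seq (.setInt Reg.pow (ivar Reg.i) (ivar Reg.double))
      (.setInt Reg.double (.const 0) (.add (ivar Reg.double) (ivar Reg.double)))

/-- Computes the least integer that is at least `1 / γ`. -/
def invertGamma : Prog :=
  .loop (.valLt (vvar Reg.acc) (.const 1)) <|
    .seq (.setVal Reg.acc (.const 0) (.add (vvar Reg.acc) (vvar Reg.gamma))) <|
    .seq (.setInt Reg.G (.const 0) (.add (ivar Reg.G) (.const 1)))
      (.setVal Reg.valG (.const 0) (.add (vvar Reg.valG) (.const 1)))

/-- Computes the number of units and the number of levels. -/
def computeLevels : Prog :=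
  .seq (.forLoop Reg.i (ivar Reg.n) <|
    .seq (.setInt Reg.N (.const 0) (.add (ivar Reg.N) (ivar Reg.G)))
      (.setVal Reg.valN (.const 0) (.add (vvar Reg.valN) (vvar Reg.valG)))) <|
  .forLoop Reg.i (ivar Reg.n) <|
    .setInt Reg.levels (.const 0) (.add (ivar Reg.levels) (ivar Reg.N))

/-- Writes the cheapest fair contract for the best team. -/
def writeContract : Prog :=
  .seq (.setInt Reg.cand (.const 0) (ivar Reg.best)) <|
  .seq evaluate <|
  .forLoop Reg.i (ivar Reg.n) <|
    .cond marked
      (.seq (.setInt Reg.team (ivar Reg.i) (.const 1))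
        (.cond (.valLt (.cell Reg.price (ivar Reg.i)) (vvar Reg.thr))
          (.setVal Reg.share (ivar Reg.i) (vvar Reg.thr))
          (.setVal Reg.share (ivar Reg.i) (.cell Reg.price (ivar Reg.i)))))
      .skip

/-- The approximation scheme for fair contracts. -/
def fptas : Prog :=
  .seq computePrices <| .seq invertGamma <| .seq computeLevels <|
  .seq trySingletons <| .seq tryGuesses writeContract

/-! ### Correctness of the whole program -/

section Specifications

variable {K : Type} [Field K] [LinearOrder K] {m : CostModel K} {𝓢 : SizeModel K m}
  {B L n N G e a : ℕ} {c f : ℕ → K} {γ : K} {σ : Store K}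

/-- A best candidate of revenue at least `r` is stored. -/
def BestAtLeast (n : ℕ) (c f : ℕ → K) (r : K) (σ : Store K) : Prop :=
  HasBest n c f σ ∧ r ≤ σ.val Reg.bestRev 0

theorem BestAtLeast.congr {τ : Store K} {r : K} (h : BestAtLeast n c f r σ)
    (hi : τ.int Reg.best = σ.int Reg.best) (hv : τ.val Reg.bestRev = σ.val Reg.bestRev) :
    BestAtLeast n c f r τ :=
  ⟨h.1.congr hi hv, by rw [hv]; exact h.2⟩

/-- Singletons are the fallback for a guess whose lightest team has a true threshold larger than the
guessed one. -/
theorem trySingletons_spec (hB : Budget 𝓢 B L n N G c f γ) (hσ : Env n N c f σ)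
    (hbest : HasBest n c f σ) :
    Runs 𝓢 B L trySingletons σ fun τ => BestAtLeast n c f (σ.val Reg.bestRev 0) τ ∧
      ∀ k < n, c k ≤ f k → teamRevenue c f {k} ≤ τ.val Reg.bestRev 0 := by
  refine Runs.forLoop n hB.n_le (hB.lt_two_pow hB.n_le) (by decide) (fun τ hτ => ?_)
    (fun k τ => BestAtLeast n c f (σ.val Reg.bestRev 0) τ ∧
      ∀ k' < k, c k' ≤ f k' → teamRevenue c f {k'} ≤ τ.val Reg.bestRev 0) ?_ ?_ ?_
  · simp only [IntExpr.eval]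
    rw [hτ.int _ (by decide), hσ.n_eq]
  · exact ⟨⟨hbest.congr (by simp +decide) rfl, le_rfl⟩, by simp⟩
  · rintro k hk τ hτ hkτ ⟨⟨h₁, h₂⟩, h₃⟩
    have hE : Env n N c f τ := hσ.frame hτ (by decide) (by decide)
    refine Runs.cond (fun hb => Runs.skip ⟨⟨h₁.congr (by simp +decide) rfl, h₂⟩, ?_⟩) fun hb => ?_
    · simp only [Test.Holds, ValExpr.eval, IntExpr.eval, hkτ, hE.reward_eq, hE.cost_eq] at hb
      intro k' hk' hv
      rcases Nat.lt_succ_iff_lt_or_eq.1 hk' with h | rfl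
      · exact h₃ k' h hv
      · exact absurd hv (not_le.2 hb)
    · simp only [Test.Holds, ValExpr.eval, IntExpr.eval, hkτ, hE.reward_eq, hE.cost_eq,
        not_lt] at hb
      have hpow : (IntExpr.cell Reg.pow (ivar Reg.k)).eval τ = 2 ^ k := by
        simp only [IntExpr.eval, hkτ, hE.pow_eq k hk]
      refine Runs.seq (Runs.setInt ?_ ?_)
      · rw [hpow]
        exact Nat.pow_lt_pow_right one_lt_two (hk.trans hB.n_lt)
      rw [hpow]
      have hE' : Env n N c f (τ.setInt Reg.cand ((IntExpr.const 0).eval τ) (2 ^ k)) :=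
        hE.congr (fun b hb => Store.setInt_int_of_ne _ _ _ _ _
          (by rintro rfl; revert hb; decide)) fun _ _ => rfl
      refine (evaluate_spec (S := {k}) hB hE' (by simpa [IsValid] using ⟨hk, hb⟩)
        (by simp [mask]) (h₁.congr (by simp +decide) rfl)).mono fun υ hυ h => ?_
      obtain ⟨-, -, h₄, h₅, h₆⟩ := h
      refine ⟨⟨h₄.congr (by simp +decide) rfl, h₂.trans h₅⟩, fun k' hk' hv => ?_⟩
      rcases Nat.lt_succ_iff_lt_or_eq.1 hk' with h | rfl
      · exact (h₃ k' h hv).trans h₅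
      · exact h₆
  · exact fun τ _ h => h

/-- The best candidate is as good as a lightest team for the guess `e`, `a`, `j`. -/
def Covered (n N : ℕ) (c f : ℕ → K) (e a j : ℕ) (σ : Store K) : Prop :=
  ∃ R, IsLightestFor n N c f e a j R ∧ teamRevenue c f R ≤ σ.val Reg.bestRev 0

theorem Covered.mono {j : ℕ} {τ : Store K} (h : Covered n N c f e a j σ)
    (hle : σ.val Reg.bestRev 0 ≤ τ.val Reg.bestRev 0) : Covered n N c f e a j τ :=
  let ⟨R, h₁, h₂⟩ := h
  ⟨R, h₁, h₂.trans hle⟩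

theorem computePrices_spec (hB : Budget 𝓢 B L n N G c f γ) (hn : σ.int Reg.n 0 = n)
    (hcσ : σ.val Reg.cost = c) (hfσ : σ.val Reg.reward = f) :
    Runs 𝓢 B L computePrices σ fun τ => ∀ i < n,
      τ.val Reg.price i = c i / f i ∧ τ.int Reg.pow i = 2 ^ i := by
  have hB1 : 1 < 2 ^ B := Nat.one_lt_two_pow (by have := hB.n_lt; omega)
  refine Runs.seq (Runs.setInt (by simpa using hB1) ?_)
  refine Runs.forLoop n hB.n_le (hB.lt_two_pow hB.n_le) (by decide) (fun τ hτ => ?_)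
    (fun k τ => τ.int Reg.double 0 = 2 ^ k ∧ ∀ i < k,
      τ.val Reg.price i = c i / f i ∧ τ.int Reg.pow i = 2 ^ i) ?_ ?_ ?_
  · simp only [IntExpr.eval]
    rw [hτ.int _ (by decide)]
    simpa +decide using hn
  · simp +decide
  · rintro k hk τ hτ hkτ ⟨h₁, h₂⟩
    have hc : τ.val Reg.cost = c := by rw [hτ.val _ (by decide), Store.setInt_val, hcσ]
    have hf : τ.val Reg.reward = f := by rw [hτ.val _ (by decide), Store.setInt_val, hfσ]
    refine Runs.seq (Runs.setVal ?_ (Runs.seq (Runs.setInt ?_ (Runs.setInt ?_ ?_))))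
    · simpa only [ValExpr.eval, IntExpr.eval, hkτ, hc, hf] using hB.price k hk
    · simp only [IntExpr.eval, Store.setVal_int, h₁]
      exact Nat.pow_lt_pow_right one_lt_two (hk.trans hB.n_lt)
    · simp +decide only [IntExpr.eval, Store.setVal_int, Store.setInt_int_of_ne, ne_eq, h₁]
      rw [← two_mul, ← pow_succ']
      exact Nat.pow_lt_pow_right one_lt_two (by have := hB.n_lt; omega)
    · simp +decide only [IntExpr.eval, ValExpr.eval, Store.setVal_int, Store.setInt_int_of_ne,
        ne_eq, h₁, hkτ, hc, hf, Store.setInt_val, Store.setInt_int_self, Store.setVal_val_self,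
        if_true]
      refine ⟨by rw [← two_mul, ← pow_succ'], fun i hi => ?_⟩
      split_ifs with hik
      · simp [hik]
      · exact h₂ i (by omega)
  · exact fun τ _ h => h.2

/-- The contract stored is the cheapest fair contract for the team `S`. -/
def IsOutput (n : ℕ) (c f : ℕ → K) (S : Finset ℕ) (σ : Store K) : Prop :=
  ∀ i < n, σ.int Reg.team i = (if i ∈ S then 1 else 0) ∧
    σ.val Reg.share i = if i ∈ S then max (c i / f i) (threshold c f S) else 0

/-- The indicator and the threshold of the best team may have been overwritten by later candidates;
a second evaluation restores them. -/
theorem writeContract_spec (hB : Budget 𝓢 B L n N G c f γ) (hσ : Env n N c f σ)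
    (hbest : HasBest n c f σ) (hteam : ∀ i < n, σ.int Reg.team i = 0)
    (hshare : ∀ i < n, σ.val Reg.share i = 0) :
    Runs 𝓢 B L writeContract σ fun τ =>
      ∃ S, IsValid n c f S ∧ teamRevenue c f S = σ.val Reg.bestRev 0 ∧ IsOutput n c f S τ := by
  obtain ⟨S, hS, hbi, hbr⟩ := hbest
  have hB1 : 1 < 2 ^ B := Nat.one_lt_two_pow (by have := hB.n_lt; omega)
  refine Runs.seq (Runs.setInt ?_ ?_)
  · simp only [IntExpr.eval, hbi]
    exact (mask_lt fun i hi => (hS i hi).1).trans (Nat.pow_lt_pow_right one_lt_two hB.n_lt)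
  have hE₁ : Env n N c f (σ.setInt Reg.cand ((IntExpr.const 0).eval σ)
      ((ivar Reg.best).eval σ)) :=
    hσ.congr (fun b hb => Store.setInt_int_of_ne _ _ _ _ _
      (by rintro rfl; revert hb; decide)) fun _ _ => rfl
  refine Runs.seq ((evaluate_spec hB hE₁ hS (by simpa using hbi)
    ⟨S, hS, by simpa +decide using hbi, hbr⟩).mono fun τ hτ h => ?_)
  obtain ⟨hmark, hthr, -⟩ := h
  have hE : Env n N c f τ := hE₁.frame hτ (by decide) (by decide)
  have hteamτ : ∀ i < n, τ.int Reg.team i = 0 := by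
    rw [hτ.int _ (by decide)]
    simpa +decide using hteam
  have hshareτ : ∀ i < n, τ.val Reg.share i = 0 := by
    rw [hτ.val _ (by decide)]
    simpa +decide using hshare
  refine Runs.forLoop n hB.n_le (hB.lt_two_pow hB.n_le) (by decide) (fun υ hυ => ?_)
    (fun k υ => ∀ i < n,
      υ.int Reg.team i = (if i < k ∧ i ∈ S then 1 else 0) ∧
      υ.val Reg.share i = if i < k ∧ i ∈ S then max (c i / f i) (threshold c f S) else 0) ?_ ?_ ?_
  · simp only [IntExpr.eval]
    rw [hυ.int _ (by decide), hE.n_eq]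
  · intro i hi
    simpa +decide using ⟨hteamτ i hi, hshareτ i hi⟩
  · intro k hk υ hυ hkυ h
    have hmk : υ.int Reg.mark k = if k ∈ S then 1 else 0 := by
      rw [hυ.int _ (by decide), hmark k hk]
    have hp : υ.val Reg.price k = c k / f k := by rw [hυ.val _ (by decide), hE.price_eq k hk]
    have ht : υ.val Reg.thr 0 = threshold c f S := by rw [hυ.val _ (by decide), hthr]
    have hlt : ∀ i, i ≠ k → (i < k + 1 ∧ i ∈ S ↔ i < k ∧ i ∈ S) := fun i hi => by
      rw [Nat.lt_succ_iff_lt_or_eq]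
      tauto
    refine Runs.cond (fun hb => ?_) fun hb => Runs.skip fun i hi => ?_
    · simp only [Test.Holds, IntExpr.eval, hkυ, hmk] at hb
      have hkS : k ∈ S := by
        by_contra hkS
        simp [hkS] at hb
      have hfit : 𝓢.Fits B (max (c k / f k) (threshold c f S)) :=
        𝓢.max (hB.price k hk) (𝓢.foldMax _ fun i hi => hB.envy S hS.subset i (hS i hi).1)
      have hupd : ∀ x, x = max (c k / f k) (threshold c f S) → ∀ i < n,
          ((((υ.setInt Reg.team k 1).setVal Reg.share k x).setInt Reg.i 0 (k + 1)).int Reg.team i =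
            if i < k + 1 ∧ i ∈ S then 1 else 0) ∧
          ((((υ.setInt Reg.team k 1).setVal Reg.share k x).setInt Reg.i 0 (k + 1)).val Reg.share i =
            if i < k + 1 ∧ i ∈ S then max (c i / f i) (threshold c f S) else 0) := by
        rintro x rfl i hi
        simp +decide only [Store.setInt_int_of_ne, ne_eq, Store.setVal_int, Store.setInt_val,
          Store.setInt_int_self, Store.setVal_val_self]
        by_cases hik : i = k
        · subst hik
          simp [hkS]
        · rw [if_neg hik, if_neg hik]
          simpa only [hlt i hik] using h i hi
      refine Runs.seq (Runs.setInt (by simpa using hB1) ?_)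
      simp only [IntExpr.eval, hkυ]
      refine Runs.cond (fun hb' => ?_) fun hb' => ?_
      · simp +decide [hkυ, hp, ht] at hb'
        rw [max_eq_right hb'.le] at hfit
        refine Runs.setVal ?_ ?_ <;>
          simp +decide only [ValExpr.eval, IntExpr.eval, Store.setInt_val,
            Store.setInt_int_of_ne, ne_eq, hkυ, ht]
        · exact hfit
        · exact hupd _ (max_eq_right hb'.le).symm
      · simp +decide [hkυ, hp, ht] at hb'
        rw [max_eq_left hb'] at hfit
        refine Runs.setVal ?_ ?_ <;>
          simp +decide only [ValExpr.eval, IntExpr.eval, Store.setInt_val,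
            Store.setInt_int_of_ne, ne_eq, hkυ, hp]
        · exact hfit
        · exact hupd _ (max_eq_left hb').symm
    · simp only [Test.Holds, IntExpr.eval, hkυ, hmk] at hb
      have hkS : k ∉ S := by
        intro hkS
        simp [hkS] at hb
      simp +decide only [Store.setInt_int_of_ne, ne_eq, Store.setInt_val]
      by_cases hik : i = k
      · subst hik
        simpa [hkS] using h i hi
      · simpa only [hlt i hik] using h i hi
  · rintro υ _ h
    refine ⟨S, hS, hbr.symm, fun i hi => ?_⟩
    simpa [hi] using h i hi

variable [IsStrictOrderedRing K]

theorem tryLevel_spec (hB : Budget 𝓢 B L n N G c f γ) (hc : ∀ k < n, 0 < c k)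
    (hσ : Env n N c f σ) (he : e < n) (ha : a < n * N) (heσ : σ.int Reg.e 0 = e)
    (haσ : σ.int Reg.a 0 = a) (hxσ : σ.val Reg.x 0 = (a + 1 : ℕ) * (f e / N))
    (hu : ∀ k < n, σ.int Reg.units k = units f (f e / N) N k) (hbest : HasBest n c f σ) :
    Runs 𝓢 B L tryLevel σ fun τ => BestAtLeast n c f (σ.val Reg.bestRev 0) τ ∧
      ∀ j < n, Covered n N c f e a j τ := by
  refine Runs.forLoop n hB.n_le (hB.lt_two_pow hB.n_le) (by decide) (fun τ hτ => ?_)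
    (fun k τ => BestAtLeast n c f (σ.val Reg.bestRev 0) τ ∧ ∀ j < k, Covered n N c f e a j τ)
    ?_ ?_ ?_
  · simp only [IntExpr.eval]
    rw [hτ.int _ (by decide), hσ.n_eq]
  · exact ⟨⟨hbest.congr (by simp +decide) rfl, le_rfl⟩, by simp⟩
  · rintro j hj τ hτ hjτ ⟨⟨h₁, h₂⟩, h₃⟩
    have hg : Guess n N c f e a j τ :=
      { toEnv := hσ.frame hτ (by decide) (by decide)
        e_eq := by rw [hτ.int _ (by decide), heσ]
        a_eq := by rw [hτ.int _ (by decide), haσ]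
        j_eq := hjτ
        x_eq := by rw [hτ.val _ (by decide), hxσ]
        units_eq := by rw [hτ.int _ (by decide)]; exact hu }
    refine Runs.seq ((lightestTeam_spec hB hc hg he ha hj).mono fun υ hυ h => ?_)
    obtain ⟨R, hR, hcand⟩ := h
    have hv : υ.val Reg.bestRev = τ.val Reg.bestRev := hυ.val _ (by decide)
    refine (evaluate_spec hB (hg.toEnv.frame hυ (by decide) (by decide)) hR.isValid hcand
      (h₁.congr (hυ.int _ (by decide)) hv)).mono fun ω hω h => ?_
    obtain ⟨-, -, h₄, h₅, h₆⟩ := h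
    rw [hv] at h₅
    refine ⟨⟨h₄.congr (by simp +decide) rfl, h₂.trans h₅⟩, fun j' hj' => ?_⟩
    rcases Nat.lt_succ_iff_lt_or_eq.1 hj' with h | rfl
    · exact (h₃ j' h).mono h₅
    · exact ⟨R, hR, h₆⟩
  · exact fun τ _ h => h

theorem tryLevels_spec (hB : Budget 𝓢 B L n N G c f γ) (hc : ∀ k < n, 0 < c k)
    (hσ : Env n N c f σ) (he : e < n) (heσ : σ.int Reg.e 0 = e)
    (hδ : σ.val Reg.delta 0 = f e / N)
    (hu : ∀ k < n, σ.int Reg.units k = units f (f e / N) N k) (hbest : HasBest n c f σ) :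
    Runs 𝓢 B L tryLevels σ fun τ => BestAtLeast n c f (σ.val Reg.bestRev 0) τ ∧
      ∀ a < n * N, ∀ j < n, Covered n N c f e a j τ := by
  have hL : n * N ≤ L := hB.levels_lt.le
  refine Runs.seq (Runs.setVal (by simpa using hB.fits_zero) ?_)
  -- `x` is advanced before the level is tried, so round `a` works at level `a + 1`, as a nonempty
  -- team has at least one unit.
  refine Runs.forLoop (n * N) hL (hB.lt_two_pow hL) (by decide) (fun τ hτ => ?_)
    (fun a τ => τ.val Reg.x 0 = a * (f e / N) ∧ BestAtLeast n c f (σ.val Reg.bestRev 0) τ ∧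
      ∀ a' < a, ∀ j < n, Covered n N c f e a' j τ) ?_ ?_ ?_
  · simp only [IntExpr.eval]
    rw [hτ.int _ (by decide)]
    simpa +decide using hσ.levels_eq
  · refine ⟨by simp, ⟨hbest.congr (by simp +decide) (by simp +decide), ?_⟩, by simp⟩
    simp +decide
  · rintro a ha τ hτ haτ ⟨hx, ⟨h₁, h₂⟩, h₃⟩
    have hE : Env n N c f τ := by
      refine (hσ.congr (τ := σ.setVal Reg.x _ _) (fun _ _ => rfl) fun b hb => ?_).frame hτ
        (by decide) (by decide)
      exact Store.setVal_val_of_ne _ _ _ _ _ (by rintro rfl; revert hb; decide)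
    have hδτ : τ.val Reg.delta 0 = f e / N := by
      rw [hτ.val _ (by decide)]
      simpa +decide using hδ
    have hxτ : (ValExpr.add (vvar Reg.x) (vvar Reg.delta)).eval τ = (a + 1 : ℕ) * (f e / N) := by
      simp only [ValExpr.eval, IntExpr.eval, hx, hδτ]
      push_cast
      ring
    refine Runs.seq (Runs.setVal ?_ ?_)
    · rw [hxτ]
      exact hB.level e he _ ha
    rw [hxτ]
    have hE' : Env n N c f (τ.setVal Reg.x ((IntExpr.const 0).eval τ)
        ((a + 1 : ℕ) * (f e / N))) := hE.congr (fun _ _ => rfl) fun b hb =>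
      Store.setVal_val_of_ne _ _ _ _ _ (by rintro rfl; revert hb; decide)
    refine (tryLevel_spec (e := e) (a := a) hB hc hE' he ha ?_ haτ
      (by simp) ?_ (h₁.congr rfl (by simp +decide))).mono fun υ hυ h => ?_
    · simp only [Store.setVal_int]
      rw [hτ.int _ (by decide)]
      simpa +decide using heσ
    · simp only [Store.setVal_int]
      rw [hτ.int _ (by decide)]
      simpa +decide using hu
    · obtain ⟨⟨h₄, h₅⟩, h₆⟩ := h
      simp +decide only [Store.setVal_val_of_ne, ne_eq] at h₅
      refine ⟨?_, ⟨h₄.congr (by simp +decide) rfl, h₂.trans h₅⟩, fun a' ha' j hj => ?_⟩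
      · simp only [Store.setInt_val]
        rw [hυ.val _ (by decide)]
        simp
      · rcases Nat.lt_succ_iff_lt_or_eq.1 ha' with h | rfl
        · exact (h₃ a' h j hj).mono h₅
        · exact h₆ j hj
  · exact fun τ _ h => h.2

theorem tryGuesses_spec (hB : Budget 𝓢 B L n N G c f γ) (hc : ∀ k < n, 0 < c k)
    (hσ : Env n N c f σ) (hbest : HasBest n c f σ) :
    Runs 𝓢 B L tryGuesses σ fun τ => BestAtLeast n c f (σ.val Reg.bestRev 0) τ ∧
      ∀ e < n, c e ≤ f e → ∀ a < n * N, ∀ j < n, Covered n N c f e a j τ := by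
  refine Runs.forLoop n hB.n_le (hB.lt_two_pow hB.n_le) (by decide) (fun τ hτ => ?_)
    (fun k τ => BestAtLeast n c f (σ.val Reg.bestRev 0) τ ∧
      ∀ e < k, c e ≤ f e → ∀ a < n * N, ∀ j < n, Covered n N c f e a j τ) ?_ ?_ ?_
  · simp only [IntExpr.eval]
    rw [hτ.int _ (by decide), hσ.n_eq]
  · exact ⟨⟨hbest.congr (by simp +decide) rfl, le_rfl⟩, by simp⟩
  · rintro e he τ hτ heτ ⟨⟨h₁, h₂⟩, h₃⟩
    have hE : Env n N c f τ := hσ.frame hτ (by decide) (by decide)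
    refine Runs.cond (fun hb => Runs.skip ⟨⟨h₁.congr (by simp +decide) rfl, h₂⟩, ?_⟩) fun hb => ?_
    · simp only [Test.Holds, ValExpr.eval, IntExpr.eval, heτ, hE.reward_eq, hE.cost_eq] at hb
      intro e' he' hv
      rcases Nat.lt_succ_iff_lt_or_eq.1 he' with h | rfl
      · exact h₃ e' h hv
      · exact absurd hv (not_le.2 hb)
    · refine Runs.seq ((roundRewards_spec hB hE he heτ).mono fun υ hυ h => ?_)
      have hv : υ.val Reg.bestRev = τ.val Reg.bestRev := hυ.val _ (by decide)
      refine (tryLevels_spec hB hc (hE.frame hυ (by decide) (by decide)) he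
        (by rw [hυ.int _ (by decide), heτ]) h.1 h.2
        (h₁.congr (hυ.int _ (by decide)) hv)).mono fun ω hω h' => ?_
      obtain ⟨⟨h₄, h₅⟩, h₆⟩ := h'
      rw [hv] at h₅
      refine ⟨⟨h₄.congr (by simp +decide) rfl, h₂.trans h₅⟩, fun e' he' hv' => ?_⟩
      rcases Nat.lt_succ_iff_lt_or_eq.1 he' with h | rfl
      · exact fun a ha j hj => (h₃ e' h hv' a ha j hj).mono h₅
      · exact h₆
  · exact fun τ _ h => h

/-- Adding `γ` until `1` is reached finds `⌈1 / γ⌉` without rounding. The count is kept both as an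
integer and as a field element, because the machine cannot convert one into the other. -/
theorem invertGamma_spec (hB : Budget 𝓢 B L n N G c f γ) (hG : 1 ≤ G * γ)
    (hG' : ∀ k < G, k * γ < 1) (hγ : σ.val Reg.gamma 0 = γ) (hacc : σ.val Reg.acc 0 = 0)
    (hGσ : σ.int Reg.G 0 = 0) (hvσ : σ.val Reg.valG 0 = 0) :
    Runs 𝓢 B L invertGamma σ fun τ => τ.int Reg.G 0 = G ∧ τ.val Reg.valG 0 = G := by
  refine Runs.mono (Q := fun τ => τ.val Reg.acc 0 = G * γ ∧ τ.int Reg.G 0 = G ∧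
    τ.val Reg.valG 0 = G) ?_ fun τ _ h => h.2
  refine Runs.loop G hB.G_le (fun k τ => τ.val Reg.acc 0 = k * γ ∧ τ.int Reg.G 0 = k ∧
    τ.val Reg.valG 0 = k) (by simp [hacc, hGσ, hvσ]) ?_ ?_
  · rintro k hk τ hτ ⟨h₁, h₂, h₃⟩
    have hγτ : τ.val Reg.gamma 0 = γ := by rw [hτ.val _ (by decide), hγ]
    refine ⟨by simpa [h₁] using hG' k hk, ?_⟩
    refine Runs.seq (Runs.setVal ?_ (Runs.seq (Runs.setInt ?_ (Runs.setVal ?_ ?_))))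
    · simp only [ValExpr.eval, IntExpr.eval, h₁, hγτ]
      simpa [add_mul] using hB.clock (k + 1) hk
    · simp only [IntExpr.eval, Store.setVal_int, h₂]
      exact hB.lt_two_pow (by have := hB.G_le; omega)
    · simp +decide only [ValExpr.eval, IntExpr.eval, Store.setInt_val, Store.setVal_val_of_ne,
        ne_eq, h₃]
      simpa using hB.nat (k + 1) (by omega)
    · simp +decide [h₁, h₂, h₃, hγτ, add_mul]
  · rintro τ _ ⟨h₁, -⟩
    simpa [h₁] using hG

theorem computeLevels_spec (hB : Budget 𝓢 B L n (n * G) G c f γ) (hn : σ.int Reg.n 0 = n)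
    (hG : σ.int Reg.G 0 = G) (hvG : σ.val Reg.valG 0 = G) (hN : σ.int Reg.N 0 = 0)
    (hvN : σ.val Reg.valN 0 = 0) (hl : σ.int Reg.levels 0 = 0) :
    Runs 𝓢 B L computeLevels σ fun τ => τ.int Reg.N 0 = n * G ∧
      τ.val Reg.valN 0 = (n * G : ℕ) ∧ τ.int Reg.levels 0 = n * (n * G) := by
  refine Runs.seq (Runs.forLoop n hB.n_le (hB.lt_two_pow hB.n_le) (by decide) (fun τ hτ => ?_)
    (fun k τ => τ.int Reg.N 0 = k * G ∧ τ.val Reg.valN 0 = (k * G : ℕ)) ?_ ?_ ?_)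
  · simp only [IntExpr.eval]
    rw [hτ.int _ (by decide), hn]
  · simp +decide [hN, hvN]
  · rintro k hk τ hτ hkτ ⟨h₁, h₂⟩
    have hGτ : τ.int Reg.G 0 = G := by rw [hτ.int _ (by decide), hG]
    have hvGτ : τ.val Reg.valG 0 = G := by rw [hτ.val _ (by decide), hvG]
    have hle : (k + 1) * G ≤ n * G := Nat.mul_le_mul_right _ hk
    rw [add_mul, one_mul] at hle
    refine Runs.seq (Runs.setInt ?_ (Runs.setVal ?_ ?_))
    · simp only [IntExpr.eval, h₁, hGτ]
      exact hB.lt_two_pow (hle.trans hB.N_le)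
    · simp only [ValExpr.eval, IntExpr.eval, Store.setInt_val, h₂, hvGτ]
      exact_mod_cast hB.nat (k * G + G) (by omega)
    · simp +decide [h₁, h₂, hGτ, hvGτ, add_mul]
  · rintro τ hτ ⟨h₁, h₂⟩
    refine Runs.forLoop n hB.n_le (hB.lt_two_pow hB.n_le) (by decide) (fun υ hυ => ?_)
      (fun k υ => υ.int Reg.levels 0 = k * (n * G)) ?_ ?_ ?_
    · simp only [IntExpr.eval]
      rw [hυ.int _ (by decide), hτ.int _ (by decide), hn]
    · simp +decide only [Store.setInt_int_of_ne, ne_eq]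
      rw [hτ.int _ (by decide), hl, zero_mul]
    · intro k hk υ hυ hkυ h
      have hNυ : υ.int Reg.N 0 = n * G := by rw [hυ.int _ (by decide), h₁]
      have hle : (k + 1) * (n * G) ≤ n * (n * G) := Nat.mul_le_mul_right _ hk
      rw [add_mul, one_mul] at hle
      refine Runs.setInt ?_ ?_
      · simp only [IntExpr.eval, h, hNυ]
        exact hB.lt_two_pow (hle.trans hB.levels_lt.le)
      · simp +decide [h, hNυ, add_mul]
    · intro υ hυ h
      refine ⟨by rw [hυ.int _ (by decide), h₁], by rw [hυ.val _ (by decide), h₂], h⟩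

/-- The algorithm writes an almost optimal contract. -/
theorem fptas_spec (hB : Budget 𝓢 B L n (n * G) G c f γ) (hc : ∀ k < n, 0 < c k)
    (hG : 1 ≤ G * γ) (hG' : ∀ k < G, k * γ < 1) (hγ0 : 0 < γ) (hγ1 : γ ≤ 1)
    (hn : σ.int Reg.n 0 = n) (hint : ∀ a ≠ Reg.n, ∀ i, σ.int a i = 0)
    (hcσ : σ.val Reg.cost = c) (hfσ : σ.val Reg.reward = f) (hγ : σ.val Reg.gamma 0 = γ)
    (hval : ∀ a, Reg.gamma < a → ∀ i, σ.val a i = 0) :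
    Runs 𝓢 B L fptas σ fun τ => ∃ S, IsValid n c f S ∧ IsOutput n c f S τ ∧
      ∀ R, IsValid n c f R → (1 - γ) * teamRevenue c f R ≤ teamRevenue c f S := by
  refine Runs.seq ((computePrices_spec hB hn hcσ hfσ).mono fun σ₁ hf₁ h₁ => ?_)
  refine Runs.seq ((invertGamma_spec hB hG hG' ?_ ?_ ?_ ?_).mono fun σ₂ hf₂ h₂ => ?_)
  · rw [hf₁.val _ (by decide), hγ]
  · rw [hf₁.val _ (by decide), hval _ (by decide)]
  · rw [hf₁.int _ (by decide), hint _ (by decide)]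
  · rw [hf₁.val _ (by decide), hval _ (by decide)]
  refine Runs.seq ((computeLevels_spec hB ?_ h₂.1 h₂.2 ?_ ?_ ?_).mono fun σ₃ hf₃ h₃ => ?_)
  · rw [hf₂.int _ (by decide), hf₁.int _ (by decide), hn]
  · rw [hf₂.int _ (by decide), hf₁.int _ (by decide), hint _ (by decide)]
  · rw [hf₂.val _ (by decide), hf₁.val _ (by decide), hval _ (by decide)]
  · rw [hf₂.int _ (by decide), hf₁.int _ (by decide), hint _ (by decide)]
  have hE : Env n (n * G) c f σ₃ :=
    { n_eq := by rw [hf₃.int _ (by decide), hf₂.int _ (by decide), hf₁.int _ (by decide), hn]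
      N_eq := h₃.1
      levels_eq := h₃.2.2
      pow_eq := fun i hi => by
        rw [hf₃.int _ (by decide), hf₂.int _ (by decide), (h₁ i hi).2]
      cost_eq := by rw [hf₃.val _ (by decide), hf₂.val _ (by decide), hf₁.val _ (by decide), hcσ]
      reward_eq := by
        rw [hf₃.val _ (by decide), hf₂.val _ (by decide), hf₁.val _ (by decide), hfσ]
      price_eq := fun i hi => by
        rw [hf₃.val _ (by decide), hf₂.val _ (by decide), (h₁ i hi).1]
      valN_eq := h₃.2.1 }
  have hbr₃ : σ₃.val Reg.bestRev 0 = 0 := by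
    rw [hf₃.val _ (by decide), hf₂.val _ (by decide), hf₁.val _ (by decide), hval _ (by decide)]
  have hbest₃ : HasBest n c f σ₃ := by
    -- The zeros of the initial store represent the empty team and its revenue.
    refine ⟨∅, by simp [IsValid], ?_, by simp [hbr₃, teamRevenue]⟩
    rw [hf₃.int _ (by decide), hf₂.int _ (by decide), hf₁.int _ (by decide), hint _ (by decide)]
    simp [mask]
  refine Runs.seq ((trySingletons_spec hB hE hbest₃).mono fun σ₄ hf₄ h₄ => ?_)
  have hE₄ : Env n (n * G) c f σ₄ := hE.frame hf₄ (by decide) (by decide)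
  refine Runs.seq ((tryGuesses_spec hB hc hE₄ h₄.1.1).mono fun σ₅ hf₅ h₅ => ?_)
  refine (writeContract_spec hB (hE₄.frame hf₅ (by decide) (by decide)) h₅.1.1
    (fun i _ => ?_) fun i _ => ?_).mono fun τ _ h => ?_
  · rw [hf₅.int _ (by decide), hf₄.int _ (by decide), hf₃.int _ (by decide),
      hf₂.int _ (by decide), hf₁.int _ (by decide), hint _ (by decide)]
  · rw [hf₅.val _ (by decide), hf₄.val _ (by decide), hf₃.val _ (by decide),
      hf₂.val _ (by decide), hf₁.val _ (by decide), hval _ (by decide)]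
  · obtain ⟨S, hS, hrev, hout⟩ := h
    refine ⟨S, hS, hout, fun R hR => ?_⟩
    rw [hrev]
    -- Without agents `N` would be `0`, and the empty team is the only one.
    rcases Nat.eq_zero_or_pos n with rfl | hpos
    · have : R = ∅ := Finset.eq_empty_of_forall_notMem fun k hk => by simpa using (hR k hk).1
      have h0 := h₄.1.2.trans h₅.1.2
      rw [hbr₃] at h0
      simpa [this, teamRevenue] using h0
    have hG0 : 0 < G := by
      rcases Nat.eq_zero_or_pos G with rfl | h
      · norm_num at hG
      · exact h
    refine mul_teamRevenue_le_of_candidates (N := n * G) (Nat.mul_pos hpos hG0) ?_ hγ0 hγ1 hc ?_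
      (fun k hk hv => (h₄.2 k hk hv).trans h₅.1.2) h₅.2 hR
    · push_cast
      rw [mul_assoc]
      exact le_mul_of_one_le_right (Nat.cast_nonneg _) hG
    · exact hbr₃ ▸ h₄.1.2.trans h₅.1.2

end Specifications

/-! ## Correctness and running time -/

section Budget

variable {K : Type} [Field K] [LinearOrder K] {m : CostModel K} {𝓢 : SizeModel K m}
  {n G b M : ℕ} {γ : K}

/-- Every intermediate number is a fixed arithmetic expression in the data and in at most two nested
sums over agents. Each summation costs a factor of about `M`, and the constants are the sums of the
summands `a + b + 1`, all bounded by powers of `M ≥ 1`. -/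
theorem budget_of_le {c f : ℕ → K} (hM : 1 ≤ M) (hn : n ≤ M) (hG : G ≤ M) (hb : b ≤ M)
    (hc : ∀ i < n, 𝓢.Fits b (c i)) (hf : ∀ i < n, 𝓢.Fits b (f i)) (hγ : 𝓢.Fits b γ) :
    Budget 𝓢 (15 * M ^ 4) (M ^ 3 + 1) n (n * G) G c f γ := by
  have h₁₂ : M ≤ M ^ 2 := Nat.le_self_pow two_ne_zero M
  have h₂₃ : M ^ 2 ≤ M ^ 3 := Nat.pow_le_pow_right hM (by norm_num)
  have h₃₄ : M ^ 3 ≤ M ^ 4 := Nat.pow_le_pow_right hM (by norm_num)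
  have hN : n * G ≤ M ^ 2 := by rw [pow_two]; exact Nat.mul_le_mul hn hG
  have hV : n * (n * G) ≤ M ^ 3 := by
    rw [pow_succ', pow_two]
    exact Nat.mul_le_mul hn (Nat.mul_le_mul hn hG)
  have hsum : ∀ (S : Finset ℕ) (s k : ℕ) (x : ℕ → K), S ⊆ Finset.range n →
      (∀ i ∈ S, 𝓢.Fits (s * M ^ k) (x i)) → 𝓢.Fits ((s + 1) * M ^ (k + 1)) (∑ i ∈ S, x i) := by
    intro S s k x hS h
    refine 𝓢.mono ?_ (𝓢.sum S (by simpa using Finset.card_le_card hS) h)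
    have : 1 ≤ M ^ k := Nat.one_le_pow _ _ hM
    calc n * (s * M ^ k + 1) ≤ M * (s * M ^ k + M ^ k) :=
          Nat.mul_le_mul hn (by omega)
      _ = _ := by ring
  have hprice : ∀ i < n, 𝓢.Fits (3 * M) (c i / f i) := fun i hi =>
    𝓢.mono (by omega) (𝓢.div (hc i hi) (hf i hi))
  have hlevel : ∀ e < n, ∀ t ≤ n * (n * G), 𝓢.Fits (5 * M ^ 3) (t * (f e / (n * G : ℕ))) :=
    fun e he t ht => 𝓢.mono (by omega)
      (𝓢.mul (𝓢.natCast t) (𝓢.div (hf e he) (𝓢.natCast (n * G))))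
  have hthr : ∀ e < n, ∀ t ≤ n * (n * G), ∀ j < n,
      𝓢.Fits (11 * M ^ 3) (c j / f j - c j / (t * (f e / (n * G : ℕ)))) :=
    fun e he t ht j hj => 𝓢.mono (by omega)
      (𝓢.sub (hprice j hj) (𝓢.div (hc j hj) (hlevel e he t ht)))
  have hreward : ∀ S ⊆ Finset.range n, 𝓢.Fits (2 * M ^ 2) (∑ k ∈ S, f k) := fun S hS =>
    hsum S 1 1 f hS fun i hi => 𝓢.mono (by simpa using hb) (hf i (Finset.mem_range.1 (hS hi)))
  have henvy : ∀ S ⊆ Finset.range n, ∀ k < n,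
      𝓢.Fits (8 * M ^ 2) (c k / f k - c k / ∑ i ∈ S, f i) := fun S hS k hk =>
    𝓢.mono (by omega) (𝓢.sub (hprice k hk) (𝓢.div (hc k hk) (hreward S hS)))
  have hshares : ∀ S ⊆ Finset.range n, ∀ R ⊆ Finset.range n,
      𝓢.Fits (9 * M ^ 3) (∑ k ∈ R, max (c k / f k) (threshold c f S)) := fun S hS R hR =>
    hsum R 8 2 _ hR fun i hi => 𝓢.max
      (𝓢.mono (by omega) (hprice i (Finset.mem_range.1 (hR hi))))
      (𝓢.foldMax S fun k hk => henvy S hS k (Finset.mem_range.1 (hS hk)))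
  exact
    { n_lt := by omega
      L_lt := (by omega : M ^ 3 + 1 ≤ 15 * M ^ 4).trans_lt Nat.lt_two_pow_self
      G_le := by omega
      N_le := by omega
      n_le := by omega
      levels_lt := by omega
      nat := fun k hk => 𝓢.mono (by omega) (𝓢.natCast k)
      price := fun i hi => 𝓢.mono (by omega) (hprice i hi)
      clock := fun k hk => 𝓢.mono (by omega) (𝓢.mul (𝓢.natCast k) hγ)
      level := fun e he t ht => 𝓢.mono (by omega) (hlevel e he t ht)
      threshold := fun e he t ht j hj => 𝓢.mono (by omega) (hthr e he t ht j hj)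
      weight := fun e he t ht j hj R hR z hz => by
        have hz : 𝓢.Fits 2 z := by
          rcases hz with rfl | rfl
          · exact 𝓢.zero
          · exact_mod_cast 𝓢.natCast 2
        -- The largest bound: `2 + 12 * M ^ 4 + 1 ≤ 15 * M ^ 4`. It explains the constant and the
        -- exponent in the size bound.
        refine 𝓢.mono ?_ (𝓢.add hz (hsum R 11 3 _ hR fun k hk =>
          𝓢.max (𝓢.mono ?_ (hprice k (Finset.mem_range.1 (hR hk)))) (hthr e he t ht j hj)))
        all_goals norm_num
        all_goals omega
      reward := fun S hS => 𝓢.mono (by omega) (hreward S hS)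
      envy := fun S hS k hk => 𝓢.mono (by omega) (henvy S hS k hk)
      shares := fun S hS R hR => 𝓢.mono (by omega) (hshares S hS R hR)
      revenue := fun S hS => by
        have h1 : 𝓢.Fits 1 (1 : K) := by exact_mod_cast 𝓢.natCast 1
        exact 𝓢.mono (by omega) (𝓢.mul (𝓢.sub h1 (hshares S hS S hS)) (hreward S hS)) }

theorem bounded_inputStore {c f : Fin n → K} {B : ℕ} (hn : n < 2 ^ B) (hb : b ≤ B)
    (hc : ∀ i, 𝓢.Fits b (c i)) (hf : ∀ i, 𝓢.Fits b (f i)) (hγ : 𝓢.Fits b γ) :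
    𝓢.Bounded B (inputStore c f γ) := by
  refine ⟨fun a i => ?_, fun a i => ?_⟩
  · simp only [inputStore]
    split_ifs
    · exact hn
    · exact Nat.two_pow_pos B
  · simp only [inputStore]
    refine 𝓢.mono hb ?_
    split_ifs
    exacts [hc _, 𝓢.zero, hf _, 𝓢.zero, hγ, 𝓢.zero]

end Budget

/-! ### From the output of the machine to a real contract -/

theorem extend_map {K : Type} [Field K] {n : ℕ} (ι : K →+* ℝ) {g : Fin n → ℝ} {g' : Fin n → K}
    (h : ∀ i, g i = ι (g' i)) : extend g = fun i => ι (extend g' i) := by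
  funext i
  unfold extend
  split_ifs with hi
  · exact h _
  · exact (map_zero ι).symm

/-- The contract that the algorithm writes is the cheapest fair contract for the best team. -/
theorem outputContract_eq_cheapest {K : Type} [Field K] [LinearOrder K] {n : ℕ}
    {I : TeamInstance n} {c f : Fin n → K} (ι : K →+* ℝ) (hι : Monotone ι)
    (hc : ∀ i, I.cost i = ι (c i)) (hf : ∀ i, I.single i = ι (f i)) {σ : Store K}
    {S : Finset (Fin n)} (h : IsOutput n (extend c) (extend f) (TeamInstance.toNat S) σ) :
    outputContract ι n σ = I.cheapest S := by
  have hmem : ∀ i : Fin n, (i : ℕ) ∈ TeamInstance.toNat S ↔ i ∈ S := fun i => by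
    simp [TeamInstance.toNat, Fin.val_inj]
  ext i
  · simp [outputContract, TeamInstance.cheapest, (h i i.2).1, hmem]
  · simp only [outputContract, TeamInstance.cheapest, (h i i.2).2, hmem, extend_map ι hc,
      extend_map ι hf, ← map_threshold ι hι]
    split_ifs
    · rw [hι.map_max, map_div₀, extend_val, extend_val, hc, hf]
    · exact map_zero ι

/-- On every additive instance the algorithm halts with an almost optimal fair contract. -/
theorem exec_fptas {K : Type} [Field K] [LinearOrder K] [IsStrictOrderedRing K] {m : CostModel K}
    (𝓢 : SizeModel K m) (ι : K →+* ℝ) (hι : StrictMono ι) {n b M : ℕ} {I : TeamInstance n}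
    (hI : I.IsAdditive) {c f : Fin n → K} {γ : K} (hc : ∀ i, I.cost i = ι (c i))
    (hf : ∀ i, I.reward {i} = ι (f i)) (hγ0 : 0 < γ) (hγ1 : γ ≤ 1)
    (hn : n ≤ M) (hb : b ≤ M) (hG : ⌈1 / ι γ⌉₊ ≤ M) (hcb : ∀ i, 𝓢.Fits b (c i))
    (hfb : ∀ i, 𝓢.Fits b (f i)) (hγb : 𝓢.Fits b γ) :
    ∃ t σ, Exec m fptas (inputStore c f γ) t σ ∧
      t ≤ fptas.timeBound (15 * M ^ 4) (M ^ 3 + 1) ∧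
      I.IsApproxOptimalFair ((1 - ι γ) ^ 2) (outputContract ι n σ) := by
  set G := ⌈1 / ι γ⌉₊ with hGdef
  have hιγ : 0 < ι γ := by simpa using hι hγ0
  have hιγ1 : ι γ ≤ 1 := by simpa using hι.monotone hγ1
  have hG1 : 1 ≤ (G : K) * γ := by
    rw [← hι.le_iff_le]
    simpa only [map_one, map_mul, map_natCast] using (div_le_iff₀ hιγ).1 (Nat.le_ceil (1 / ι γ))
  have hGlt : ∀ k < G, (k : K) * γ < 1 := by
    intro k hk
    rw [← hι.lt_iff_lt]
    simpa only [map_one, map_mul, map_natCast] using (lt_div_iff₀ hιγ).1 (Nat.lt_ceil.1 hk)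
  have hG0 : 0 < G := Nat.ceil_pos.2 (by positivity)
  have hM : 1 ≤ M := hG0.trans_le hG
  have hext : ∀ g : Fin n → K, (∀ i, 𝓢.Fits b (g i)) → ∀ i < n, 𝓢.Fits b (extend g i) := by
    intro g hg i hi
    simpa using (extend_val g ⟨i, hi⟩) ▸ hg ⟨i, hi⟩
  have hB : Budget 𝓢 (15 * M ^ 4) (M ^ 3 + 1) n (n * G) G (extend c) (extend f) γ :=
    budget_of_le hM hn hG hb (hext c hcb) (hext f hfb) hγb
  have hcpos : ∀ k < n, 0 < extend c k := by
    intro k hk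
    have := I.cost_pos ⟨k, hk⟩
    rw [hc, ← map_zero ι, hι.lt_iff_lt] at this
    simpa [extend, hk] using this
  have hbB : b ≤ 15 * M ^ 4 := by
    have : M ≤ M ^ 4 := Nat.le_self_pow (by norm_num) M
    omega
  obtain ⟨t, σ, hexec, ht, -, S, hS, hout, hopt⟩ :=
    fptas_spec (σ := inputStore c f γ) hB hcpos hG1 hGlt hγ0 hγ1
      (by simp [inputStore]) (fun a ha i => by simp [inputStore, ha])
      (by funext i; simp [inputStore, extend]) (by funext i; simp [inputStore, extend])
      (by simp [inputStore])
      (fun a ha i => by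
        replace ha : 2 < a := ha
        have h₀ : a ≠ 0 := by omega
        have h₁ : a ≠ 1 := by omega
        have h₂ : ¬ (a = 2 ∧ i = 0) := by omega
        simp only [inputStore, if_neg h₀, if_neg h₁, if_neg h₂])
      (bounded_inputStore (hB.lt_two_pow hB.n_le) hbB hcb hfb hγb)
  refine ⟨t, σ, hexec, ht, ?_⟩
  -- The machine works with agents as natural numbers; validity places them below `n`.
  obtain ⟨S, rfl⟩ : ∃ S' : Finset (Fin n), S = TeamInstance.toNat S' := by
    refine ⟨Finset.univ.filter fun i : Fin n => (i : ℕ) ∈ S, ?_⟩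
    ext k
    simp only [TeamInstance.toNat, Finset.mem_map, Finset.mem_filter, Finset.mem_univ, true_and,
      Fin.valEmbedding_apply]
    exact ⟨fun h => ⟨⟨k, (hS k h).1⟩, h, rfl⟩, by rintro ⟨i, h, rfl⟩; exact h⟩
  have hval : ∀ k, extend c k ≤ extend f k ↔ extend I.cost k ≤ extend I.single k := by
    intro k
    rw [extend_map ι hc, extend_map (g := I.single) ι hf]
    exact hι.le_iff_le.symm
  rw [outputContract_eq_cheapest ι hι.monotone hc hf hout]
  refine TeamInstance.isApproxOptimalFair_cheapest hI (fun i hi => ?_) fun R hR => ?_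
  · simpa using (hval i).1 (hS i (Finset.mem_map_of_mem Fin.valEmbedding hi)).2
  · rw [extend_map ι hc, extend_map (g := I.single) ι hf, ← map_teamRevenue ι hι.monotone,
      ← map_teamRevenue ι hι.monotone]
    have h₁ := hι.monotone (hopt R fun k hk => ⟨(hR k hk).1, (hval k).2 (hR k hk).2⟩)
    -- Comparison with the empty team shows that the revenue obtained is nonnegative; this allows
    -- weakening the factor `1 - γ` to its square.
    have h₂ := hι.monotone (hopt ∅ fun k hk => by simp at hk)
    rw [map_mul, map_sub, map_one] at h₁
    simp only [teamRevenue, Finset.sum_empty, mul_zero, map_zero] at h₂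
    change 0 ≤ ι (teamRevenue (extend c) (extend f) (TeamInstance.toNat S)) at h₂
    have h₃ := mul_le_mul_of_nonneg_left h₁ (sub_nonneg.2 hιγ1)
    nlinarith

/-- `(B + 1) * (L + 1)` is at most `48 * M ^ 7`, and `M ≤ 2 * X` turns this into `48 * 2 ^ 7 = 6144`
times `X ^ 7`. -/
theorem exists_timeBound_le_pow : ∃ C k : ℕ, ∀ (M : ℕ) (X : ℝ), 1 ≤ M → (M : ℝ) ≤ 2 * X →
    ((fptas.timeBound (15 * M ^ 4) (M ^ 3 + 1) : ℕ) : ℝ) ≤ C * X ^ k := by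
  obtain ⟨C, d, h⟩ := fptas.exists_timeBound_le
  refine ⟨C * 6144 ^ d, 7 * d, fun M X hM hX => ?_⟩
  have h₃ : 1 ≤ M ^ 3 := Nat.one_le_pow _ _ hM
  have h₄ : 1 ≤ M ^ 4 := Nat.one_le_pow _ _ hM
  have h₁ : (15 * M ^ 4 + 1) * (M ^ 3 + 1 + 1) ≤ 48 * M ^ 7 :=
    calc (15 * M ^ 4 + 1) * (M ^ 3 + 1 + 1) ≤ (16 * M ^ 4) * (3 * M ^ 3) :=
          Nat.mul_le_mul (by omega) (by omega)
      _ = 48 * M ^ 7 := by ring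
  have h₂ := (h (15 * M ^ 4) (M ^ 3 + 1)).trans
    (Nat.mul_le_mul_left C (Nat.pow_le_pow_left h₁ d))
  calc ((fptas.timeBound (15 * M ^ 4) (M ^ 3 + 1) : ℕ) : ℝ)
      ≤ ((C * (48 * M ^ 7) ^ d : ℕ) : ℝ) := by exact_mod_cast h₂
    _ = C * (48 * (M : ℝ) ^ 7) ^ d := by push_cast; ring
    _ ≤ C * (48 * (2 * X) ^ 7) ^ d := by gcongr
    _ = (C * 6144 ^ d : ℕ) * X ^ (7 * d) := by
      rw [mul_pow 2 X 7, ← mul_assoc, mul_pow, ← pow_mul]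
      push_cast
      norm_num
      ring

end FairTeam

/-- There is one program that, for every additive instance and every `γ ∈ (0, 1]`, halts with a
fair contract of revenue at least `(1 - γ)² · OPT`. On real data it performs a number of elementary
operations polynomial in `n` and `1 / γ`; on rational data its running time under the logarithmic
cost criterion is polynomial in the binary length of the input and `1 / γ`. -/
theorem theorem5p15 :
    ∃ (P : FairTeam.Prog) (C k : ℕ),
      (∀ (n : ℕ) (I : FairTeam.TeamInstance n), I.IsAdditive →
        ∀ γ : ℝ, 0 < γ → γ ≤ 1 →
          ∃ (t : ℕ) (σ : FairTeam.Store ℝ),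
            FairTeam.Exec (FairTeam.unitCost ℝ) P
              (FairTeam.inputStore I.cost (fun i => I.reward {i}) γ) t σ ∧
            (t : ℝ) ≤ C * ((n : ℝ) + 1 / γ) ^ k ∧
            I.IsApproxOptimalFair ((1 - γ) ^ 2) (FairTeam.outputContract id n σ)) ∧
      (∀ (n : ℕ) (I : FairTeam.TeamInstance n), I.IsAdditive →
        ∀ (c f : Fin n → ℚ),
          (∀ i, I.cost i = (c i : ℝ)) → (∀ i, I.reward {i} = (f i : ℝ)) →
        ∀ γ : ℚ, 0 < γ → γ ≤ 1 →
          ∃ (t : ℕ) (σ : FairTeam.Store ℚ),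
            FairTeam.Exec FairTeam.bitCost P (FairTeam.inputStore c f γ) t σ ∧
            (t : ℝ) ≤
              C * ((FairTeam.instanceSize c f : ℝ) + FairTeam.ratBits γ + 1 / (γ : ℝ)) ^ k ∧
            I.IsApproxOptimalFair ((1 - (γ : ℝ)) ^ 2)
              (FairTeam.outputContract (fun q : ℚ => (q : ℝ)) n σ)) := by
  obtain ⟨C, k, hCk⟩ := FairTeam.exists_timeBound_le_pow
  have hceil : ∀ γ : ℝ, 0 < γ → γ ≤ 1 → 1 ≤ ⌈1 / γ⌉₊ ∧ (⌈1 / γ⌉₊ : ℝ) ≤ 1 / γ + 1 ∧ 1 ≤ 1 / γ :=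
    fun γ h0 h1 => ⟨Nat.ceil_pos.2 (by positivity), (Nat.ceil_lt_add_one (by positivity)).le,
      (one_le_div h0).2 h1⟩
  refine ⟨FairTeam.fptas, C, k, fun n I hI γ h0 h1 => ?_, fun n I hI c f hc hf γ h0 h1 => ?_⟩
  · obtain ⟨hG1, hG2, hG3⟩ := hceil γ h0 h1
    obtain ⟨t, σ, hexec, ht, hopt⟩ := FairTeam.exec_fptas (b := 0) (M := n + ⌈1 / γ⌉₊)
      (FairTeam.SizeModel.unit ℝ) (RingHom.id ℝ) strictMono_id hI (fun _ => rfl) (fun _ => rfl)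
      h0 h1 (by omega) (by omega) (by simp) (fun _ => trivial) (fun _ => trivial) trivial
    refine ⟨t, σ, hexec, ?_, hopt⟩
    refine (Nat.cast_le.2 ht).trans (hCk _ _ (by omega) ?_)
    push_cast
    -- The ceiling exceeds `1 / γ` by at most `1`, which is at most `1 / γ`; hence `M ≤ 2 * (n + 1 /
    -- γ)`.
    linarith [Nat.cast_nonneg (α := ℝ) n]
  · have h0' : (0 : ℝ) < γ := by exact_mod_cast h0
    have h1' : (γ : ℝ) ≤ 1 := by exact_mod_cast h1
    obtain ⟨hG1, hG2, hG3⟩ := hceil γ h0' h1'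
    have hsum : ∀ i, FairTeam.ratBits (c i) + FairTeam.ratBits (f i) ≤
        ∑ i, (FairTeam.ratBits (c i) + FairTeam.ratBits (f i)) := fun i =>
      Finset.single_le_sum (f := fun i => FairTeam.ratBits (c i) + FairTeam.ratBits (f i))
        (fun _ _ => Nat.zero_le _) (Finset.mem_univ i)
    set b := FairTeam.instanceSize c f + FairTeam.ratBits γ with hb
    obtain ⟨t, σ, hexec, ht, hopt⟩ := FairTeam.exec_fptas (b := b) (M := b + ⌈1 / (γ : ℝ)⌉₊)
      FairTeam.SizeModel.bit (Rat.castHom ℝ) Rat.cast_strictMono hI hc hf h0 h1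
      (by simp only [hb, FairTeam.instanceSize]; omega) (by omega) (by simp)
      (fun i => FairTeam.ratFits_of_ratBits_le (by
        have := hsum i
        simp only [hb, FairTeam.instanceSize]
        omega))
      (fun i => FairTeam.ratFits_of_ratBits_le (by
        have := hsum i
        simp only [hb, FairTeam.instanceSize]
        omega))
      (FairTeam.ratFits_of_ratBits_le (by omega))
    refine ⟨t, σ, hexec, ?_, hopt⟩
    refine (Nat.cast_le.2 ht).trans (hCk _ _ (by omega) ?_)
    rw [hb]
    push_cast
    linarith [Nat.cast_nonneg (α := ℝ) (FairTeam.instanceSize c f),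
      Nat.cast_nonneg (α := ℝ) (FairTeam.ratBits γ)]
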